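/- Let $(M,h)$ be a smooth, connected, complete four-dimensional Riemannian manifold without boundary, with distance $d_h$, and let $T>0$. Let $\Phi,W:M\times(0,T)\to M$ be smooth maps such that for each $s\in(0,T)$ the maps $\Phi(s)=\Phi(\cdot,s)$ and $W(s)=W(\cdot,s)$ are diffeomorphisms of $M$ inverse to one another, and let $\Phi(0),W(0):M\to M$ be continuous maps inverse to one another such that, for all compact $K\subseteq M$, $$\sup_{x\in K}d_h(\Phi(s)(x),\Phi(0)(x))\to0,\qquad \sup_{y\in K}d_h(W(s)(y),W(0)(y))\to0\qquad\text{as } s\searrow0 .$$ Let $(\ell(s))_{s\in(0,T)}$ and $(g(s))_{s\in(0,T)}$ be smooth families of Riemannian metrics on $M$ with $\ell(s)=\Phi(s)^*g(s)$ and $g(s)=W(s)^*\ell(s)$. Let $\ell(0)$ and $g(0)$ be (non-smooth) fields of bilinear forms on the tangent spaces of $M$ which are symmetric and positive definite almost everywhere, such that $\ell(0),g(0),\ell(0)^{-1},g(0)^{-1}\in L^p_{loc}$ for all $p\in[1,\infty)$. Assume: (i) $\ell(s)\to\ell(0)$, $\ell(s)^{-1}\to\ell(0)^{-1}$, $g(s)\to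 g(0)$, $g(s)^{-1}\to g(0)^{-1}$ locally in $L^p$ as $s\searrow0$, for all $p\in[1,\infty)$; (ii) for every compact $K\subseteq M$ there is a constant $c(K)$ with $\|\ell(s)\|_{W^{1,2}(K)}+\|g(s)\|_{W^{1,4}(K)}\le c(K)$ for all $s\in(0,T)$; (iii) there is a constant $a\ge1$ with $\frac1a h\le g(s)\le a h$ for all $s\in(0,T)$. Here local $L^p$ and Sobolev norms are those of the components in smooth coordinates on compact subsets of the coordinate domains. Then $\Phi(s)\to\Phi(0)$ and $W(s)\to W(0)$ locally in $W^{1,p}$ as $s\searrow0$ for all $p\in[1,\infty)$; that is, in any smooth coordinates on the domain and on the target, $\Phi(0)$ has a weak derivative, and $\Phi(s)$ and $D\Phi(s)$ converge to $\Phi(0)$ and $D\Phi(0)$ in $L^p$ on every compact set on which $\Phi(0)$ is expressed in these coordinates, and likewise for $W$. In particular $\Phi(0),W(0)\in W^{1,p}_{loc}$. Moreover, write $A\subset\subset B$ if the closure of $A$ is compact and contained in $B$, let $\phi:U\to\mathbb R^4$ and $\psi:V\to\mathbb R^4$ be smooth coordinates on open subsets of $M$, let $\tilde U\subset\subset U$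 and $\tilde V\subset\subset V$ be open, and let $0<S<T$ be such that $W(s)(\tilde V)\subset\subset U$, $\Phi(s)(\tilde U)\subset\subset V$ and $W(s)(V)\subset\subset U$ for all $s\in[0,S]$. Then, in these coordinates, for all $p\in[1,\infty)$: 1. $\sup_{s\in(0,S]}\big(\|D\Phi(s)\|_{L^p(\tilde U)}+\|DW(s)\|_{L^p(\tilde V)}\big)<\infty$; 2. $\Phi(s)\to\Phi(0)$ in $W^{1,p}(\tilde U)$ and $W(s)\to W(0)$ in $W^{1,p}(\tilde V)$ as $s\searrow0$; 3. $\ell(0)_{ij}\circ W(0)\in L^p_{loc}(V)$ for all $i,j$; 4. for all $\alpha,\beta$, $$g(0)_{\alpha\beta}=\sum_{i,j=1}^4 D_\alpha(W(0))^i\,D_\beta(W(0))^j\,\big(\ell(0)_{ij}\circ W(0)\big)\qquad\text{almost everywhere on }\tilde V,$$ and both sides are in $L^p(\tilde V)$. -/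

import Mathlib

open Set Filter Topology MeasureTheory Bundle
open scoped Manifold ContDiff ENNReal NNReal

noncomputable section

/-- The model space `ℝ⁴` with its Euclidean norm and Lebesgue measure. -/
abbrev E4 : Type := EuclideanSpace ℝ (Fin 4)

/-- `A ⊂⊂ B`: the closure of `A` is compact and contained in `B`. -/
def CompactlyIn {X : Type*} [TopologicalSpace X] (A B : Set X) : Prop :=
  IsCompact (closure A) ∧ closure A ⊆ B

/-- `G` is the weak (distributional) derivative of `u` on the open set `Ω ⊆ ℝ⁴`. -/
structure HasWeakDerivOn (u : E4 → E4) (G : E4 → E4 →L[ℝ] E4) (Ω : Set E4) : Prop where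
  locInt : LocallyIntegrableOn u Ω volume
  locInt_deriv : LocallyIntegrableOn G Ω volume
  integral_eq : ∀ η : E4 → ℝ, ContDiff ℝ ∞ η → HasCompactSupport η → tsupport η ⊆ Ω →
    ∀ v : E4, ∫ y, (fderiv ℝ η y v) • u y = - ∫ y, η y • G y v

/-- `u₀` and `G₀` lie in `L^p(A)`, and `u s → u₀`, `D(u s) → G₀` in `L^p(A)` as `s ↘ 0`; here the
`u s` are classically differentiable on `A` for small `s > 0`, and `G₀` is meant to be the weak
derivative of `u₀`, so that this is convergence `u s → u₀` in `W^{1,p}(A)`. -/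
structure TendstoW1p (p : ℝ≥0∞) (A : Set E4) (u : ℝ → E4 → E4) (u₀ : E4 → E4)
    (G₀ : E4 → E4 →L[ℝ] E4) : Prop where
  memLp : MemLp u₀ p (volume.restrict A)
  memLp_deriv : MemLp G₀ p (volume.restrict A)
  tendsto : Tendsto (fun s => eLpNorm (fun y => u s y - u₀ y) p (volume.restrict A))
    (𝓝[>] 0) (𝓝 0)
  tendsto_deriv : Tendsto
    (fun s => eLpNorm (fun y => fderiv ℝ (u s) y - G₀ y) p (volume.restrict A)) (𝓝[>] 0) (𝓝 0)

section Manifold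

variable {M : Type*} [TopologicalSpace M] [ChartedSpace E4 M]

/-- A smooth coordinate system on (an open subset `e.source` of) `M`. -/
def IsSmoothChart (e : OpenPartialHomeomorph M E4) : Prop :=
  e ∈ IsManifold.maximalAtlas (𝓡 4) ∞ M

variable (M) in
/-- A (not necessarily continuous) field of bilinear forms on the tangent spaces of `M`. -/
abbrev FormField : Type _ := ∀ x : M, LinearMap.BilinForm ℝ (TangentSpace (𝓡 4) x)

/-- The `i`-th coordinate vector field of the chart `e`, at the point with coordinates `y`. -/
def coordVec (e : OpenPartialHomeomorph M E4) (y : E4) (i : Fin 4) :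
    TangentSpace (𝓡 4) (e.symm y) :=
  mfderiv (𝓡 4) (𝓡 4) e.symm y (EuclideanSpace.single i (1 : ℝ) : E4)

/-- The matrix `b_{ij}(y) = b(∂_i, ∂_j)` of the components of `b` in the chart `e`, as a function
of the coordinates `y`. -/
def metricComp (e : OpenPartialHomeomorph M E4) (b : FormField M) (y : E4) :
    Matrix (Fin 4) (Fin 4) ℝ :=
  Matrix.of fun i j => b (e.symm y) (coordVec e y i) (coordVec e y j)

/-- The map `F : M → M` in the coordinates `e` (on the domain) and `e'` (on the target). -/
def coordMap (e e' : OpenPartialHomeomorph M E4) (F : M → M) : E4 → E4 :=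
  fun y => e' (F (e.symm y))

/-- The pullback `F^* b`. -/
def pullbackForm (F : M → M) (b : FormField M) : FormField M := fun x =>
  (b (F x)).comp (mfderiv (𝓡 4) (𝓡 4) F x).toLinearMap (mfderiv (𝓡 4) (𝓡 4) F x).toLinearMap

/-- `b s`, `s ∈ (0,T)`, is a smooth family of Riemannian metrics (smooth in `(s, x)`). -/
structure IsSmoothMetricFamily (T : ℝ) (b : ℝ → FormField M) : Prop where
  symm : ∀ s ∈ Ioo 0 T, ∀ (x : M) (v w : TangentSpace (𝓡 4) x), b s x v w = b s x w v
  pos : ∀ s ∈ Ioo 0 T, ∀ (x : M) (v : TangentSpace (𝓡 4) x), v ≠ 0 → 0 < b s x v v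
  smooth : ∀ e : OpenPartialHomeomorph M E4, IsSmoothChart e → ∀ i j,
    ContDiffOn ℝ ∞ (fun q : ℝ × E4 => metricComp e (b q.1) q.2 i j) (Ioo 0 T ×ˢ e.target)

/-- The map `(s, x) ↦ F s x` is smooth on `(0,T) × M`. -/
def IsSmoothMapFamily (T : ℝ) (F : ℝ → M → M) : Prop :=
  ContMDiffOn ((𝓘(ℝ, ℝ)).prod (𝓡 4)) (𝓡 4) ∞ (fun q : ℝ × M => F q.1 q.2) (Ioo 0 T ×ˢ univ)

/-- `b` is a (non-smooth) Riemannian metric, invertible almost everywhere, such that `b` and `b⁻¹`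
are in `L^p_loc` for all `p ∈ [1,∞)`. -/
structure IsWeakMetric (b : FormField M) : Prop where
  posDef : ∀ e : OpenPartialHomeomorph M E4, IsSmoothChart e →
    ∀ᵐ y ∂(volume.restrict e.target), (metricComp e b y).PosDef
  memLp : ∀ e : OpenPartialHomeomorph M E4, IsSmoothChart e → ∀ K ⊆ e.target, IsCompact K →
    ∀ p : ℝ≥0∞, 1 ≤ p → p ≠ ⊤ → ∀ i j, MemLp (fun y => metricComp e b y i j) p (volume.restrict K)
  memLp_inv : ∀ e : OpenPartialHomeomorph M E4, IsSmoothChart e → ∀ K ⊆ e.target, IsCompact K →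
    ∀ p : ℝ≥0∞, 1 ≤ p → p ≠ ⊤ → ∀ i j, MemLp (fun y => (metricComp e b y)⁻¹ i j) p (volume.restrict K)

/-- `b s → b₀` and `(b s)⁻¹ → b₀⁻¹` locally in `L^p` for all `p ∈ [1,∞)` as `s ↘ 0`. -/
structure TendstoLpLoc (b : ℝ → FormField M) (b₀ : FormField M) : Prop where
  tendsto : ∀ e : OpenPartialHomeomorph M E4, IsSmoothChart e → ∀ K ⊆ e.target, IsCompact K →
    ∀ p : ℝ≥0∞, 1 ≤ p → p ≠ ⊤ → ∀ i j, Tendsto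
      (fun s => eLpNorm (fun y => metricComp e (b s) y i j - metricComp e b₀ y i j) p (volume.restrict K))
      (𝓝[>] 0) (𝓝 0)
  tendsto_inv : ∀ e : OpenPartialHomeomorph M E4, IsSmoothChart e → ∀ K ⊆ e.target, IsCompact K →
    ∀ p : ℝ≥0∞, 1 ≤ p → p ≠ ⊤ → ∀ i j, Tendsto
      (fun s => eLpNorm (fun y => (metricComp e (b s) y)⁻¹ i j - (metricComp e b₀ y)⁻¹ i j) p
        (volume.restrict K))
      (𝓝[>] 0) (𝓝 0)

/-- The norms of `b s`, `s ∈ (0,T)`, in `W^{1,q}(K)` are bounded by a constant which depends on `K`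
but not on `s`, for all compact `K` (it suffices to consider those `K` which lie in the domain of
some chart, with the norms computed in coordinates). -/
def BoundedW1Loc (q : ℝ≥0∞) (T : ℝ) (b : ℝ → FormField M) : Prop :=
  ∀ e : OpenPartialHomeomorph M E4, IsSmoothChart e → ∀ K ⊆ e.target, IsCompact K →
    ∃ C : ℝ≥0, ∀ s ∈ Ioo 0 T, ∀ i j,
      eLpNorm (fun y => metricComp e (b s) y i j) q (volume.restrict K) ≤ C ∧
      eLpNorm (fun y => fderiv ℝ (fun z => metricComp e (b s) z i j) y) q (volume.restrict K) ≤ C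

/-- `F s → F₀` locally in `W^{1,p}` as `s ↘ 0`, for all `p ∈ [1,∞)`: in all coordinates on the
domain and on the target, on all compact sets on which `F₀` is expressed in these coordinates.
The limit `F₀` is in particular in `W^{1,p}_loc`. -/
def TendstoW1Loc (F : ℝ → M → M) (F₀ : M → M) : Prop :=
  ∀ e e' : OpenPartialHomeomorph M E4, IsSmoothChart e → IsSmoothChart e' →
    ∃ G : E4 → E4 →L[ℝ] E4,
      HasWeakDerivOn (coordMap e e' F₀) G (e.target ∩ e.symm ⁻¹' (F₀ ⁻¹' e'.source)) ∧
      ∀ K ⊆ e.target ∩ e.symm ⁻¹' (F₀ ⁻¹' e'.source), IsCompact K →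
        ∀ p : ℝ≥0∞, 1 ≤ p → p ≠ ⊤ →
          TendstoW1p p K (fun s => coordMap e e' (F s)) (coordMap e e' F₀) G

end Manifold

end

/-! In charts, `Φ(s)` becomes an isometry `P` from a metric `L` (the components of `ℓ(s)`) to a
metric `G` (those of `g(s)`), with inverse `Q`. With `J = DP` this reads `L = Jᵀ (G ∘ P) J`. Locally
`G` is elliptic and bounded uniformly in `s`, because all `g(s)` are comparable with `h`. Hence
`|J|² ≤ C |L|`, and `DP` is bounded in every `L^p_loc`. Moreover `J⁻¹ = L⁻¹ Jᵀ (G ∘ P)`, so `J⁻¹`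
and `1 / |det J|` are controlled by powers of `|L|` and `|L⁻¹|`.

Compactness comes from second derivatives. Differentiating `L = P^*G` and solving as for Christoffel
symbols expresses `D²P` through `J⁻¹`, `DL` and `DG ∘ P`. Now `DG` is controlled only in the target.
Young's inequality with weight `|det J|` therefore turns its contribution into `|DG ∘ P|² |det J|`,
which a change of variables integrates, plus powers of `|L|` and `|L⁻¹|`
(`exists_norm_fderiv_fderiv_le`). With the `L²` bounds on `DL` and `DG` this bounds the pure second
derivatives of `P` in `L¹_loc` (`IsometryFamily.bdd_fderiv_fderiv`). The maps converge locally
uniformly, so interpolation between the sup norm and these `L¹` bounds makes `DP` Cauchy in `L¹_loc`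
(`exists_eLpNorm_fderiv_sub_lt`). The bounds in every `L^p` improve this to convergence in every
`L^p_loc` (`exists_lpAllTendsto_of_cauchy`).

The inverse maps need another argument, since `L` is not uniformly elliptic. One uses `DQ = (L⁻¹ ∘
Q) (Jᵀ ∘ Q) G`, so it is enough that convergence in every `L^p_loc` survives composition with the
varying maps `Q`. The push-forward of Lebesgue measure under `Q` has density `|det DP|`, which is
bounded in `L²_loc`. Thus composition with `Q` maps `L^{2p}` to `L^p` with uniform bounds
(`HasSquareIntegrableDensity`), and approximation by continuous functions gives the convergence
(`LpAllTendsto.comp`). The isometry of the limit metrics follows by letting `s ↘ 0` in `G = Q^*L`,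
all of whose factors converge in every `L^p`. -/

/-! ### Convergence and boundedness in all `L^p`, `p < ∞`. -/

section LpAll

variable {ι α E F : Type*} [MeasurableSpace α] [NormedAddCommGroup E] [NormedAddCommGroup F]

/-- `f s → f₀` along `l` in `L^p(μ)` for every `p ∈ [1,∞)`. -/
structure LpAllTendsto (μ : Measure α) (l : Filter ι) (f : ι → α → E) (f₀ : α → E) : Prop where
  aesm : ∀ᶠ s in l, AEStronglyMeasurable (f s) μ
  memLp : ∀ p : ℝ≥0∞, 1 ≤ p → p ≠ ⊤ → MemLp f₀ p μ
  tendsto : ∀ p : ℝ≥0∞, 1 ≤ p → p ≠ ⊤ → Tendsto (fun s => eLpNorm (fun y => f s y - f₀ y) p μ) l (𝓝 0)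

/-- The norms of `f s` in `L^p(μ)` are eventually bounded along `l`, for every `p ∈ [1,∞)`. -/
def LpAllBdd (μ : Measure α) (l : Filter ι) (f : ι → α → E) : Prop :=
  ∀ p : ℝ≥0∞, 1 ≤ p → p ≠ ⊤ → ∃ C : ℝ≥0, ∀ᶠ s in l, eLpNorm (f s) p μ ≤ C

variable {μ : Measure α} {l : Filter ι}

namespace LpAllTendsto

theorem aesm_lim {f : ι → α → E} {f₀ : α → E} (h : LpAllTendsto μ l f f₀) :
    AEStronglyMeasurable f₀ μ := (h.memLp 1 le_rfl ENNReal.one_ne_top).1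

theorem bdd {f : ι → α → E} {f₀ : α → E} (h : LpAllTendsto μ l f f₀) : LpAllBdd μ l f := by
  intro p hp hp'
  have hf₀ := h.memLp p hp hp'
  refine ⟨1 + (eLpNorm f₀ p μ).toNNReal, ?_⟩
  filter_upwards [h.aesm, (h.tendsto p hp hp').eventually_le_const zero_lt_one] with s hs hs1
  have : f s = (fun y => f s y - f₀ y) + f₀ := by ext y; simp
  calc eLpNorm (f s) p μ ≤ eLpNorm (fun y => f s y - f₀ y) p μ + eLpNorm f₀ p μ := by
        conv_lhs => rw [this]
        exact eLpNorm_add_le (hs.sub hf₀.1) hf₀.1 hp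
    _ ≤ _ := by
        rw [ENNReal.coe_add, ENNReal.coe_toNNReal hf₀.2.ne]
        exact add_le_add (by simpa using hs1) le_rfl

theorem congr {f g : ι → α → E} {f₀ g₀ : α → E} (h : LpAllTendsto μ l f f₀)
    (hfg : ∀ᶠ s in l, f s =ᵐ[μ] g s) (h₀ : f₀ =ᵐ[μ] g₀) : LpAllTendsto μ l g g₀ where
  aesm := by
    filter_upwards [h.aesm, hfg] with s hs hs' using hs.congr hs'
  memLp p hp hp' := (memLp_congr_ae h₀).1 (h.memLp p hp hp')
  tendsto p hp hp' := by
    refine (h.tendsto p hp hp').congr' ?_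
    filter_upwards [hfg] with s hs
    exact eLpNorm_congr_ae (by filter_upwards [hs, h₀] with y h1 h2; rw [h1, h2])

theorem add {f g : ι → α → E} {f₀ g₀ : α → E} (hf : LpAllTendsto μ l f f₀)
    (hg : LpAllTendsto μ l g g₀) :
    LpAllTendsto μ l (fun s y => f s y + g s y) (fun y => f₀ y + g₀ y) where
  aesm := by filter_upwards [hf.aesm, hg.aesm] with s h1 h2 using h1.add h2
  memLp p hp hp' := (hf.memLp p hp hp').add (hg.memLp p hp hp')
  tendsto p hp hp' := by
    have := (hf.tendsto p hp hp').add (hg.tendsto p hp hp')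
    rw [add_zero] at this
    refine tendsto_of_tendsto_of_tendsto_of_le_of_le' tendsto_const_nhds this
      (Eventually.of_forall fun _ => zero_le) ?_
    filter_upwards [hf.aesm, hg.aesm] with s h1 h2
    have e : (fun y => f s y + g s y - (f₀ y + g₀ y)) =
      (fun y => f s y - f₀ y) + (fun y => g s y - g₀ y) := by ext y; simp; abel
    rw [e]
    exact eLpNorm_add_le (h1.sub hf.aesm_lim) (h2.sub hg.aesm_lim) hp

theorem zero : LpAllTendsto μ l (fun (_ : ι) (_ : α) => (0 : E)) (fun _ => 0) where
  aesm := Eventually.of_forall fun _ => aestronglyMeasurable_const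
  memLp p _ _ := MemLp.zero'
  tendsto p _ _ := by simpa using tendsto_const_nhds

theorem sum {κ : Type*} (t : Finset κ) {f : κ → ι → α → E} {f₀ : κ → α → E}
    (h : ∀ k ∈ t, LpAllTendsto μ l (f k) (f₀ k)) :
    LpAllTendsto μ l (fun s y => ∑ k ∈ t, f k s y) (fun y => ∑ k ∈ t, f₀ k y) := by
  classical
  induction t using Finset.induction_on with
  | empty => simpa using zero
  | insert k t hk ih =>
    simp only [Finset.sum_insert hk]
    exact (h k (by simp)).add (ih fun k' hk' => h k' (by simp [hk']))

/-- Hölder with exponents `2p, 2p`, applied to `f g - f₀ g₀ = f (g - g₀) + g₀ (f - f₀)`. Closure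
under products is the reason for asking for all finite exponents at once. -/
theorem mul {f g : ι → α → ℝ} {f₀ g₀ : α → ℝ} (hf : LpAllTendsto μ l f f₀)
    (hg : LpAllTendsto μ l g g₀) :
    LpAllTendsto μ l (fun s y => f s y * g s y) (fun y => f₀ y * g₀ y) where
  aesm := by filter_upwards [hf.aesm, hg.aesm] with s h1 h2 using h1.mul h2
  memLp p hp hp' := by
    have : ENNReal.HolderTriple (p + p) (p + p) p := ⟨by
      rw [← two_mul, ← two_mul, ENNReal.mul_inv (by simp) (by simp), ← mul_assoc,
        ENNReal.mul_inv_cancel (by simp) (by simp), one_mul]⟩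
    exact (hg.memLp (p + p) (hp.trans le_self_add) (by simp [hp'])).mul
      (hf.memLp (p + p) (hp.trans le_self_add) (by simp [hp']))
  tendsto p hp hp' := by
    have : ENNReal.HolderTriple (p + p) (p + p) p := ⟨by
      rw [← two_mul, ← two_mul, ENNReal.mul_inv (by simp) (by simp), ← mul_assoc,
        ENNReal.mul_inv_cancel (by simp) (by simp), one_mul]⟩
    have hq : 1 ≤ p + p := hp.trans le_self_add
    have hq' : p + p ≠ ⊤ := by simp [hp']
    obtain ⟨C, hC⟩ := hf.bdd (p + p) hq hq'
    have h1 := ENNReal.Tendsto.const_mul (a := (C : ℝ≥0∞)) (hg.tendsto (p + p) hq hq')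
      (Or.inr (by simp))
    have h2 := ENNReal.Tendsto.const_mul (a := eLpNorm g₀ (p + p) μ) (hf.tendsto (p + p) hq hq')
      (Or.inr (hg.memLp (p + p) hq hq').2.ne)
    have h3 := h1.add h2
    simp only [mul_zero, add_zero] at h3
    refine tendsto_of_tendsto_of_tendsto_of_le_of_le' tendsto_const_nhds h3
      (Eventually.of_forall fun _ => zero_le) ?_
    filter_upwards [hf.aesm, hg.aesm, hC] with s m1 m2 hs
    have e : (fun y => f s y * g s y - f₀ y * g₀ y) =
      (f s • fun y => g s y - g₀ y) + (g₀ • fun y => f s y - f₀ y) := by ext y; simp; ring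
    rw [e]
    have m3 := m1.sub hf.aesm_lim
    have m4 := m2.sub hg.aesm_lim
    refine (eLpNorm_add_le (m1.smul m4) (hg.aesm_lim.smul m3) hp).trans (add_le_add ?_ ?_)
    · exact (eLpNorm_smul_le_mul_eLpNorm m4 m1 (p := p + p) (q := p + p)).trans
        (mul_le_mul_left hs _)
    · exact eLpNorm_smul_le_mul_eLpNorm m3 hg.aesm_lim (p := p + p) (q := p + p)

theorem unique [l.NeBot] {f : ι → α → E} {f₀ g₀ : α → E} (hf : LpAllTendsto μ l f f₀)
    (hg : LpAllTendsto μ l f g₀) : f₀ =ᵐ[μ] g₀ := by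
  have h := (hf.tendsto 1 le_rfl ENNReal.one_ne_top).add (hg.tendsto 1 le_rfl ENNReal.one_ne_top)
  rw [add_zero] at h
  have h0 : eLpNorm (f₀ - g₀) 1 μ ≤ 0 := by
    refine ge_of_tendsto h ?_
    filter_upwards [hf.aesm] with s hs
    have e : f₀ - g₀ = (fun y => f s y - g₀ y) - (fun y => f s y - f₀ y) := by ext y; simp
    rw [e, add_comm]
    exact eLpNorm_sub_le (hs.sub hg.aesm_lim) (hs.sub hf.aesm_lim) le_rfl
  have := (eLpNorm_eq_zero_iff (hf.aesm_lim.sub hg.aesm_lim) one_ne_zero).1 (le_antisymm h0 (zero_le))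
  filter_upwards [this] with y hy
  simpa [sub_eq_zero] using hy

theorem clm_comp [NormedSpace ℝ E] [NormedSpace ℝ F] (A : E →L[ℝ] F) {f : ι → α → E} {f₀ : α → E}
    (h : LpAllTendsto μ l f f₀) : LpAllTendsto μ l (fun s y => A (f s y)) (fun y => A (f₀ y)) where
  aesm := h.aesm.mono fun s hs => A.continuous.comp_aestronglyMeasurable hs
  memLp p hp hp' := A.comp_memLp' (h.memLp p hp hp')
  tendsto p hp hp' := by
    have h0 := ENNReal.Tendsto.const_mul (a := (‖A‖₊ : ℝ≥0∞)) (h.tendsto p hp hp')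
      (Or.inr (by simp))
    rw [mul_zero] at h0
    refine tendsto_of_tendsto_of_tendsto_of_le_of_le tendsto_const_nhds h0
      (fun _ => zero_le) fun s => ?_
    refine (eLpNorm_le_nnreal_smul_eLpNorm_of_ae_le_mul (c := ‖A‖₊)
      (g := fun y => f s y - f₀ y) (Eventually.of_forall fun y => ?_) p).trans_eq
      (by rw [ENNReal.smul_def, smul_eq_mul])
    rw [← map_sub]
    exact A.le_opNNNorm _

end LpAllTendsto

/-- Cauchy–Schwarz for `|f|^r = |f|^(1/2) |f|^(r - 1/2)`. -/
theorem lintegral_rpow_enorm_le_sqrt_mul_sqrt {f : α → E} (hf : AEStronglyMeasurable f μ) {r : ℝ}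
    (hr : 1 ≤ r) :
    ∫⁻ y, ‖f y‖ₑ ^ r ∂μ ≤ (∫⁻ y, ‖f y‖ₑ ∂μ) ^ (1 / 2 : ℝ) *
      (∫⁻ y, ‖f y‖ₑ ^ (2 * r - 1) ∂μ) ^ (1 / 2 : ℝ) := by
  have h := ENNReal.lintegral_mul_le_Lp_mul_Lq μ (p := 2) (q := 2)
    (by constructor <;> norm_num) (f := fun y => ‖f y‖ₑ ^ (1 / 2 : ℝ))
    (g := fun y => ‖f y‖ₑ ^ (r - 1 / 2)) (hf.enorm.pow_const _) (hf.enorm.pow_const _)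
  convert h using 2
  · ext y
    rw [Pi.mul_apply, ← ENNReal.rpow_add_of_nonneg _ _ (by norm_num) (by linarith)]
    congr 1; ring
  · simp only [← ENNReal.rpow_mul]; norm_num
  · congr 1; refine lintegral_congr fun y => ?_
    rw [← ENNReal.rpow_mul]; congr 1; ring

/-- Interpolation: the differences are small in `L¹` and bounded in `L^(2p-1)`, hence small in
`L^p`. -/
theorem LpAllTendsto.of_tendsto_one {f : ι → α → E} {f₀ : α → E}
    (hm : ∀ᶠ s in l, AEStronglyMeasurable (f s) μ)
    (hmem : ∀ p : ℝ≥0∞, 1 ≤ p → p ≠ ⊤ → MemLp f₀ p μ) (hb : LpAllBdd μ l f)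
    (h : Tendsto (fun s => eLpNorm (fun y => f s y - f₀ y) 1 μ) l (𝓝 0)) :
    LpAllTendsto μ l f f₀ where
  aesm := hm
  memLp := hmem
  tendsto p hp hp' := by
    set r := p.toReal with hr
    have hr1 : 1 ≤ r := by
      rw [hr, ← ENNReal.toReal_one]; exact ENNReal.toReal_mono hp' hp
    set q : ℝ≥0∞ := ENNReal.ofReal (2 * r - 1)
    have hq : q.toReal = 2 * r - 1 := ENNReal.toReal_ofReal (by linarith)
    have hq1 : 1 ≤ q := by rw [ENNReal.one_le_ofReal]; linarith
    have hq' : q ≠ ⊤ := ENNReal.ofReal_ne_top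
    obtain ⟨C, hC⟩ := hb q hq1 hq'
    have hf0 := hmem q hq1 hq'
    set B : ℝ≥0∞ := C + eLpNorm f₀ q μ with hB
    have hB' : B ≠ ⊤ := by simp [hB, hf0.2.ne]
    have key : ∀ᶠ s in l, eLpNorm (fun y => f s y - f₀ y) p μ ≤
        ((eLpNorm (fun y => f s y - f₀ y) 1 μ) ^ (1 / 2 : ℝ) *
          (B ^ (2 * r - 1)) ^ (1 / 2 : ℝ)) ^ (1 / r) := by
      filter_upwards [hm, hC] with s hs hsC
      have hm' := hs.sub hf0.1
      have hb' : eLpNorm (fun y => f s y - f₀ y) q μ ≤ B :=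
        (eLpNorm_sub_le hs hf0.1 hq1).trans (add_le_add_left hsC _)
      rw [eLpNorm_eq_lintegral_rpow_enorm_toReal (by positivity) hp', ← hr,
        eLpNorm_one_eq_lintegral_enorm]
      refine ENNReal.rpow_le_rpow ((lintegral_rpow_enorm_le_sqrt_mul_sqrt hm' hr1).trans ?_)
        (by positivity)
      refine mul_le_mul_right (ENNReal.rpow_le_rpow ?_ (by norm_num)) _
      rw [eLpNorm_eq_lintegral_rpow_enorm_toReal (by positivity) hq', hq] at hb'
      have := ENNReal.rpow_le_rpow hb' (show 0 ≤ 2 * r - 1 by linarith)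
      rwa [← ENNReal.rpow_mul, one_div, inv_mul_cancel₀ (by linarith), ENNReal.rpow_one] at this
    have hlim : Tendsto (fun s => ((eLpNorm (fun y => f s y - f₀ y) 1 μ) ^ (1 / 2 : ℝ) *
          (B ^ (2 * r - 1)) ^ (1 / 2 : ℝ)) ^ (1 / r)) l (𝓝 0) := by
      have h1 := ((ENNReal.continuous_rpow_const (y := (1 / 2 : ℝ))).tendsto 0).comp h
      have h2 := ENNReal.Tendsto.mul_const (b := (B ^ (2 * r - 1)) ^ (1 / 2 : ℝ)) h1
        (Or.inr (ENNReal.rpow_ne_top_of_nonneg (by norm_num)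
          (ENNReal.rpow_ne_top_of_nonneg (by linarith) hB')))
      have h3 := ((ENNReal.continuous_rpow_const (y := (1 / r : ℝ))).tendsto _).comp h2
      rw [ENNReal.zero_rpow_of_pos (by norm_num), zero_mul,
        ENNReal.zero_rpow_of_pos (by positivity)] at h3
      exact h3
    exact tendsto_of_tendsto_of_tendsto_of_le_of_le' tendsto_const_nhds hlim
      (Eventually.of_forall fun _ => zero_le) key

theorem LpAllBdd.of_norm_le {f : ι → α → E} {g : ι → α → F} (hf : LpAllBdd μ l f)
    (h : ∀ᶠ s in l, ∀ᵐ y ∂μ, ‖g s y‖ ≤ ‖f s y‖) : LpAllBdd μ l g := by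
  intro p hp hp'
  obtain ⟨C, hC⟩ := hf p hp hp'
  exact ⟨C, by filter_upwards [hC, h] with s h1 h2 using (eLpNorm_mono_ae h2).trans h1⟩

theorem LpAllBdd.add {f g : ι → α → E} (hf : LpAllBdd μ l f) (hg : LpAllBdd μ l g)
    (hfm : ∀ᶠ s in l, AEStronglyMeasurable (f s) μ)
    (hgm : ∀ᶠ s in l, AEStronglyMeasurable (g s) μ) : LpAllBdd μ l (fun s y => f s y + g s y) := by
  intro p hp hp'
  obtain ⟨C, hC⟩ := hf p hp hp'
  obtain ⟨C', hC'⟩ := hg p hp hp'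
  refine ⟨C + C', ?_⟩
  filter_upwards [hC, hC', hfm, hgm] with s h1 h2 h3 h4
  rw [ENNReal.coe_add]
  exact (eLpNorm_add_le h3 h4 hp).trans (add_le_add h1 h2)

theorem LpAllBdd.sum {κ : Type*} (t : Finset κ) {f : κ → ι → α → E}
    (h : ∀ k ∈ t, LpAllBdd μ l (f k))
    (hm : ∀ k ∈ t, ∀ᶠ s in l, AEStronglyMeasurable (f k s) μ) :
    LpAllBdd μ l (fun s y => ∑ k ∈ t, f k s y) ∧
      ∀ᶠ s in l, AEStronglyMeasurable (fun y => ∑ k ∈ t, f k s y) μ := by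
  classical
  induction t using Finset.induction_on with
  | empty =>
    simp only [Finset.sum_empty]
    exact ⟨fun p _ _ => ⟨0, by simp⟩, Eventually.of_forall fun _ => aestronglyMeasurable_const⟩
  | insert k t hk ih =>
    simp only [Finset.sum_insert hk]
    obtain ⟨h1, h2⟩ := ih (fun k' hk' => h k' (by simp [hk'])) (fun k' hk' => hm k' (by simp [hk']))
    refine ⟨(h k (by simp)).add h1 (hm k (by simp)) h2, ?_⟩
    filter_upwards [hm k (by simp), h2] with s a b using a.add b

theorem LpAllBdd.const_mul {f : ι → α → ℝ} (hf : LpAllBdd μ l f) (c : ℝ) :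
    LpAllBdd μ l (fun s y => c * f s y) := by
  intro p hp hp'
  obtain ⟨C, hC⟩ := hf p hp hp'
  refine ⟨‖c‖₊ * C, ?_⟩
  filter_upwards [hC] with s hs
  refine (eLpNorm_le_nnreal_smul_eLpNorm_of_ae_le_mul (c := ‖c‖₊) (g := f s)
    (Eventually.of_forall fun y => by simp) p).trans ?_
  rw [ENNReal.coe_mul, ENNReal.smul_def, smul_eq_mul]
  gcongr

theorem LpAllBdd.pow {f : ι → α → ℝ} (hf : LpAllBdd μ l f) {n : ℕ} (hn : n ≠ 0) :
    LpAllBdd μ l (fun s y => f s y ^ n) := by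
  intro p hp hp'
  have hn1 : (1 : ℝ≥0∞) ≤ n := by exact_mod_cast Nat.one_le_iff_ne_zero.2 hn
  obtain ⟨C, hC⟩ := hf (p * n) (one_le_mul hp hn1) (ENNReal.mul_ne_top hp' (by simp))
  refine ⟨C ^ n, ?_⟩
  filter_upwards [hC] with s hs
  have := eLpNorm_norm_rpow (μ := μ) (p := p) (f s) (q := n) (by positivity)
  simp only [Real.rpow_natCast, ENNReal.ofReal_natCast, ENNReal.rpow_natCast] at this
  have e : eLpNorm (fun y => f s y ^ n) p μ = eLpNorm (fun y => ‖f s y‖ ^ n) p μ :=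
    eLpNorm_congr_norm_ae (Eventually.of_forall fun y => by simp)
  rw [e, this, ENNReal.coe_pow]
  gcongr

theorem LpAllBdd.lintegral_enorm_le {f : ι → α → E} (hf : LpAllBdd μ l f) :
    ∃ C : ℝ≥0, ∀ᶠ s in l, ∫⁻ y, ‖f s y‖ₑ ∂μ ≤ C := by
  simpa only [eLpNorm_one_eq_lintegral_enorm] using hf 1 le_rfl ENNReal.one_ne_top

end LpAll

/-! ### Completeness of the local `L^p` spaces. -/

theorem IsOpen.exists_monotone_compact_exhaustion {X : Type*} [TopologicalSpace X]
    [LocallyCompactSpace X] [SecondCountableTopology X] {D : Set X} (hD : IsOpen D) :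
    ∃ K : ℕ → Set X, Monotone K ∧ (∀ n, IsCompact (K n)) ∧ (∀ n, K n ⊆ D) ∧
      ∀ A ⊆ D, IsCompact A → ∃ n, A ⊆ K n := by
  have := hD.locallyCompactSpace
  let Ke : CompactExhaustion D := default
  refine ⟨fun n => Subtype.val '' Ke n, fun m n h => image_mono (Ke.subset h),
    fun n => (Ke.isCompact n).image continuous_subtype_val, fun n => by simp, fun A hA hc => ?_⟩
  have hc' : IsCompact (Subtype.val ⁻¹' A : Set D) := by
    rw [Subtype.isCompact_iff, Subtype.image_preimage_coe, inter_eq_self_of_subset_right hA]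
    exact hc
  obtain ⟨n, hn⟩ := Ke.exists_superset_of_isCompact hc'
  exact ⟨n, fun x hx => ⟨⟨x, hA hx⟩, hn hx, rfl⟩⟩

/-- A family which is bounded in all `L^p_loc(D)` and Cauchy in `L^1_loc(D)` converges. -/
theorem exists_lpAllTendsto_of_cauchy {ι X E : Type*} [TopologicalSpace X]
    [LocallyCompactSpace X] [SecondCountableTopology X] [MeasurableSpace X]
    [NormedAddCommGroup E] [CompleteSpace E] {μ : Measure X}
    {l : Filter ι} [l.NeBot] [l.IsCountablyGenerated] {D : Set X} (hD : IsOpen D)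
    {f : ι → X → E}
    (hm : ∀ K ⊆ D, IsCompact K → ∀ᶠ s in l, AEStronglyMeasurable (f s) (μ.restrict K))
    (hb : ∀ K ⊆ D, IsCompact K → LpAllBdd (μ.restrict K) l f)
    (hc : ∀ K ⊆ D, IsCompact K → ∀ ε : ℝ≥0∞, 0 < ε → ∃ V ∈ l, ∀ s ∈ V, ∀ t ∈ V,
      eLpNorm (f s - f t) 1 (μ.restrict K) < ε) :
    ∃ G : X → E, ∀ K ⊆ D, IsCompact K → LpAllTendsto (μ.restrict K) l f G := by
  obtain ⟨K, hmono, hcpt, hsub, hK⟩ := hD.exists_monotone_compact_exhaustion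
  obtain ⟨B, hB⟩ := l.exists_antitone_basis
  have hU : ∀ n : ℕ, ∃ U ∈ l, ∀ s ∈ U, AEStronglyMeasurable (f s) (μ.restrict (K n)) ∧
      ∀ t ∈ U, eLpNorm (f s - f t) 1 (μ.restrict (K n)) < 2⁻¹ ^ n := by
    intro n
    obtain ⟨V, hV, h⟩ := hc (K n) (hsub n) (hcpt n) (2⁻¹ ^ n)
      (ENNReal.pow_pos (by simp) n)
    exact ⟨V ∩ _, inter_mem hV (hm (K n) (hsub n) (hcpt n)),
      fun s hs => ⟨hs.2, fun t ht => h s hs.1 t ht.1⟩⟩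
  choose U hUl hU using hU
  -- Diagonal choice: from index `k` on, the sequence stays in `U k`, so it is Cauchy at a geometric
  -- rate on every `K k` simultaneously.
  have hex : ∀ n : ℕ, ∃ s, s ∈ B n ∧ ∀ k ≤ n, s ∈ U k := by
    intro n
    have h1 : ∀ᶠ s in l, ∀ k ∈ Iic n, s ∈ U k :=
      (eventually_all_finite (finite_Iic n)).2 fun k _ => hUl k
    obtain ⟨s, hs⟩ := ((show ∀ᶠ s in l, s ∈ B n from hB.1.mem_of_mem trivial).and h1).exists
    exact ⟨s, hs.1, hs.2⟩
  choose σ hσB hσU using hex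
  have hσ : Tendsto σ atTop l := hB.tendsto hσB
  -- The shift by `N` discards the finitely many indices for which nothing is known on `K N`.
  -- Summable `L¹` differences then give convergence almost everywhere, and the limit does not
  -- depend on `N`.
  have hae : ∀ N, ∀ᵐ y ∂μ.restrict (K N),
      Tendsto (fun n => f (σ n) y) atTop (𝓝 (limUnder atTop fun n => f (σ n) y)) := by
    intro N
    have h := Lp.ae_tendsto_of_cauchy_eLpNorm (μ := μ.restrict (K N)) (p := 1)
      (f := fun n y => f (σ (n + N)) y)
      (fun n => (hU N _ (hσU _ _ (by omega))).1) le_rfl (B := fun n => 2⁻¹ ^ n)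
      (by rw [ENNReal.tsum_geometric]; simp) (fun k n m hn hm => ?_)
    · filter_upwards [h] with y hy
      obtain ⟨z, hz⟩ := hy
      exact tendsto_nhds_limUnder ⟨z, (tendsto_add_atTop_iff_nat N).1 hz⟩
    · calc _ ≤ eLpNorm (f (σ (n + N)) - f (σ (m + N))) 1 (μ.restrict (K (k + N))) :=
            eLpNorm_mono_measure _ (Measure.restrict_mono (hmono (by omega)) le_rfl)
        _ < 2⁻¹ ^ (k + N) := (hU _ _ (hσU _ _ (by omega))).2 _ (hσU _ _ (by omega))
        _ ≤ 2⁻¹ ^ k := pow_le_pow_right_of_le_one' (by simp) (by omega)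
  refine ⟨fun y => limUnder atTop fun n => f (σ n) y, fun A hA hAc => ?_⟩
  set G : X → E := fun y => limUnder atTop fun n => f (σ n) y
  have haeA : ∀ᵐ y ∂μ.restrict A, Tendsto (fun n => f (σ n) y) atTop (𝓝 (G y)) := by
    obtain ⟨N, hN⟩ := hK A hA hAc
    exact ae_mono (Measure.restrict_mono hN le_rfl) (hae N)
  obtain ⟨N, hN⟩ := eventually_atTop.1 (hσ.eventually (hm A hA hAc))
  have haeN : ∀ᵐ y ∂μ.restrict A, Tendsto (fun n => f (σ (n + N)) y) atTop (𝓝 (G y)) := by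
    filter_upwards [haeA] with y hy using (tendsto_add_atTop_iff_nat N).2 hy
  have hmN : ∀ n, AEStronglyMeasurable (f (σ (n + N))) (μ.restrict A) := fun n => hN _ (by omega)
  have hσN : Tendsto (fun n => σ (n + N)) atTop l := hσ.comp (tendsto_add_atTop_nat N)
  have hGm : AEStronglyMeasurable G (μ.restrict A) := aestronglyMeasurable_of_tendsto_ae _ hmN haeN
  -- Fatou's lemma for the norms along the sequence carries the `L^p` bounds over to `G`; applied to
  -- `f s - f (σ n)`, it turns the Cauchy condition into convergence in `L¹`.
  refine LpAllTendsto.of_tendsto_one (hm A hA hAc) (fun p hp hp' => ⟨hGm, ?_⟩) (hb A hA hAc) ?_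
  · obtain ⟨C, hC⟩ := hb A hA hAc p hp hp'
    refine ((Lp.eLpNorm_lim_le_liminf_eLpNorm hmN G haeN).trans ?_).trans_lt
      (ENNReal.coe_lt_top (r := C))
    exact liminf_le_of_frequently_le' (hσN.eventually hC).frequently
  · rw [ENNReal.tendsto_nhds_zero]
    intro ε hε
    obtain ⟨V, hV, h⟩ := hc A hA hAc ε hε
    filter_upwards [hV, hm A hA hAc] with s hs hsm
    have hlim : ∀ᵐ y ∂μ.restrict A,
        Tendsto (fun n => (f s - f (σ (n + N))) y) atTop (𝓝 (f s y - G y)) := by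
      filter_upwards [haeN] with y hy using tendsto_const_nhds.sub hy
    refine (Lp.eLpNorm_lim_le_liminf_eLpNorm (fun n => hsm.sub (hmN n)) _ hlim).trans ?_
    exact liminf_le_of_frequently_le'
      ((hσN.eventually hV).mono fun n hn => (h s hs _ hn).le).frequently

/-! ### Interpolation of first derivatives between the sup norm and second derivatives. -/

section Interpolation

variable {E F : Type*} [NormedAddCommGroup E] [NormedSpace ℝ E]
  [NormedAddCommGroup F] [NormedSpace ℝ F] [CompleteSpace F]

/-- On `[0, δ]` the derivative stays within `∫ |f''|` of `f' 0`. By the mean value inequality `δ f'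
0` then differs from `f δ - f 0` by at most `δ ∫ |f''|`. -/
theorem norm_deriv_zero_le_of_hasDerivAt {f f' f'' : ℝ → F} {δ M : ℝ} (hδ : 0 < δ)
    (hf : ∀ τ ∈ Icc 0 δ, HasDerivAt f (f' τ) τ) (hf' : ∀ τ ∈ Icc 0 δ, HasDerivAt f' (f'' τ) τ)
    (hc : ContinuousOn f'' (Icc 0 δ)) (h0 : ‖f 0‖ ≤ M) (h1 : ‖f δ‖ ≤ M) :
    ‖f' 0‖ ≤ 2 * M / δ + ∫ τ in (0 : ℝ)..δ, ‖f'' τ‖ := by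
  set I := ∫ τ in (0 : ℝ)..δ, ‖f'' τ‖
  have hint : IntervalIntegrable (fun τ => ‖f'' τ‖) volume 0 δ :=
    (hc.norm.mono (by rw [uIcc_of_le hδ.le])).intervalIntegrable
  have h2 : ∀ τ ∈ Icc 0 δ, ‖f' τ - f' 0‖ ≤ I := by
    intro τ hτ
    have hsub : uIcc 0 τ ⊆ Icc 0 δ := by rw [uIcc_of_le hτ.1]; exact Icc_subset_Icc_right hτ.2
    rw [← intervalIntegral.integral_eq_sub_of_hasDerivAt (fun t ht => hf' t (hsub ht))
      ((hc.mono hsub).intervalIntegrable)]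
    refine (intervalIntegral.norm_integral_le_integral_norm hτ.1).trans ?_
    exact intervalIntegral.integral_mono_interval le_rfl hτ.1 hτ.2
      (Eventually.of_forall fun _ => norm_nonneg _) hint
  have h3 := norm_image_sub_le_of_norm_deriv_le_segment' (f := fun τ => f τ - τ • f' 0)
    (f' := fun τ => f' τ - (1 : ℝ) • f' 0) (a := 0) (b := δ) (C := I)
    (fun τ hτ => ((hf τ hτ).sub ((hasDerivAt_id τ).smul_const (f' 0))).hasDerivWithinAt)
    (fun τ hτ => by rw [one_smul]; exact h2 τ (Ico_subset_Icc_self hτ)) δ (right_mem_Icc.2 hδ.le)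
  simp only [zero_smul, sub_zero] at h3
  have h4 : δ * ‖f' 0‖ ≤ 2 * M + I * δ := by
    have e : δ • f' 0 = f δ - f 0 - (f δ - δ • f' 0 - f 0) := by abel
    calc δ * ‖f' 0‖ = ‖δ • f' 0‖ := by rw [norm_smul, Real.norm_of_nonneg hδ.le]
      _ ≤ ‖f δ - f 0‖ + ‖f δ - δ • f' 0 - f 0‖ := (congrArg norm e).le.trans (norm_sub_le _ _)
      _ ≤ (‖f δ‖ + ‖f 0‖) + I * δ := add_le_add (norm_sub_le _ _) h3
      _ ≤ _ := by linarith
  rw [div_add' _ _ _ hδ.ne', le_div_iff₀ hδ]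
  linarith

theorem enorm_fderiv_apply_le_of_contDiffAt {w : E → F} {x e : E} {δ M : ℝ} (hδ : 0 < δ)
    (hw : ∀ τ ∈ Icc 0 δ, ContDiffAt ℝ 2 w (x + τ • e)) (h0 : ‖w x‖ ≤ M) (h1 : ‖w (x + δ • e)‖ ≤ M) :
    ‖fderiv ℝ w x e‖ₑ ≤ ENNReal.ofReal (2 * M / δ) +
      ∫⁻ τ in Ioc 0 δ, ‖fderiv ℝ (fderiv ℝ w) (x + τ • e) e e‖ₑ := by
  have hline : ∀ τ : ℝ, HasDerivAt (fun t : ℝ => x + t • e) e τ := fun τ => by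
    simpa using ((hasDerivAt_id τ).smul_const e).const_add x
  have hD : ∀ τ ∈ Icc 0 δ, ContDiffAt ℝ 1 (fderiv ℝ w) (x + τ • e) := fun τ hτ =>
    (hw τ hτ).fderiv_right (by norm_num)
  have hc : ContinuousOn (fun τ : ℝ => fderiv ℝ (fderiv ℝ w) (x + τ • e) e e) (Icc 0 δ) := by
    intro τ hτ
    have h : ContinuousAt (fun τ : ℝ => fderiv ℝ (fderiv ℝ w) (x + τ • e)) τ :=
      ContinuousAt.comp (f := fun τ : ℝ => x + τ • e)
        ((hD τ hτ).fderiv_right (m := 0) (by norm_num)).continuousAt (hline τ).continuousAt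
    exact ((h.clm_apply continuousAt_const).clm_apply continuousAt_const).continuousWithinAt
  have d1 : ∀ τ ∈ Icc 0 δ, HasDerivAt (fun τ : ℝ => w (x + τ • e)) (fderiv ℝ w (x + τ • e) e) τ :=
    fun τ hτ => HasFDerivAt.comp_hasDerivAt (l := w) (f := fun τ : ℝ => x + τ • e) τ
      ((hw τ hτ).differentiableAt (by norm_num)).hasFDerivAt (hline τ)
  have d2 : ∀ τ ∈ Icc 0 δ, HasDerivAt (fun τ : ℝ => fderiv ℝ w (x + τ • e) e)
      (fderiv ℝ (fderiv ℝ w) (x + τ • e) e e) τ := fun τ hτ => by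
    have h : HasDerivAt (fun τ : ℝ => fderiv ℝ w (x + τ • e))
        (fderiv ℝ (fderiv ℝ w) (x + τ • e) e) τ :=
      HasFDerivAt.comp_hasDerivAt (l := fderiv ℝ w) (f := fun τ : ℝ => x + τ • e) τ
        ((hD τ hτ).differentiableAt (by norm_num)).hasFDerivAt (hline τ)
    simpa using h.clm_apply (hasDerivAt_const τ e)
  have h := norm_deriv_zero_le_of_hasDerivAt hδ d1 d2 hc (by simpa using h0) h1
  have hM : 0 ≤ 2 * M / δ := by have := (norm_nonneg _).trans h0; positivity
  simp only [zero_smul, add_zero] at h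
  rw [← ofReal_norm]
  refine (ENNReal.ofReal_le_ofReal h).trans ?_
  rw [ENNReal.ofReal_add hM (intervalIntegral.integral_nonneg hδ.le fun _ _ => norm_nonneg _),
    intervalIntegral.integral_of_le hδ.le, ofReal_integral_norm_eq_lintegral_enorm]
  exact (hc.integrableOn_Icc).mono_set Ioc_subset_Icc_self

/-- The estimate along segments is integrated over the base point. By Tonelli and translation
invariance, the line integrals contribute `δ` times one integral over `K'`. A small `M` thus
compensates the factor `1 / δ`, whereas the second derivatives need only be bounded in `L¹`. -/
theorem lintegral_enorm_fderiv_apply_le [MeasurableSpace E] [BorelSpace E] [FiniteDimensional ℝ E]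
    {μ : Measure E} [μ.IsAddHaarMeasure] {w : E → F} {e : E} {K K' : Set E} {δ M : ℝ} (hδ : 0 < δ)
    (hK : MeasurableSet K) (hK' : MeasurableSet K')
    (hKK' : ∀ x ∈ K, ∀ τ ∈ Icc 0 δ, x + τ • e ∈ K')
    (hw : ∀ x ∈ K', ContDiffAt ℝ 2 w x) (hM : ∀ x ∈ K', ‖w x‖ ≤ M) :
    ∫⁻ x in K, ‖fderiv ℝ w x e‖ₑ ∂μ ≤ ENNReal.ofReal (2 * M / δ) * μ K +
      ENNReal.ofReal δ * ∫⁻ x in K', ‖fderiv ℝ (fderiv ℝ w) x e e‖ₑ ∂μ := by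
  -- Extension by zero outside `K'` makes the translation-invariant integral over the whole space
  -- available.
  set H : E → ℝ≥0∞ := K'.indicator fun x => ‖fderiv ℝ (fderiv ℝ w) x e e‖ₑ with hH
  have hHm : Measurable H := by
    refine Measurable.indicator ?_ hK'
    have h := measurable_fderiv ℝ (fderiv ℝ w)
    borelize F (E →L[ℝ] F)
    have := (measurable_fderiv_apply_const ℝ (fun x => fderiv ℝ w x) e)
    have h2 : Continuous fun A : E →L[ℝ] F => A e := by fun_prop
    exact (h2.measurable.comp this).enorm
  calc ∫⁻ x in K, ‖fderiv ℝ w x e‖ₑ ∂μ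
      ≤ ∫⁻ x in K, (ENNReal.ofReal (2 * M / δ) + ∫⁻ τ in Ioc (0 : ℝ) δ, H (x + τ • e)) ∂μ := by
        refine setLIntegral_mono' hK fun x hx => ?_
        refine (enorm_fderiv_apply_le_of_contDiffAt hδ (fun τ hτ => hw _ (hKK' x hx τ hτ))
          (hM x (by simpa using hKK' x hx 0 (left_mem_Icc.2 hδ.le)))
          (hM _ (hKK' x hx δ (right_mem_Icc.2 hδ.le)))).trans (add_le_add_right ?_ _)
        refine setLIntegral_mono' measurableSet_Ioc fun τ hτ => ?_
        rw [hH, indicator_of_mem (hKK' x hx τ (Ioc_subset_Icc_self hτ))]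
    _ = ENNReal.ofReal (2 * M / δ) * μ K + ∫⁻ x in K, (∫⁻ τ in Ioc (0 : ℝ) δ, H (x + τ • e)) ∂μ := by
        rw [lintegral_add_left measurable_const, setLIntegral_const]
    _ ≤ ENNReal.ofReal (2 * M / δ) * μ K + ∫⁻ x, (∫⁻ τ in Ioc (0 : ℝ) δ, H (x + τ • e)) ∂μ :=
        add_le_add_right (setLIntegral_le_lintegral _ _) _
    _ = ENNReal.ofReal (2 * M / δ) * μ K + ∫⁻ τ in Ioc 0 δ, ∫⁻ x, H (x + τ • e) ∂μ := by
        rw [lintegral_lintegral_swap]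
        have : Measurable fun q : E × ℝ => q.1 + q.2 • e := by fun_prop
        exact (hHm.comp this).aemeasurable
    _ = _ := by
        simp only [lintegral_add_right_eq_self, setLIntegral_const, Real.volume_Ioc, sub_zero]
        rw [mul_comm (∫⁻ x, H x ∂μ), hH, lintegral_indicator hK']

end Interpolation

/-! ### Derivatives in coordinates, and limits of maps that converge locally uniformly. -/

theorem EuclideanSpace.apply_eq_sum_single {n : ℕ} {F : Type*} [NormedAddCommGroup F]
    [NormedSpace ℝ F] (A : EuclideanSpace ℝ (Fin n) →L[ℝ] F) (v : EuclideanSpace ℝ (Fin n)) :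
    A v = ∑ i, v i • A (EuclideanSpace.single i 1) := by
  conv_lhs => rw [← (EuclideanSpace.basisFun (Fin n) ℝ).sum_repr v]
  simp [map_sum]

theorem EuclideanSpace.norm_clm_le_sum {n : ℕ} {F : Type*} [NormedAddCommGroup F]
    [NormedSpace ℝ F] (A : EuclideanSpace ℝ (Fin n) →L[ℝ] F) :
    ‖A‖ ≤ ∑ i, ‖A (EuclideanSpace.single i 1)‖ := by
  refine A.opNorm_le_bound (Finset.sum_nonneg fun _ _ => norm_nonneg _) fun v => ?_
  rw [apply_eq_sum_single, Finset.sum_mul]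
  refine (norm_sum_le _ _).trans (Finset.sum_le_sum fun i _ => ?_)
  rw [norm_smul, mul_comm]
  exact mul_le_mul_of_nonneg_left (PiLp.norm_apply_le v i) (norm_nonneg _)

theorem LpAllTendsto.of_tendstoUniformlyOn {ι X F : Type*} [TopologicalSpace X]
    [SecondCountableTopology X] [T2Space X]
    [MeasurableSpace X] [BorelSpace X] [NormedAddCommGroup F] {μ : Measure X}
    [IsFiniteMeasureOnCompacts μ] {l : Filter ι} [l.NeBot] {K : Set X} (hK : IsCompact K)
    {u : ι → X → F} {u₀ : X → F} (h : TendstoUniformlyOn u u₀ l K)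
    (hc : ∀ᶠ s in l, ContinuousOn (u s) K) : LpAllTendsto (μ.restrict K) l u u₀ := by
  have : IsFiniteMeasure (μ.restrict K) := ⟨by simpa using hK.measure_lt_top⟩
  have hc₀ : ContinuousOn u₀ K := h.continuousOn hc.frequently
  have hm₀ := hc₀.aestronglyMeasurable_of_isCompact (μ := μ) hK hK.measurableSet
  refine ⟨hc.mono fun s hs => hs.aestronglyMeasurable_of_isCompact hK hK.measurableSet,
    fun p _ _ => ?_, fun p hp hp' => ?_⟩
  · obtain ⟨C, hC⟩ := hK.exists_bound_of_continuousOn hc₀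
    exact MemLp.of_bound hm₀ C ((ae_restrict_iff' hK.measurableSet).2 (Eventually.of_forall hC))
  · rw [ENNReal.tendsto_nhds_zero]
    intro ε hε
    set c : ℝ≥0∞ := (μ.restrict K) univ ^ p.toReal⁻¹
    have hcT : c ≠ ⊤ := by
      refine ENNReal.rpow_ne_top_of_nonneg (by positivity) (measure_ne_top _ _)
    obtain ⟨r, hr, hrε⟩ : ∃ r : ℝ, 0 < r ∧ c * ENNReal.ofReal r ≤ ε := by
      have ht : Tendsto (fun r : ℝ => c * ENNReal.ofReal r) (𝓝[>] 0) (𝓝 0) := by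
        have := ENNReal.Tendsto.const_mul (a := c)
          ((ENNReal.continuous_ofReal.tendsto 0).mono_left (nhdsWithin_le_nhds (s := Ioi 0)))
          (Or.inr hcT)
        simpa using this
      obtain ⟨r, h1, h2⟩ := ((ht.eventually_le_const hε).and self_mem_nhdsWithin).exists
      exact ⟨r, h2, h1⟩
    filter_upwards [Metric.tendstoUniformlyOn_iff.1 h r hr] with s hs
    refine (eLpNorm_le_of_ae_bound (C := r) ?_).trans hrε
    rw [ae_restrict_iff' hK.measurableSet]
    exact Eventually.of_forall fun x hx => by
      rw [← dist_eq_norm, dist_comm]; exact (hs x hx).le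

section WeakDeriv

variable {ι : Type*} {l : Filter ι} {D : Set E4} {u : ι → E4 → E4} {u₀ : E4 → E4}

/-- Locally uniformly convergent maps with second derivatives bounded in `L^1_loc` have first
derivatives which are Cauchy in `L^1_loc`. -/
theorem exists_eLpNorm_fderiv_sub_lt (hD : IsOpen D)
    (hu : ∀ K ⊆ D, IsCompact K → TendstoUniformlyOn u u₀ l K)
    (hs : ∀ K ⊆ D, IsCompact K → ∀ᶠ s in l, ∀ x ∈ K, ContDiffAt ℝ 2 (u s) x)
    (h2 : ∀ K ⊆ D, IsCompact K → ∀ i : Fin 4, ∃ C : ℝ≥0, ∀ᶠ s in l,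
      ∫⁻ x in K, ‖fderiv ℝ (fderiv ℝ (u s)) x (EuclideanSpace.single i 1)
        (EuclideanSpace.single i 1)‖ₑ ≤ C)
    {K : Set E4} (hKD : K ⊆ D) (hK : IsCompact K) {ε : ℝ≥0∞} (hε : 0 < ε) :
    ∃ V ∈ l, ∀ s ∈ V, ∀ t ∈ V,
      eLpNorm (fderiv ℝ (u s) - fderiv ℝ (u t)) 1 (volume.restrict K) < ε := by
  obtain ⟨δ₀, hδ₀, hsub⟩ := hK.exists_cthickening_subset_open hD hKD
  have hK' : IsCompact (Metric.cthickening δ₀ K) := hK.cthickening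
  set K' := Metric.cthickening δ₀ K
  choose C₁ hC₁ using h2 K' hsub hK'
  set C : ℝ≥0 := ∑ i, C₁ i
  have hC : ∀ i, C₁ i ≤ C := fun i => Finset.single_le_sum (fun _ _ => zero_le) (Finset.mem_univ i)
  set r : ℝ := (min ε 1).toReal
  have hr : 0 < r := ENNReal.toReal_pos (by simp [hε.ne']) (by simp)
  have hrε : ENNReal.ofReal r ≤ ε := by
    rw [ENNReal.ofReal_toReal (by simp)]; exact min_le_left _ _
  set v : ℝ := (volume K).toReal
  have hv : 0 ≤ v := ENNReal.toReal_nonneg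
  have hvK : volume K = ENNReal.ofReal v := (ENNReal.ofReal_toReal hK.measure_lt_top.ne).symm
  -- `δ` is fixed first, so that the second-derivative terms, `4 · δ · 2C` in total, stay below `r /
  -- 2`. Here `4` counts the coordinate directions and `2` the two maps being subtracted. Only then
  -- is `M` chosen in terms of `δ`, to make `4 · (2M / δ) · v` smaller than `r / 2`.
  set δ : ℝ := min δ₀ (r / (16 * (C + 1)))
  have hδ : 0 < δ := by positivity
  have hδC : 8 * (δ * C) < r / 2 := by
    have h1 : δ ≤ r / (16 * (C + 1)) := min_le_right _ _
    have h2 : δ * (16 * (C + 1)) ≤ r := (le_div_iff₀ (by positivity)).1 h1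
    nlinarith
  set M : ℝ := r * δ / (32 * (v + 1)) with hM
  have hMp : 0 < M := by positivity
  have hMv : 4 * (2 * M / δ * v) < r / 2 := by
    have : 4 * (2 * M / δ * v) = r / 4 * (v / (v + 1)) := by rw [hM]; field_simp; norm_num
    rw [this]
    have : v / (v + 1) < 1 := by rw [div_lt_one (by positivity)]; linarith
    nlinarith
  -- Distance `M / 2` from `u₀` gives distance at most `M` between two members of the family.
  refine ⟨{s | (∀ x ∈ K', ContDiffAt ℝ 2 (u s) x) ∧ (∀ x ∈ K', dist (u₀ x) (u s x) < M / 2) ∧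
    ∀ i, ∫⁻ x in K', ‖fderiv ℝ (fderiv ℝ (u s)) x (EuclideanSpace.single i 1)
      (EuclideanSpace.single i 1)‖ₑ ≤ C₁ i}, ?_, ?_⟩
  · filter_upwards [hs K' hsub hK', Metric.tendstoUniformlyOn_iff.1 (hu K' hsub hK') (M / 2)
      (by positivity), eventually_all.2 hC₁] with s a b c using ⟨a, b, c⟩
  · rintro s ⟨s1, s2, s3⟩ t ⟨t1, t2, t3⟩
    have hKK' : K ⊆ K' := Metric.self_subset_cthickening K
    have hfd : ∀ x ∈ K', fderiv ℝ (u s - u t) x = fderiv ℝ (u s) x - fderiv ℝ (u t) x :=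
      fun x hx => fderiv_sub ((s1 x hx).differentiableAt (by norm_num))
        ((t1 x hx).differentiableAt (by norm_num))
    have hfd2 : ∀ x ∈ K', fderiv ℝ (fderiv ℝ (u s - u t)) x =
        fderiv ℝ (fderiv ℝ (u s)) x - fderiv ℝ (fderiv ℝ (u t)) x := by
      intro x hx
      have e : fderiv ℝ (u s - u t) =ᶠ[𝓝 x] fderiv ℝ (u s) - fderiv ℝ (u t) := by
        filter_upwards [(s1 x hx).eventually (by simp), (t1 x hx).eventually (by simp)] with z a b
        exact fderiv_sub (a.differentiableAt (by norm_num)) (b.differentiableAt (by norm_num))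
      rw [e.fderiv_eq]
      exact fderiv_sub (((s1 x hx).fderiv_right (m := 1) (by norm_num)).differentiableAt
        (by norm_num)) (((t1 x hx).fderiv_right (m := 1) (by norm_num)).differentiableAt
        (by norm_num))
    have key : ∀ i : Fin 4, ∫⁻ x in K, ‖fderiv ℝ (u s - u t) x (EuclideanSpace.single i 1)‖ₑ ≤
        ENNReal.ofReal (2 * M / δ * v + δ * (2 * C)) := by
      intro i
      refine (lintegral_enorm_fderiv_apply_le (K' := K') (M := M) hδ hK.measurableSet
        hK'.measurableSet (fun x hx τ hτ => ?_) (fun x hx => (s1 x hx).sub (t1 x hx))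
        fun x hx => ?_).trans ?_
      · refine Metric.mem_cthickening_of_dist_le _ x _ _ hx ?_
        rw [dist_eq_norm, add_sub_cancel_left, norm_smul, Real.norm_of_nonneg hτ.1]
        simpa using hτ.2.trans (min_le_left _ _)
      · rw [← dist_eq_norm]
        linarith [dist_triangle_left (u s x) (u t x) (u₀ x), s2 x hx, t2 x hx]
      · rw [ENNReal.ofReal_add (by positivity) (by positivity), ENNReal.ofReal_mul (by positivity),
          ENNReal.ofReal_mul hδ.le, hvK]
        refine add_le_add_right (mul_le_mul_right ?_ _) _
        calc ∫⁻ x in K', ‖fderiv ℝ (fderiv ℝ (u s - u t)) x (EuclideanSpace.single i 1)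
              (EuclideanSpace.single i 1)‖ₑ
            ≤ ∫⁻ x in K', (‖fderiv ℝ (fderiv ℝ (u s)) x (EuclideanSpace.single i 1)
              (EuclideanSpace.single i 1)‖ₑ + ‖fderiv ℝ (fderiv ℝ (u t)) x
              (EuclideanSpace.single i 1) (EuclideanSpace.single i 1)‖ₑ) := by
              refine setLIntegral_mono' hK'.measurableSet fun x hx => ?_
              rw [hfd2 x hx]
              exact enorm_sub_le
          _ ≤ C₁ i + C₁ i := by
              rw [lintegral_add_left]
              · exact add_le_add (s3 i) (t3 i)
              · have h2 : Continuous fun A : E4 →L[ℝ] E4 →L[ℝ] E4 =>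
                    A (EuclideanSpace.single i 1) (EuclideanSpace.single i 1) := by fun_prop
                borelize (E4 →L[ℝ] E4 →L[ℝ] E4)
                exact (h2.measurable.comp (measurable_fderiv ℝ (fderiv ℝ (u s)))).enorm
          _ ≤ ENNReal.ofReal (2 * C) := by
              rw [← two_mul, ENNReal.ofReal_mul (by norm_num), ENNReal.ofReal_coe_nnreal]
              simp only [ENNReal.ofReal_ofNat]
              gcongr
              exact hC i
    rw [eLpNorm_one_eq_lintegral_enorm]
    calc ∫⁻ x in K, ‖(fderiv ℝ (u s) - fderiv ℝ (u t)) x‖ₑ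
        ≤ ∫⁻ x in K, ∑ i : Fin 4, ‖fderiv ℝ (u s - u t) x (EuclideanSpace.single i 1)‖ₑ := by
          refine setLIntegral_mono' hK.measurableSet fun x hx => ?_
          rw [Pi.sub_apply, ← hfd x (hKK' hx)]
          simp only [← ofReal_norm]
          rw [← ENNReal.ofReal_sum_of_nonneg fun _ _ => norm_nonneg _]
          exact ENNReal.ofReal_le_ofReal (EuclideanSpace.norm_clm_le_sum _)
      _ = ∑ i : Fin 4, ∫⁻ x in K, ‖fderiv ℝ (u s - u t) x (EuclideanSpace.single i 1)‖ₑ :=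
          lintegral_finsetSum _ fun i _ => (measurable_fderiv_apply_const ℝ _ _).enorm
      _ ≤ ∑ i : Fin 4, ENNReal.ofReal (2 * M / δ * v + δ * (2 * C)) :=
          Finset.sum_le_sum fun i _ => key i
      _ = ENNReal.ofReal (4 * (2 * M / δ * v + δ * (2 * C))) := by
          rw [Finset.sum_const, Finset.card_univ, Fintype.card_fin, nsmul_eq_mul,
            ENNReal.ofReal_mul (by norm_num)]
          norm_num
      _ < ENNReal.ofReal r := (ENNReal.ofReal_lt_ofReal_iff hr).2 (by linarith)
      _ ≤ ε := hrε

/-- Both sides of the integration by parts formula for `u s` converge, since on the support of the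
test function `u s` converges uniformly and its derivative converges in `L¹`. -/
theorem hasWeakDerivOn_of_tendsto [l.NeBot] {G : E4 → E4 →L[ℝ] E4} (hD : IsOpen D)
    (hu₀ : ContinuousOn u₀ D)
    (hu : ∀ K ⊆ D, IsCompact K → TendstoUniformlyOn u u₀ l K)
    (hs : ∀ K ⊆ D, IsCompact K → ∀ᶠ s in l, ∀ x ∈ K, ContDiffAt ℝ 2 (u s) x)
    (hG : ∀ K ⊆ D, IsCompact K →
      LpAllTendsto (volume.restrict K) l (fun s => fderiv ℝ (u s)) G) :
    HasWeakDerivOn u₀ G D where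
  locInt := hu₀.locallyIntegrableOn hD.measurableSet
  locInt_deriv := by
    rw [locallyIntegrableOn_iff hD.isLocallyClosed]
    exact fun K hKD hK => memLp_one_iff_integrable.1 ((hG K hKD hK).memLp 1 le_rfl (by simp))
  integral_eq η hη hηc hηD v := by
    set K := tsupport η
    have hK : IsCompact K := hηc
    have hcu : ∀ᶠ s in l, ContinuousOn (u s) K :=
      (hs K hηD hK).mono fun s h x hx => (h x hx).continuousAt.continuousWithinAt
    have hU := LpAllTendsto.of_tendstoUniformlyOn (μ := volume) hK (hu K hηD hK) hcu
    have hDc : Continuous fun y => fderiv ℝ η y v :=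
      (hη.continuous_fderiv (by simp)).clm_apply continuous_const
    have hsupp : ∀ w : E4 → E4, ∀ y, y ∉ K → fderiv ℝ η y v • w y = 0 := fun w y hy => by
      have : fderiv ℝ η y = 0 := by
        by_contra h
        exact hy (support_fderiv_subset ℝ (f := η) (Function.mem_support.2 h))
      simp [this]
    have hsupp' : ∀ w : E4 → E4, ∀ y, y ∉ K → η y • w y = 0 := fun w y hy => by
      simp [image_eq_zero_of_notMem_tsupport hy]
    -- convergence of integrals of products with a fixed continuous function
    have conv : ∀ (θ : E4 → ℝ), Continuous θ → ∀ (f : ι → E4 → E4) (f₀ : E4 → E4),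
        LpAllTendsto (volume.restrict K) l f f₀ →
        Tendsto (fun s => ∫ y in K, θ y • f s y) l (𝓝 (∫ y in K, θ y • f₀ y)) ∧
        ∀ᶠ s in l, IntegrableOn (fun y => θ y • f s y) K := by
      intro θ hθ f f₀ hf
      obtain ⟨c, hc⟩ := hK.exists_bound_of_continuousOn hθ.continuousOn
      have hint : ∀ w : E4 → E4, MemLp w 1 (volume.restrict K) →
          Integrable (fun y => θ y • w y) (volume.restrict K) := fun w hw =>
        (memLp_one_iff_integrable.1 hw).bdd_smul c hθ.aestronglyMeasurable
          ((ae_restrict_iff' hK.measurableSet).2 (Eventually.of_forall hc))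
      have hfi : ∀ᶠ s in l, MemLp (f s) 1 (volume.restrict K) := by
        obtain ⟨C, hC⟩ := hf.bdd 1 le_rfl (by simp)
        filter_upwards [hC, hf.aesm] with s h1 h2 using ⟨h2, h1.trans_lt ENNReal.coe_lt_top⟩
      refine ⟨tendsto_integral_of_L1' _ (hint _ (hf.memLp 1 le_rfl (by simp))).aestronglyMeasurable
        (hfi.mono fun s h => hint _ h) ?_, hfi.mono fun s h => hint _ h⟩
      have h0 := ENNReal.Tendsto.const_mul (a := (‖c‖₊ : ℝ≥0∞))
        (hf.tendsto 1 le_rfl (by simp)) (Or.inr (by simp))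
      rw [mul_zero] at h0
      refine tendsto_of_tendsto_of_tendsto_of_le_of_le tendsto_const_nhds h0
        (fun _ => zero_le) fun s => ?_
      refine (eLpNorm_le_nnreal_smul_eLpNorm_of_ae_le_mul (c := ‖c‖₊)
        (g := fun y => f s y - f₀ y) ?_ 1).trans_eq (by rw [ENNReal.smul_def, smul_eq_mul])
      rw [ae_restrict_iff' hK.measurableSet]
      refine Eventually.of_forall fun y hy => ?_
      rw [Pi.sub_apply, ← smul_sub, nnnorm_smul]
      gcongr
      exact (hc y hy).trans (le_abs_self c)
    have hGv : LpAllTendsto (volume.restrict K) l (fun s y => fderiv ℝ (u s) y v)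
        (fun y => G y v) :=
      (hG K hηD hK).clm_comp (ContinuousLinearMap.apply ℝ E4 v)
    obtain ⟨t1, i1⟩ := conv _ hDc u u₀ hU
    obtain ⟨t2, i2⟩ := conv η hη.continuous _ _ hGv
    obtain ⟨_, i3⟩ := conv η hη.continuous u u₀ hU
    rw [← setIntegral_eq_integral_of_forall_compl_eq_zero (s := K) (hsupp u₀),
      ← setIntegral_eq_integral_of_forall_compl_eq_zero (s := K) (hsupp' fun y => G y v)]
    refine tendsto_nhds_unique t1 (t2.neg.congr' ?_)
    filter_upwards [hs K hηD hK, i1, i2, i3] with s hs1 j1 j2 j3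
    rw [setIntegral_eq_integral_of_forall_compl_eq_zero (s := K) (hsupp (u s)),
      setIntegral_eq_integral_of_forall_compl_eq_zero (s := K)
        (hsupp' fun y => fderiv ℝ (u s) y v)]
    -- The maps `u s` are only known to be regular on the support of `η`. The products with `η` and
    -- its derivative vanish elsewhere and are therefore integrable on all of `ℝ⁴`.
    have glob : ∀ f : E4 → E4, IntegrableOn f K → (∀ y, y ∉ K → f y = 0) → Integrable f :=
      fun f hf h0 => (integrableOn_iff_integrable_of_support_subset fun y hy => by
        by_contra h; exact hy (h0 y h)).1 hf
    have := integral_smul_fderiv_eq_neg_fderiv_smul_of_integrable (μ := volume) (𝕜 := ℝ) (f := η)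
      (g := u s) (v := v) (glob _ j1 (hsupp _)) (glob _ j2 (hsupp' fun y => fderiv ℝ (u s) y v))
      (glob _ j3 (hsupp' _))
      (fun x _ => hη.differentiable (by simp) x)
      (fun x hx => (hs1 x hx).differentiableAt (by norm_num))
    rw [this, neg_neg]

end WeakDeriv

/-! ### Composition with maps whose push-forward has density in `L²`. -/

section Composition

variable {X Y : Type*} [MeasurableSpace X] [MeasurableSpace Y]

/-- The push-forward of `α` under `w` has, formally, a density with respect to `β` whose
`L²`-norm is at most `C`. -/
structure HasSquareIntegrableDensity (C : ℝ≥0) (α : Measure X) (β : Measure Y) (w : X → Y) :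
    Prop where
  aemeasurable : AEMeasurable w α
  lintegral_comp_le : ∀ f : Y → ℝ≥0∞, Measurable f →
    ∫⁻ x, f (w x) ∂α ≤ C * (∫⁻ y, f y ^ 2 ∂β) ^ (1 / 2 : ℝ)

namespace HasSquareIntegrableDensity

variable {C : ℝ≥0} {α : Measure X} {β : Measure Y} {w : X → Y}

/-- Test with the indicator of a null set, which equals its own square. Composition with `w` is
hence well defined on almost everywhere classes. -/
theorem map_absolutelyContinuous (h : HasSquareIntegrableDensity C α β w) : α.map w ≪ β := by
  refine Measure.AbsolutelyContinuous.mk fun N hN h0 => ?_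
  have := h.lintegral_comp_le (N.indicator 1) (measurable_one.indicator hN)
  have e : ∀ y, N.indicator (1 : Y → ℝ≥0∞) y ^ 2 = N.indicator 1 y := fun y => by
    by_cases hy : y ∈ N <;> simp [hy]
  simp only [e] at this
  rw [lintegral_indicator_one hN, h0, ENNReal.zero_rpow_of_pos (by norm_num), mul_zero] at this
  rw [← lintegral_indicator_one hN, lintegral_map' (measurable_one.indicator hN).aemeasurable
    h.aemeasurable]
  exact le_antisymm this zero_le

theorem aestronglyMeasurable_comp {E : Type*} [TopologicalSpace E]
    (h : HasSquareIntegrableDensity C α β w) {f : Y → E} (hf : AEStronglyMeasurable f β) :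
    AEStronglyMeasurable (fun x => f (w x)) α :=
  (hf.mono_ac h.map_absolutelyContinuous).comp_aemeasurable h.aemeasurable

/-- The defining inequality is applied to `|f|^p`. Doubling the exponent is harmless when all finite
exponents are available. -/
theorem eLpNorm_comp_le {E : Type*} [NormedAddCommGroup E] (h : HasSquareIntegrableDensity C α β w)
    {f : Y → E} (hf : AEStronglyMeasurable f β) {p : ℝ≥0∞} (hp : 1 ≤ p) (hp' : p ≠ ⊤) :
    eLpNorm (fun x => f (w x)) p α ≤ (C : ℝ≥0∞) ^ (1 / p.toReal) * eLpNorm f (2 * p) β := by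
  have hr : 0 < p.toReal := ENNReal.toReal_pos (by positivity) hp'
  obtain ⟨k, hk, hkf⟩ := hf.enorm.pow_const p.toReal
  have hae : (fun x => ‖f (w x)‖ₑ ^ p.toReal) =ᵐ[α] fun x => k (w x) :=
    ae_of_ae_map h.aemeasurable (h.map_absolutelyContinuous.ae_le hkf)
  rw [eLpNorm_eq_lintegral_rpow_enorm_toReal (by positivity) hp',
    eLpNorm_eq_lintegral_rpow_enorm_toReal (by positivity) (ENNReal.mul_ne_top (by simp) hp'),
    lintegral_congr_ae hae]
  refine (ENNReal.rpow_le_rpow (h.lintegral_comp_le k hk) (by positivity)).trans_eq ?_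
  rw [ENNReal.mul_rpow_of_nonneg _ _ (by positivity), ← ENNReal.rpow_mul]
  congr 2
  · refine lintegral_congr_ae ?_
    filter_upwards [hkf] with y hy
    rw [← hy, ENNReal.toReal_mul, ENNReal.toReal_ofNat, mul_comm, ENNReal.rpow_mul,
      ENNReal.rpow_ofNat]
  · rw [ENNReal.toReal_mul, ENNReal.toReal_ofNat]; field_simp

/-- The inequality passes to pointwise limits of the maps. By the Vitali–Carathéodory theorem `f²`
lies below a lower semicontinuous `k` with almost the same integral. Lower semicontinuity bounds
`√k` at the limit point by the lower limit of its values along the maps, and Fatou's lemma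
concludes. -/
theorem of_tendsto [TopologicalSpace Y] [BorelSpace Y] [TopologicalSpace.PseudoMetrizableSpace Y]
    [β.WeaklyRegular] {ι : Type*} {l : Filter ι}
    [l.NeBot] [l.IsCountablyGenerated] {W : ι → X → Y}
    (h : ∀ᶠ s in l, HasSquareIntegrableDensity C α β (W s))
    (hw : ∀ᵐ x ∂α, Tendsto (fun s => W s x) l (𝓝 (w x))) :
    HasSquareIntegrableDensity C α β w := by
  obtain ⟨σ, hσ⟩ := l.exists_seq_tendsto
  obtain ⟨N, hN⟩ := eventually_atTop.1 (hσ.eventually h)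
  have hσN : Tendsto (fun n => σ (n + N)) atTop l := hσ.comp (tendsto_add_atTop_nat N)
  have hN' : ∀ n, HasSquareIntegrableDensity C α β (W (σ (n + N))) := fun n => hN _ (by omega)
  refine ⟨aemeasurable_of_tendsto_metrizable_ae atTop (fun n => (hN' n).aemeasurable)
    (hw.mono fun x hx => hx.comp hσN), fun f hf => ?_⟩
  have key : ∀ ε : ℝ≥0∞, ε ≠ 0 →
      ∫⁻ x, f (w x) ∂α ≤ C * (∫⁻ y, f y ^ 2 ∂β + ε) ^ (1 / 2 : ℝ) := by
    intro ε hε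
    obtain ⟨k, hfk, hk, hkε⟩ := exists_le_lowerSemicontinuous_lintegral_ge β (fun y => f y ^ 2)
      (hf.pow_const 2) hε
    have hks : Measurable fun y => k y ^ (1 / 2 : ℝ) := hk.measurable.pow_const _
    have hle : ∀ y, f y ≤ k y ^ (1 / 2 : ℝ) := fun y => by
      have := ENNReal.rpow_le_rpow (hfk y) (show (0 : ℝ) ≤ 1 / 2 by norm_num)
      rwa [← ENNReal.rpow_natCast, ← ENNReal.rpow_mul, show ((2 : ℕ) : ℝ) * (1 / 2) = 1 by norm_num,
        ENNReal.rpow_one] at this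
    have hsq : ∀ y, (k y ^ (1 / 2 : ℝ)) ^ 2 = k y := fun y => by
      rw [← ENNReal.rpow_natCast, ← ENNReal.rpow_mul]; norm_num
    calc ∫⁻ x, f (w x) ∂α
        ≤ ∫⁻ x, liminf (fun n => k (W (σ (n + N)) x) ^ (1 / 2 : ℝ)) atTop ∂α := by
          refine lintegral_mono_ae ?_
          filter_upwards [hw] with x hx
          refine (hle _).trans ?_
          refine le_of_forall_lt fun c hc => ?_
          have hc' : c ^ (2 : ℝ) < k (w x) := by
            have := ENNReal.rpow_lt_rpow hc (show (0 : ℝ) < 2 by norm_num)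
            rwa [← ENNReal.rpow_mul, show (1 / 2 : ℝ) * 2 = 1 by norm_num, ENNReal.rpow_one] at this
          obtain ⟨d, hcd, hd⟩ := exists_between hc'
          have hev := (hx.comp hσN).eventually (hk (w x) d hd)
          refine lt_of_lt_of_le ?_ (le_liminf_of_le (a := d ^ (1 / 2 : ℝ)) (by isBoundedDefault)
            (hev.mono fun n hn => ENNReal.rpow_le_rpow (le_of_lt hn) (by norm_num)))
          have := ENNReal.rpow_lt_rpow hcd (show (0 : ℝ) < 1 / 2 by norm_num)
          rwa [← ENNReal.rpow_mul, show (2 : ℝ) * (1 / 2) = 1 by norm_num, ENNReal.rpow_one] at this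
      _ ≤ liminf (fun n => ∫⁻ x, k (W (σ (n + N)) x) ^ (1 / 2 : ℝ) ∂α) atTop :=
          lintegral_liminf_le' fun n => hks.comp_aemeasurable (hN' n).aemeasurable
      _ ≤ C * (∫⁻ y, k y ∂β) ^ (1 / 2 : ℝ) := by
          refine liminf_le_of_frequently_le' (Eventually.of_forall fun n => ?_).frequently
          have := (hN' n).lintegral_comp_le _ hks
          simpa only [hsq] using this
      _ ≤ _ := by gcongr
  have hlim : Tendsto (fun ε : ℝ≥0∞ => C * (∫⁻ y, f y ^ 2 ∂β + ε) ^ (1 / 2 : ℝ)) (𝓝[≠] 0)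
      (𝓝 (C * (∫⁻ y, f y ^ 2 ∂β + 0) ^ (1 / 2 : ℝ))) := by
    refine ENNReal.Tendsto.const_mul ?_ (Or.inr (by simp))
    exact ((ENNReal.continuous_rpow_const.tendsto _).comp
      ((continuous_const.add continuous_id).tendsto 0)).mono_left nhdsWithin_le_nhds
  rw [add_zero] at hlim
  have : (𝓝[≠] (0 : ℝ≥0∞)).NeBot := by
    have : (𝓝[>] (0 : ℝ≥0∞)).NeBot := ENNReal.nhdsGT_zero_neBot
    exact this.mono (nhdsWithin_mono _ fun x hx => (ne_of_gt hx))
  exact ge_of_tendsto hlim (eventually_nhdsWithin_of_forall fun ε hε => key ε hε)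

end HasSquareIntegrableDensity

/-- The limit `f₀` is approximated in `L^(2p)` by a continuous compactly supported `k`. The errors
`f s - f₀` and `f₀ - k`, composed with `W s` or `w`, are controlled by the density bound, and `k ∘ W
s → k ∘ w` uniformly because `k` is uniformly continuous. -/
theorem LpAllTendsto.comp {ι E : Type*} [NormedAddCommGroup E] [NormedSpace ℝ E]
    {l : Filter ι} [l.NeBot] [l.IsCountablyGenerated] {A B : Set E4} (hA : IsCompact A)
    (hB : IsCompact B) {C : ℝ≥0} {W : ι → E4 → E4} {w : E4 → E4}
    (hd : ∀ᶠ s in l,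
      HasSquareIntegrableDensity C (volume.restrict A) (volume.restrict B) (W s))
    (hc : ∀ᶠ s in l, ContinuousOn (W s) A) (hW : TendstoUniformlyOn W w l A)
    {f : ι → E4 → E} {f₀ : E4 → E} (hf : LpAllTendsto (volume.restrict B) l f f₀) :
    LpAllTendsto (volume.restrict A) l (fun s x => f s (W s x)) (fun x => f₀ (w x)) := by
  have : IsFiniteMeasure (volume.restrict B : Measure E4) := ⟨by simpa using hB.measure_lt_top⟩
  have hw : ∀ᵐ x ∂(volume.restrict A : Measure E4), Tendsto (fun s => W s x) l (𝓝 (w x)) :=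
    (ae_restrict_iff' hA.measurableSet).2 (Eventually.of_forall fun x hx => hW.tendsto_at hx)
  have hd₀ := HasSquareIntegrableDensity.of_tendsto hd hw
  have h2 : ∀ p : ℝ≥0∞, 1 ≤ p → p ≠ ⊤ → 1 ≤ 2 * p ∧ 2 * p ≠ ⊤ := fun p hp hp' =>
    ⟨one_le_mul (by norm_num) hp, ENNReal.mul_ne_top (by simp) hp'⟩
  refine ⟨?_, fun p hp hp' => ⟨hd₀.aestronglyMeasurable_comp hf.aesm_lim, ?_⟩, fun p hp hp' => ?_⟩
  · filter_upwards [hd, hf.aesm] with s h1 h2 using h1.aestronglyMeasurable_comp h2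
  · refine (hd₀.eLpNorm_comp_le hf.aesm_lim hp hp').trans_lt (ENNReal.mul_lt_top ?_ ?_)
    · exact ENNReal.rpow_lt_top_of_nonneg (by positivity) (by simp)
    · exact (hf.memLp _ (h2 p hp hp').1 (h2 p hp hp').2).2
  · set c : ℝ≥0∞ := (C : ℝ≥0∞) ^ (1 / p.toReal)
    have hcT : c ≠ ⊤ := ENNReal.rpow_ne_top_of_nonneg (by positivity) (by simp)
    obtain ⟨hq, hq'⟩ := h2 p hp hp'
    rw [ENNReal.tendsto_nhds_zero]
    intro ε hε
    have hε4 : 0 < ε / 4 := ENNReal.div_pos hε.ne' (by simp)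
    -- The case `c = 0` is separate because the witness divides by `c`.
    obtain ⟨η, hη, hηε⟩ : ∃ η : ℝ≥0∞, η ≠ 0 ∧ c * η ≤ ε / 4 := by
      rcases eq_or_ne c 0 with h0 | h0
      · exact ⟨1, by simp, by simp [h0]⟩
      · refine ⟨ε / 4 / c, (ENNReal.div_pos hε4.ne' hcT).ne', ENNReal.mul_div_le⟩
    obtain ⟨k, hkc, hk, hkcont, hkm⟩ := (hf.memLp _ hq hq').exists_hasCompactSupport_eLpNorm_sub_le
      hq' hη
    have hku : LpAllTendsto (volume.restrict A) l (fun s x => k (W s x)) (fun x => k (w x)) := by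
      refine LpAllTendsto.of_tendstoUniformlyOn hA ?_
        (hc.mono fun s hs => hkcont.comp_continuousOn hs)
      exact (hkc.uniformContinuous_of_continuous hkcont).comp_tendstoUniformlyOn hW
    have t1 := ENNReal.Tendsto.const_mul (a := c) (hf.tendsto _ hq hq') (Or.inr hcT)
    rw [mul_zero] at t1
    filter_upwards [t1.eventually_le_const hε4, (hku.tendsto p hp hp').eventually_le_const hε4, hd,
      hf.aesm, hku.aesm] with s s1 s2 s3 s4 s5
    have m1 := s4.sub hf.aesm_lim
    have m2 := hf.aesm_lim.sub hkm.1
    have a1 := s3.aestronglyMeasurable_comp m1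
    have a2 := s3.aestronglyMeasurable_comp m2
    have a3 := s5.sub hku.aesm_lim
    have a4 := hd₀.aestronglyMeasurable_comp m2
    have e : (fun x => f s (W s x) - f₀ (w x)) =
        (fun x => (f s - f₀) (W s x)) + ((fun x => (f₀ - k) (W s x)) +
          ((fun x => k (W s x) - k (w x)) - (fun x => (f₀ - k) (w x)))) := by
      ext x; simp
    rw [e]
    calc _ ≤ eLpNorm (fun x => (f s - f₀) (W s x)) p (volume.restrict A) +
          (eLpNorm (fun x => (f₀ - k) (W s x)) p (volume.restrict A) +
          (eLpNorm (fun x => k (W s x) - k (w x)) p (volume.restrict A) +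
          eLpNorm (fun x => (f₀ - k) (w x)) p (volume.restrict A))) := by
          refine (eLpNorm_add_le a1 (a2.add (a3.sub a4)) hp).trans (add_le_add_right ?_ _)
          refine (eLpNorm_add_le a2 (a3.sub a4) hp).trans (add_le_add_right ?_ _)
          exact eLpNorm_sub_le a3 a4 hp
      _ ≤ ε / 4 + (ε / 4 + (ε / 4 + ε / 4)) := by
          gcongr
          · exact (s3.eLpNorm_comp_le m1 hp hp').trans s1
          · exact (s3.eLpNorm_comp_le m2 hp hp').trans ((mul_le_mul_right hk _).trans hηε)
          · exact (hd₀.eLpNorm_comp_le m2 hp hp').trans ((mul_le_mul_right hk _).trans hηε)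
      _ = ε := by
          rw [ENNReal.div_eq_inv_mul]
          have : (4 : ℝ≥0∞)⁻¹ * ε + (4⁻¹ * ε + (4⁻¹ * ε + 4⁻¹ * ε)) = (4 * 4⁻¹) * ε := by ring
          rw [this, ENNReal.mul_inv_cancel (by simp) (by simp), one_mul]

end Composition

/-! ### Pointwise estimates for the first and second derivatives of an isometry. -/

section Pointwise

theorem Matrix.abs_mul_apply_le {n : ℕ} {A B : Matrix (Fin n) (Fin n) ℝ} {a b : ℝ}
    (hA : ∀ i j, |A i j| ≤ a) (hB : ∀ i j, |B i j| ≤ b) (i j : Fin n) :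
    |(A * B) i j| ≤ n * (a * b) := by
  rw [Matrix.mul_apply]
  refine (Finset.abs_sum_le_sum_abs _ _).trans ?_
  calc ∑ k, |A i k * B k j| ≤ ∑ _k : Fin n, a * b := by
        refine Finset.sum_le_sum fun k _ => ?_
        rw [abs_mul]
        exact mul_le_mul (hA i k) (hB k j) (abs_nonneg _) ((abs_nonneg _).trans (hA i k))
    _ = _ := by simp

/-- Symmetric matrices with ellipticity constant `c` and entries bounded by `b`. -/
structure Matrix.IsEllipticWith (c b : ℝ) (G : Matrix (Fin 4) (Fin 4) ℝ) : Prop where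
  isSymm : G.IsSymm
  le : ∀ v : Fin 4 → ℝ, c * ∑ i, v i ^ 2 ≤ v ⬝ᵥ (G.mulVec v)
  abs_le : ∀ i j, |G i j| ≤ b

namespace Matrix.IsEllipticWith

variable {c b ξ : ℝ} {G J : Matrix (Fin 4) (Fin 4) ℝ}

/-- Ellipticity on the `i`-th column of `J` gives `c |J e_i|² ≤ (JᵀGJ)_ii ≤ ξ`; then `|t| ≤ 1 + t²`
replaces the square root by a bound linear in `ξ`. -/
theorem abs_apply_le (hG : G.IsEllipticWith c b) (hc : 0 < c) (hξ : 1 ≤ ξ)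
    (hL : ∀ i j, |(J.transpose * G * J) i j| ≤ ξ) (α i : Fin 4) : |J α i| ≤ (1 + 1 / c) * ξ := by
  have h1 := hG.le (fun β => J β i)
  have h2 : (fun β => J β i) ⬝ᵥ (G.mulVec fun β => J β i) = (J.transpose * G * J) i i := by
    rw [Matrix.mul_assoc, Matrix.mul_apply]
    rfl
  have h3 : J α i ^ 2 ≤ ∑ β, J β i ^ 2 :=
    Finset.single_le_sum (f := fun β => J β i ^ 2) (fun _ _ => sq_nonneg _) (Finset.mem_univ α)
  have h4 : c * J α i ^ 2 ≤ ξ := by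
    have := (le_abs_self _).trans (hL i i)
    rw [← h2] at this
    nlinarith
  have h5 : J α i ^ 2 ≤ 1 / c * ξ := by
    rw [div_mul_eq_mul_div, one_mul, le_div_iff₀ hc]; linarith
  have h6 : |J α i| ≤ 1 + J α i ^ 2 := by
    rw [← sq_abs]; nlinarith [sq_nonneg (|J α i| - 1)]
  linarith

theorem det_ne_zero (hG : G.IsEllipticWith c b) (hc : 0 < c) (hJ : J.det ≠ 0) :
    (J.transpose * G * J).det ≠ 0 := by
  intro h
  obtain ⟨v, hv, hv0⟩ := Matrix.exists_mulVec_eq_zero_iff.2 h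
  have h1 := hG.le (J.mulVec v)
  have h2 : J.mulVec v ⬝ᵥ (G.mulVec (J.mulVec v)) = v ⬝ᵥ ((J.transpose * G * J).mulVec v) := by
    rw [← Matrix.mulVec_mulVec, ← Matrix.mulVec_mulVec, Matrix.dotProduct_mulVec v,
      Matrix.vecMul_transpose]
  rw [h2, hv0, dotProduct_zero] at h1
  have h3 : ∑ i, (J.mulVec v) i ^ 2 ≤ 0 := by nlinarith
  have h4 : J.mulVec v = 0 := by
    ext i
    have := (Finset.sum_eq_zero_iff_of_nonneg fun i _ => sq_nonneg ((J.mulVec v) i)).1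
      (le_antisymm h3 (Finset.sum_nonneg fun i _ => sq_nonneg _)) i (Finset.mem_univ i)
    simpa using this
  exact hJ (Matrix.exists_mulVec_eq_zero_iff.1 ⟨v, hv, h4⟩)

/-- This makes `J⁻¹` polynomial in quantities that are already controlled, so no lower bound on `J`
itself is needed. It later also supplies the formula for the derivative of the inverse map. -/
theorem inv_eq (hG : G.IsEllipticWith c b) (hc : 0 < c) (hJ : J.det ≠ 0) :
    J⁻¹ = (J.transpose * G * J)⁻¹ * J.transpose * G := by
  have hL := hG.det_ne_zero hc hJ
  refine Matrix.inv_eq_left_inv ?_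
  rw [Matrix.mul_assoc, Matrix.mul_assoc, ← Matrix.mul_assoc J.transpose,
    Matrix.nonsing_inv_mul _ hL.isUnit]

theorem abs_inv_apply_le (hG : G.IsEllipticWith c b) (hc : 0 < c) (hJ : J.det ≠ 0) (hξ : 1 ≤ ξ)
    (hL : ∀ i j, |(J.transpose * G * J) i j| ≤ ξ)
    (hL' : ∀ i j, |(J.transpose * G * J)⁻¹ i j| ≤ ξ) (i j : Fin 4) :
    |J⁻¹ i j| ≤ 16 * ((1 + 1 / c) * b) * ξ ^ 2 := by
  rw [hG.inv_eq hc hJ]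
  have h1 := Matrix.abs_mul_apply_le hL' (B := J.transpose) fun i j => hG.abs_apply_le hc hξ hL j i
  refine (Matrix.abs_mul_apply_le h1 hG.abs_le i j).trans_eq ?_
  push_cast; ring

/-- The determinant of `J⁻¹` is a sum of `4! = 24` products of four entries, each of order `ξ²`. -/
theorem abs_det_inv_le (hG : G.IsEllipticWith c b) (hc : 0 < c) (hJ : J.det ≠ 0) (hξ : 1 ≤ ξ)
    (hL : ∀ i j, |(J.transpose * G * J) i j| ≤ ξ)
    (hL' : ∀ i j, |(J.transpose * G * J)⁻¹ i j| ≤ ξ) :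
    |J.det|⁻¹ ≤ 24 * (16 * ((1 + 1 / c) * b)) ^ 4 * ξ ^ 8 := by
  have h := Matrix.det_le (A := J⁻¹) (abv := AbsoluteValue.abs)
    (fun i j => hG.abs_inv_apply_le hc hJ hξ hL hL' i j)
  rw [Matrix.det_nonsing_inv, Ring.inverse_eq_inv', AbsoluteValue.abs_apply, abs_inv] at h
  refine h.trans_eq ?_
  simp only [Fintype.card_fin, Nat.factorial, nsmul_eq_mul]
  push_cast; ring

/-- Solving `⟨w, J e_j⟩_G = q_j` for `w`. -/
theorem norm_le_of_vecMul_eq (hG : G.IsEllipticWith c b) (hc : 0 < c) (hJ : J.det ≠ 0) {w : E4}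
    {q : Fin 4 → ℝ} {ρ κ : ℝ} (hw : ∀ j, ∑ α, ∑ β, G α β * w α * J β j = q j)
    (hq : ∀ j, |q j| ≤ ρ) (hκ : ∀ i j, |J⁻¹ i j| ≤ κ) : ‖w‖ ≤ 16 / c * (ρ * κ) := by
  have hρ : 0 ≤ ρ := (abs_nonneg _).trans (hq 0)
  have hκ0 : 0 ≤ κ := (abs_nonneg _).trans (hκ 0 0)
  have e1 : Matrix.vecMul (fun α => w α) (G * J) = q := by
    ext j
    rw [← hw j, ← Matrix.vecMul_vecMul]
    simp only [Matrix.vecMul, dotProduct, Finset.sum_mul]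
    rw [Finset.sum_comm]
    exact Finset.sum_congr rfl fun α _ => Finset.sum_congr rfl fun β _ => by ring
  have e2 : Matrix.vecMul (fun α => w α) G = Matrix.vecMul q J⁻¹ := by
    rw [← e1, Matrix.vecMul_vecMul, Matrix.mul_assoc, Matrix.mul_nonsing_inv _ hJ.isUnit,
      Matrix.mul_one]
  have h1 := hG.le fun α => w α
  rw [Matrix.dotProduct_mulVec, e2] at h1
  have h2 : Matrix.vecMul q J⁻¹ ⬝ᵥ (fun α => w α) ≤ 16 * (ρ * κ) * ‖w‖ := by
    calc Matrix.vecMul q J⁻¹ ⬝ᵥ (fun α => w α) = ∑ α, (∑ j, q j * J⁻¹ j α) * w α := rfl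
      _ ≤ ∑ _α : Fin 4, (4 * (ρ * κ)) * ‖w‖ := by
          refine Finset.sum_le_sum fun α _ => ?_
          refine (le_abs_self _).trans ?_
          rw [abs_mul]
          refine mul_le_mul ?_ (PiLp.norm_apply_le w α) (abs_nonneg _) (by positivity)
          refine (Finset.abs_sum_le_sum_abs _ _).trans ?_
          calc ∑ j, |q j * J⁻¹ j α| ≤ ∑ _j : Fin 4, ρ * κ := by
                refine Finset.sum_le_sum fun j _ => ?_
                rw [abs_mul]
                exact mul_le_mul (hq j) (hκ j α) (abs_nonneg _) hρ
            _ = _ := by simp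
      _ = _ := by simp; ring
  have h3 : ∑ i, (w i) ^ 2 = ‖w‖ ^ 2 := by
    rw [EuclideanSpace.norm_sq_eq]; simp
  rw [h3] at h1
  rcases (norm_nonneg w).eq_or_lt with h0 | h0
  · rw [← h0]; positivity
  · rw [div_mul_eq_mul_div, le_div_iff₀ hc]
    nlinarith

end Matrix.IsEllipticWith

/-- The Jacobian matrix. -/
noncomputable def jac (u : E4 → E4) (x : E4) : Matrix (Fin 4) (Fin 4) ℝ :=
  Matrix.of fun α i => fderiv ℝ u x (EuclideanSpace.single i 1) α

theorem det_jac (u : E4 → E4) (x : E4) : (jac u x).det = (fderiv ℝ u x).det := by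
  rw [ContinuousLinearMap.det,
    ← LinearMap.det_toMatrix (EuclideanSpace.basisFun (Fin 4) ℝ).toBasis]
  congr 1

variable {u : E4 → E4} {L G : E4 → Matrix (Fin 4) (Fin 4) ℝ} {x : E4}

/-- Differentiating the identity `L = u^* G`. -/
theorem fderiv_pullback_apply (hu : ContDiffAt ℝ 2 u x)
    (hG : ∀ α β, DifferentiableAt ℝ (fun y => G y α β) (u x))
    (hL : ∀ᶠ z in 𝓝 x, L z = (jac u z).transpose * G (u z) * jac u z) (i j : Fin 4) (v : E4) :
    fderiv ℝ (fun z => L z i j) x v = ∑ α, ∑ β,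
      (fderiv ℝ (fun y => G y α β) (u x) (fderiv ℝ u x v) * jac u x α i * jac u x β j +
      G (u x) α β * fderiv ℝ (fderiv ℝ u) x v (EuclideanSpace.single i 1) α * jac u x β j +
      G (u x) α β * fderiv ℝ (fderiv ℝ u) x v (EuclideanSpace.single j 1) β * jac u x α i) := by
  have hLe : (fun z => L z i j) =ᶠ[𝓝 x]
      fun z => ∑ α, ∑ β, G (u z) α β * jac u z α i * jac u z β j := by
    filter_upwards [hL] with z hz
    rw [hz, Matrix.mul_apply]
    simp only [Matrix.mul_apply, Matrix.transpose_apply, Finset.sum_mul]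
    rw [Finset.sum_comm]
    exact Finset.sum_congr rfl fun α _ => Finset.sum_congr rfl fun β _ => by ring
  have hu1 : HasFDerivAt u (fderiv ℝ u x) x := (hu.differentiableAt (by norm_num)).hasFDerivAt
  have hu2 : HasFDerivAt (fderiv ℝ u) (fderiv ℝ (fderiv ℝ u) x) x :=
    ((hu.fderiv_right (m := 1) (by norm_num)).differentiableAt (by norm_num)).hasFDerivAt
  have hJ : ∀ α k, HasFDerivAt (fun z => jac u z α k)
      ((EuclideanSpace.proj α : E4 →L[ℝ] ℝ).comp
        ((ContinuousLinearMap.apply ℝ E4 (EuclideanSpace.single k (1 : ℝ))).comp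
          (fderiv ℝ (fderiv ℝ u) x))) x := fun α k =>
    (EuclideanSpace.proj α : E4 →L[ℝ] ℝ).hasFDerivAt.comp x
      ((ContinuousLinearMap.apply ℝ E4 (EuclideanSpace.single k (1 : ℝ))).hasFDerivAt.comp x hu2)
  have hGu : ∀ α β, HasFDerivAt (fun z => G (u z) α β)
      ((fderiv ℝ (fun y => G y α β) (u x)).comp (fderiv ℝ u x)) x := fun α β =>
    (hG α β).hasFDerivAt.comp x hu1
  have hsum := HasFDerivAt.fun_sum (u := Finset.univ) fun α (_ : α ∈ Finset.univ) =>
    HasFDerivAt.fun_sum (u := Finset.univ) fun β (_ : β ∈ Finset.univ) =>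
      ((hGu α β).mul (hJ α i)).mul (hJ β j)
  have hL' : HasFDerivAt (fun z => L z i j) _ x := hsum.congr_of_eventuallyEq hLe
  rw [hL'.fderiv]
  simp only [sum_apply]
  refine Finset.sum_congr rfl fun α _ => Finset.sum_congr rfl fun β _ => ?_
  simp only [add_apply, smul_apply, smul_eq_mul,
    ContinuousLinearMap.comp_apply, ContinuousLinearMap.apply_apply, PiLp.proj_apply,
    Pi.mul_apply]
  ring

/-- The bound for the second derivative of an isometry `u : (ℝ⁴, L) → (ℝ⁴, G)` in terms of the first
derivatives of the metrics. -/
theorem exists_norm_fderiv_fderiv_le {c b : ℝ} (hc : 0 < c) : ∃ C : ℝ, 0 ≤ C ∧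
    ∀ (u : E4 → E4) (L G : E4 → Matrix (Fin 4) (Fin 4) ℝ) (x : E4) (ξ : ℝ), 1 ≤ ξ →
    ContDiffAt ℝ 2 u x → (∀ α β, DifferentiableAt ℝ (fun y => G y α β) (u x)) →
    (∀ᶠ z in 𝓝 x, L z = (jac u z).transpose * G (u z) * jac u z) → (G (u x)).IsEllipticWith c b →
    (jac u x).det ≠ 0 → (∀ i j, |L x i j| ≤ ξ) → (∀ i j, |(L x)⁻¹ i j| ≤ ξ) → ∀ k i : Fin 4,
    ‖fderiv ℝ (fderiv ℝ u) x (EuclideanSpace.single k 1) (EuclideanSpace.single i 1)‖ ≤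
      C * (ξ ^ 18 + (∑ i, ∑ j, ‖fderiv ℝ (fun z => L z i j) x‖) ^ 2 +
        (∑ α, ∑ β, ‖fderiv ℝ (fun y => G y α β) (u x)‖) ^ 2 * |(jac u x).det|) := by
  set C₁ : ℝ := 1 + 1 / c with hC₁
  have hC₁0 : 1 ≤ C₁ := by rw [hC₁]; have := one_div_pos.2 hc; linarith
  set C₂ : ℝ := 16 * (C₁ * |b|)
  have hC₂ : 0 ≤ C₂ := by positivity
  set C₃ : ℝ := 24 * C₂ ^ 4
  have hC₃ : 0 ≤ C₃ := by positivity
  -- `16 / c` comes from solving for the second derivative, `3 / 2` from the Koszul combination of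
  -- three terms, `C₂` from the bound on `J⁻¹`, and the last factor from Young's inequality.
  refine ⟨16 / c * (3 / 2 * C₂) * (1 + 4 * C₁ ^ 3 * (1 + C₃)), by positivity, ?_⟩
  intro u L G x ξ hξ hu hGd hL hG hJ hLx hLi k i
  have hGb : (G (u x)).IsEllipticWith c |b| := ⟨hG.1, hG.2, fun i j => (hG.3 i j).trans (le_abs_self b)⟩
  have hLx0 := hL.self_of_nhds
  rw [hLx0] at hLx hLi
  set dL := ∑ i, ∑ j, ‖fderiv ℝ (fun z => L z i j) x‖ with hdL
  set dG := ∑ α, ∑ β, ‖fderiv ℝ (fun y => G y α β) (u x)‖ with hdG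
  have hdL0 : 0 ≤ dL := Finset.sum_nonneg fun _ _ => Finset.sum_nonneg fun _ _ => norm_nonneg _
  have hdG0 : 0 ≤ dG := Finset.sum_nonneg fun _ _ => Finset.sum_nonneg fun _ _ => norm_nonneg _
  have hJle := hGb.abs_apply_le hc hξ hLx
  have hJi := hGb.abs_inv_apply_le hc hJ hξ hLx hLi
  have hdet := hGb.abs_det_inv_le hc hJ hξ hLx hLi
  set J := jac u x
  set e : Fin 4 → E4 := fun i => EuclideanSpace.single i 1
  set H : Fin 4 → Fin 4 → E4 := fun k i => fderiv ℝ (fderiv ℝ u) x (e k) (e i)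
  have hsymm : ∀ k i, H k i = H i k := fun k i =>
    (hu.isSymmSndFDerivAt (by simp)).eq (e k) (e i)
  -- `A k i j` is the `G`-product of `∂_k ∂_i u` with `∂_j u`, symmetric in `k, i`. The term `R k i
  -- j` is what remains of `∂_k L_ij` once the derivative of `G ∘ u` is removed, so that `R k i j =
  -- A k i j + A k j i`. This is the algebra that determines a torsion-free metric connection.
  set A : Fin 4 → Fin 4 → Fin 4 → ℝ := fun k i j => ∑ α, ∑ β, G (u x) α β * H k i α * J β j
    with hA
  have hAsymm : ∀ k i j, A k i j = A i k j := fun k i j => by simp only [hA, hsymm k i]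
  set R : Fin 4 → Fin 4 → Fin 4 → ℝ := fun k i j => fderiv ℝ (fun z => L z i j) x (e k) -
    ∑ α, ∑ β, fderiv ℝ (fun y => G y α β) (u x) (fderiv ℝ u x (e k)) * J α i * J β j with hR
  have hRA : ∀ k i j, R k i j = A k i j + A k j i := by
    intro k i j
    have h2 : A k j i = ∑ α, ∑ β, G (u x) α β * H k j β * J α i := by
      simp only [hA]
      rw [Finset.sum_comm]
      refine Finset.sum_congr rfl fun α _ => Finset.sum_congr rfl fun β _ => ?_
      rw [hG.isSymm.apply]
    rw [h2]
    simp only [hR, hA]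
    rw [fderiv_pullback_apply hu hGd hL i j (e k)]
    simp only [← Finset.sum_sub_distrib, ← Finset.sum_add_distrib]
    refine Finset.sum_congr rfl fun α _ => Finset.sum_congr rfl fun β _ => ?_
    ring
  -- Of the three factors `C₁ ξ`, two are entries of `J`, and one, with its factor `4`, comes from
  -- differentiating `G ∘ u` along `∂_k u`.
  set ρ : ℝ := dL + 4 * C₁ ^ 3 * (dG * ξ ^ 3) with hρ
  have hRle : ∀ k i j, |R k i j| ≤ ρ := by
    intro k i j
    refine (abs_sub _ _).trans (add_le_add ?_ ?_)
    · calc |fderiv ℝ (fun z => L z i j) x (e k)| ≤ ‖fderiv ℝ (fun z => L z i j) x‖ * ‖e k‖ :=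
            (fderiv ℝ (fun z => L z i j) x).le_opNorm (e k)
        _ = ‖fderiv ℝ (fun z => L z i j) x‖ := by simp [e]
        _ ≤ ∑ j, ‖fderiv ℝ (fun z => L z i j) x‖ :=
            Finset.single_le_sum (f := fun j => ‖fderiv ℝ (fun z => L z i j) x‖)
              (fun _ _ => norm_nonneg _) (Finset.mem_univ j)
        _ ≤ dL := Finset.single_le_sum (f := fun i => ∑ j, ‖fderiv ℝ (fun z => L z i j) x‖)
              (fun _ _ => Finset.sum_nonneg fun _ _ => norm_nonneg _) (Finset.mem_univ i)
    · have hDu : ‖fderiv ℝ u x (e k)‖ ≤ 4 * (C₁ * ξ) := by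
        rw [← (EuclideanSpace.basisFun (Fin 4) ℝ).sum_repr (fderiv ℝ u x (e k))]
        refine (norm_sum_le _ _).trans ?_
        calc _ ≤ ∑ _α : Fin 4, C₁ * ξ := by
              refine Finset.sum_le_sum fun α _ => ?_
              rw [norm_smul, OrthonormalBasis.norm_eq_one, mul_one]
              exact hJle α k
          _ = _ := by simp
      refine (Finset.abs_sum_le_sum_abs _ _).trans ?_
      calc _ ≤ ∑ α, ∑ β, ‖fderiv ℝ (fun y => G y α β) (u x)‖ * (4 * C₁ ^ 3 * ξ ^ 3) := by
            refine Finset.sum_le_sum fun α _ => (Finset.abs_sum_le_sum_abs _ _).trans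
              (Finset.sum_le_sum fun β _ => ?_)
            rw [abs_mul, abs_mul]
            have h1 : |fderiv ℝ (fun y => G y α β) (u x) (fderiv ℝ u x (e k))| ≤
                ‖fderiv ℝ (fun y => G y α β) (u x)‖ * (4 * (C₁ * ξ)) :=
              ((fderiv ℝ (fun y => G y α β) (u x)).le_opNorm _).trans
                (mul_le_mul_of_nonneg_left hDu (norm_nonneg _))
            calc _ ≤ ‖fderiv ℝ (fun y => G y α β) (u x)‖ * (4 * (C₁ * ξ)) * (C₁ * ξ) * (C₁ * ξ) := by
                  gcongr
                  · exact hJle α i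
                  · exact hJle β j
              _ = _ := by ring
        _ = 4 * C₁ ^ 3 * (dG * ξ ^ 3) := by
            simp only [← Finset.sum_mul]; rw [← hdG]; ring
  have hAle : ∀ j, |A k i j| ≤ 3 / 2 * ρ := by
    intro j
    -- Koszul's formula.
    have e1 : A k i j = (R k i j + R i k j - R j i k) / 2 := by
      rw [hRA, hRA, hRA, hAsymm i k j, hAsymm j i k, hAsymm j k i]; ring
    rw [e1, abs_le]
    have a1 := abs_le.1 (hRle k i j)
    have a2 := abs_le.1 (hRle i k j)
    have a3 := abs_le.1 (hRle j i k)
    constructor <;> linarith [a1.1, a1.2, a2.1, a2.2, a3.1, a3.2]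
  have hfin := hGb.norm_le_of_vecMul_eq hc hJ (w := H k i) (q := A k i) (fun j => rfl) hAle hJi
  refine hfin.trans ?_
  have hξ0 : 0 ≤ ξ := zero_le_one.trans hξ
  have hD : 0 < |J.det| := abs_pos.2 hJ
  have b1 : ξ ^ 2 * dL ≤ ξ ^ 18 + dL ^ 2 := by
    have : ξ ^ 4 ≤ ξ ^ 18 := pow_le_pow_right₀ hξ (by norm_num)
    nlinarith [sq_nonneg (ξ ^ 2 - dL), sq_nonneg (ξ ^ 2), sq_nonneg dL]
  -- Young's inequality weighted by `|det J|`: the square of `dG` acquires the Jacobian needed for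
  -- the change of variables, and `|det J|⁻¹ ≤ C₃ ξ⁸` absorbs the rest. This is the origin of the
  -- exponent `18 = 10 + 8`.
  have b2 : dG * ξ ^ 5 ≤ dG ^ 2 * |J.det| + C₃ * ξ ^ 18 := by
    have h1 : ξ ^ 10 * |J.det|⁻¹ ≤ C₃ * ξ ^ 18 := by
      calc ξ ^ 10 * |J.det|⁻¹ ≤ ξ ^ 10 * (C₃ * ξ ^ 8) := by gcongr
        _ = _ := by ring
    have h2 : dG * ξ ^ 5 ≤ dG ^ 2 * |J.det| + ξ ^ 10 * |J.det|⁻¹ := by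
      set d := |J.det|
      have e1 : dG ^ 2 * d + ξ ^ 10 * d⁻¹ - dG * ξ ^ 5 =
        d⁻¹ * ((dG * d - ξ ^ 5 / 2) ^ 2 + 3 / 4 * (ξ ^ 5) ^ 2) := by field_simp; ring
      have : 0 ≤ d⁻¹ * ((dG * d - ξ ^ 5 / 2) ^ 2 + 3 / 4 * (ξ ^ 5) ^ 2) := by positivity
      linarith
    linarith
  have b3 : 0 ≤ dL ^ 2 := sq_nonneg _
  have b4 : 0 ≤ dG ^ 2 * |J.det| := by positivity
  have b5 : 0 ≤ ξ ^ 18 := by positivity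
  calc 16 / c * (3 / 2 * ρ * (16 * (C₁ * |b|) * ξ ^ 2))
      = 16 / c * (3 / 2 * C₂) * (ξ ^ 2 * dL + 4 * C₁ ^ 3 * (dG * ξ ^ 5)) := by rw [hρ]; ring
    _ ≤ 16 / c * (3 / 2 * C₂) * ((1 + 4 * C₁ ^ 3 * (1 + C₃)) *
        (ξ ^ 18 + dL ^ 2 + dG ^ 2 * |J.det|)) := by
        refine mul_le_mul_of_nonneg_left ?_ (by positivity)
        have b6 : dG * ξ ^ 5 ≤ (1 + C₃) * (ξ ^ 18 + dL ^ 2 + dG ^ 2 * |J.det|) := by nlinarith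
        have b7 : 4 * C₁ ^ 3 * (dG * ξ ^ 5) ≤
          4 * C₁ ^ 3 * ((1 + C₃) * (ξ ^ 18 + dL ^ 2 + dG ^ 2 * |J.det|)) := by gcongr
        nlinarith
    _ = _ := by ring

end Pointwise

/-! ### Jacobian matrices and convergence of matrix-valued functions. -/

theorem jac_comp {v u : E4 → E4} {x : E4} (hv : DifferentiableAt ℝ v (u x))
    (hu : DifferentiableAt ℝ u x) : jac (v ∘ u) x = jac v (u x) * jac u x := by
  ext α i
  simp only [jac, Matrix.mul_apply, Matrix.of_apply, fderiv_comp x hv hu,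
    ContinuousLinearMap.comp_apply]
  rw [EuclideanSpace.apply_eq_sum_single (fderiv ℝ v (u x))]
  simp [mul_comm]

theorem jac_of_eventuallyEq_id {u : E4 → E4} {x : E4} (h : u =ᶠ[𝓝 x] id) : jac u x = 1 := by
  ext α i
  simp [jac, h.fderiv_eq, Matrix.one_apply]

theorem norm_clm_le_sum_abs (A : E4 →L[ℝ] E4) :
    ‖A‖ ≤ ∑ i, ∑ α, |A (EuclideanSpace.single i 1) α| := by
  refine (EuclideanSpace.norm_clm_le_sum A).trans (Finset.sum_le_sum fun i _ => ?_)
  conv_lhs => rw [← (EuclideanSpace.basisFun (Fin 4) ℝ).sum_repr (A (EuclideanSpace.single i 1))]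
  refine (norm_sum_le _ _).trans (Finset.sum_le_sum fun α _ => ?_)
  rw [norm_smul, OrthonormalBasis.norm_eq_one, mul_one]
  rfl

/-- The linear map with a given matrix. -/
noncomputable def matrixCLM (M : Matrix (Fin 4) (Fin 4) ℝ) : E4 →L[ℝ] E4 :=
  ∑ i, ∑ α, M α i • (EuclideanSpace.proj i : E4 →L[ℝ] ℝ).smulRight (EuclideanSpace.single α 1)

theorem matrixCLM_apply_single (M : Matrix (Fin 4) (Fin 4) ℝ) (α i : Fin 4) :
    matrixCLM M (EuclideanSpace.single i 1) α = M α i := by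
  simp [matrixCLM, sum_apply, Pi.single_apply, Finset.sum_apply]

theorem fderiv_eq_matrixCLM (u : E4 → E4) (x : E4) : fderiv ℝ u x = matrixCLM (jac u x) := by
  refine ContinuousLinearMap.ext fun v => ?_
  rw [EuclideanSpace.apply_eq_sum_single (fderiv ℝ u x),
    EuclideanSpace.apply_eq_sum_single (matrixCLM (jac u x))]
  refine Finset.sum_congr rfl fun i _ => ?_
  congr 1
  ext α
  rw [matrixCLM_apply_single]; rfl

theorem LpAllTendsto.matrixCLM {ι X : Type*} [MeasurableSpace X] {μ : Measure X} {l : Filter ι}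
    {A : ι → X → Matrix (Fin 4) (Fin 4) ℝ} {A₀ : X → Matrix (Fin 4) (Fin 4) ℝ}
    (h : ∀ i j, LpAllTendsto μ l (fun s y => A s y i j) fun y => A₀ y i j) :
    LpAllTendsto μ l (fun s y => matrixCLM (A s y)) fun y => matrixCLM (A₀ y) :=
  LpAllTendsto.sum _ fun i _ => LpAllTendsto.sum _ fun α _ =>
    (h α i).clm_comp (ContinuousLinearMap.toSpanSingleton ℝ _)

theorem LpAllTendsto.matrix_mul {ι X : Type*} [MeasurableSpace X] {μ : Measure X} {l : Filter ι}
    {A B : ι → X → Matrix (Fin 4) (Fin 4) ℝ} {A₀ B₀ : X → Matrix (Fin 4) (Fin 4) ℝ}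
    (hA : ∀ i j, LpAllTendsto μ l (fun s y => A s y i j) fun y => A₀ y i j)
    (hB : ∀ i j, LpAllTendsto μ l (fun s y => B s y i j) fun y => B₀ y i j) (i j : Fin 4) :
    LpAllTendsto μ l (fun s y => (A s y * B s y) i j) fun y => (A₀ y * B₀ y) i j := by
  simp only [Matrix.mul_apply]
  exact LpAllTendsto.sum _ fun k _ => (hA i k).mul (hB k j)

theorem LpAllTendsto.jac_apply {ι : Type*} {μ : Measure E4} {l : Filter ι}
    {u : ι → E4 → E4} {G : E4 → E4 →L[ℝ] E4}
    (h : LpAllTendsto μ l (fun s => fderiv ℝ (u s)) G) (α i : Fin 4) :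
    LpAllTendsto μ l (fun s y => jac (u s) y α i)
      (fun y => G y (EuclideanSpace.single i 1) α) :=
  h.clm_comp ((EuclideanSpace.proj α : E4 →L[ℝ] ℝ).comp
    (ContinuousLinearMap.apply ℝ E4 (EuclideanSpace.single i (1 : ℝ))))

/-- A function which dominates the entries of a matrix and of its inverse. -/
noncomputable def Matrix.size (A : Matrix (Fin 4) (Fin 4) ℝ) : ℝ :=
  1 + ((∑ i, ∑ j, |A i j|) + ∑ i, ∑ j, |A⁻¹ i j|)

theorem Matrix.one_le_size (A : Matrix (Fin 4) (Fin 4) ℝ) : 1 ≤ A.size := by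
  have : 0 ≤ (∑ i, ∑ j, |A i j|) + ∑ i, ∑ j, |A⁻¹ i j| := by positivity
  unfold Matrix.size; linarith

theorem Matrix.abs_le_sum_sum_abs (A : Matrix (Fin 4) (Fin 4) ℝ) (i j : Fin 4) :
    |A i j| ≤ ∑ i, ∑ j, |A i j| :=
  (Finset.single_le_sum (f := fun j => |A i j|) (fun _ _ => abs_nonneg _) (Finset.mem_univ j)).trans
    (Finset.single_le_sum (f := fun i => ∑ j, |A i j|)
      (fun _ _ => Finset.sum_nonneg fun _ _ => abs_nonneg _) (Finset.mem_univ i))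

theorem Matrix.abs_le_size (A : Matrix (Fin 4) (Fin 4) ℝ) (i j : Fin 4) :
    |A i j| ≤ A.size := by
  have : 0 ≤ ∑ i, ∑ j, |A⁻¹ i j| := by positivity
  have := A.abs_le_sum_sum_abs i j
  unfold Matrix.size; linarith

theorem Matrix.abs_inv_le_size (A : Matrix (Fin 4) (Fin 4) ℝ) (i j : Fin 4) :
    |A⁻¹ i j| ≤ A.size := by
  have : 0 ≤ ∑ i, ∑ j, |A i j| := by positivity
  have := A⁻¹.abs_le_sum_sum_abs i j
  unfold Matrix.size; linarith

/-- If continuous maps converge locally uniformly on `D` to a continuous map into `D'`, then they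
eventually map a compact subset of `D` into a fixed compact subset of `D'`. -/
theorem exists_compact_eventually_mapsTo {ι X Y : Type*} [TopologicalSpace X] [MetricSpace Y]
    [LocallyCompactSpace Y] {l : Filter ι} {K : Set X} (hK : IsCompact K) {D' : Set Y}
    (hD' : IsOpen D') {u : ι → X → Y} {u₀ : X → Y} (hu : TendstoUniformlyOn u u₀ l K)
    (hc : ContinuousOn u₀ K) (hm : MapsTo u₀ K D') :
    ∃ K' ⊆ D', IsCompact K' ∧ MapsTo u₀ K K' ∧ ∀ᶠ s in l, MapsTo (u s) K K' := by
  have hcpt := hK.image_of_continuousOn hc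
  obtain ⟨K', hK', h1, h2⟩ := exists_compact_between hcpt hD' hm.image_subset
  obtain ⟨δ, hδ, hsub⟩ := hcpt.exists_thickening_subset_open isOpen_interior h1
  refine ⟨K', h2, hK', fun x hx => interior_subset (h1 ⟨x, hx, rfl⟩), ?_⟩
  filter_upwards [Metric.tendstoUniformlyOn_iff.1 hu δ hδ] with s hs x hx
  refine interior_subset (hsub ?_)
  rw [Metric.mem_thickening_iff]
  exact ⟨u₀ x, ⟨x, hx, rfl⟩, by rw [dist_comm]; exact hs x hx⟩

/-! ### Families of isometries between open subsets of `ℝ⁴`. -/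

/-- Isometries `P s : (D, L s) → (D', G s)` between open subsets of `ℝ⁴`, with inverses `Q s`, such
that, as `s ↘ 0`, the maps converge locally uniformly and the metrics converge in `L^p_loc`. All
conditions are local, and only required for small `s` on each compact set. -/
structure IsometryFamily (D D' : Set E4) (P Q : ℝ → E4 → E4)
    (L G : ℝ → E4 → Matrix (Fin 4) (Fin 4) ℝ) : Prop where
  isOpen : IsOpen D
  isOpen' : IsOpen D'
  contP : ContinuousOn (P 0) D
  contQ : ContinuousOn (Q 0) D'
  mapsP : MapsTo (P 0) D D'
  mapsQ : MapsTo (Q 0) D' D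
  tendstoP : ∀ K ⊆ D, IsCompact K → TendstoUniformlyOn P (P 0) (𝓝[>] 0) K
  tendstoQ : ∀ K ⊆ D', IsCompact K → TendstoUniformlyOn Q (Q 0) (𝓝[>] 0) K
  smoothP : ∀ K ⊆ D, IsCompact K → ∀ᶠ s in 𝓝[>] 0, ∀ x ∈ K, ContDiffAt ℝ ∞ (P s) x
  smoothQ : ∀ K ⊆ D', IsCompact K → ∀ᶠ s in 𝓝[>] 0, ∀ x ∈ K, ContDiffAt ℝ ∞ (Q s) x
  left : ∀ K ⊆ D, IsCompact K → ∀ᶠ s in 𝓝[>] 0, ∀ x ∈ K, Q s (P s x) = x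
  right : ∀ K ⊆ D', IsCompact K → ∀ᶠ s in 𝓝[>] 0, ∀ y ∈ K, P s (Q s y) = y
  isometry : ∀ K ⊆ D, IsCompact K → ∀ᶠ s in 𝓝[>] 0, ∀ x ∈ K,
    L s x = (jac (P s) x).transpose * G s (P s x) * jac (P s) x
  elliptic : ∀ K ⊆ D', IsCompact K → ∃ c b : ℝ, 0 < c ∧ ∀ᶠ s in 𝓝[>] 0, ∀ y ∈ K,
    (G s y).IsEllipticWith c b
  diffG : ∀ K ⊆ D', IsCompact K → ∀ᶠ s in 𝓝[>] 0, ∀ y ∈ K, ∀ α β,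
    DifferentiableAt ℝ (fun z => G s z α β) y
  convL : ∀ K ⊆ D, IsCompact K → ∀ i j,
    LpAllTendsto (volume.restrict K) (𝓝[>] 0) (fun s x => L s x i j) fun x => L 0 x i j
  convLinv : ∀ K ⊆ D, IsCompact K → ∀ i j,
    LpAllTendsto (volume.restrict K) (𝓝[>] 0) (fun s x => (L s x)⁻¹ i j) fun x => (L 0 x)⁻¹ i j
  convG : ∀ K ⊆ D', IsCompact K → ∀ i j,
    LpAllTendsto (volume.restrict K) (𝓝[>] 0) (fun s x => G s x i j) fun x => G 0 x i j
  bddL : ∀ K ⊆ D, IsCompact K → ∀ i j, ∃ C : ℝ≥0, ∀ᶠ s in 𝓝[>] 0,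
    eLpNorm (fderiv ℝ fun x => L s x i j) 2 (volume.restrict K) ≤ C
  bddG : ∀ K ⊆ D', IsCompact K → ∀ i j, ∃ C : ℝ≥0, ∀ᶠ s in 𝓝[>] 0,
    eLpNorm (fderiv ℝ fun x => G s x i j) 2 (volume.restrict K) ≤ C

namespace IsometryFamily

variable {D D' : Set E4} {P Q : ℝ → E4 → E4} {L G : ℝ → E4 → Matrix (Fin 4) (Fin 4) ℝ}

theorem exists_mapsTo (h : IsometryFamily D D' P Q L G) {K : Set E4} (hKD : K ⊆ D)
    (hK : IsCompact K) : ∃ K' ⊆ D', IsCompact K' ∧ MapsTo (P 0) K K' ∧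
      ∀ᶠ s in 𝓝[>] 0, MapsTo (P s) K K' :=
  exists_compact_eventually_mapsTo hK h.isOpen' (h.tendstoP K hKD hK) (h.contP.mono hKD)
    (h.mapsP.mono_left hKD)

theorem exists_mapsTo' (h : IsometryFamily D D' P Q L G) {K : Set E4} (hKD : K ⊆ D')
    (hK : IsCompact K) : ∃ K' ⊆ D, IsCompact K' ∧ MapsTo (Q 0) K K' ∧
      ∀ᶠ s in 𝓝[>] 0, MapsTo (Q s) K K' :=
  exists_compact_eventually_mapsTo hK h.isOpen (h.tendstoQ K hKD hK) (h.contQ.mono hKD)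
    (h.mapsQ.mono_left hKD)

theorem eventually_jac_mul_jac (h : IsometryFamily D D' P Q L G) {K : Set E4} (hKD : K ⊆ D)
    (hK : IsCompact K) : ∀ᶠ s in 𝓝[>] 0, ∀ x ∈ K, jac (Q s) (P s x) * jac (P s) x = 1 := by
  -- `K₁` is a neighbourhood of `K`: the relation `Q s (P s x) = x` has to hold near each point of
  -- `K` before it can be differentiated there.
  obtain ⟨K₁, hK₁, h1, h2⟩ := exists_compact_between hK h.isOpen hKD
  obtain ⟨K', hK'D, hK', -, hm⟩ := h.exists_mapsTo h2 hK₁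
  filter_upwards [hm, h.smoothQ K' hK'D hK', h.smoothP K₁ h2 hK₁, h.left K₁ h2 hK₁]
    with s s1 s2 s3 s4 x hx
  have hx₁ : x ∈ K₁ := interior_subset (h1 hx)
  rw [← jac_comp ((s2 _ (s1 hx₁)).differentiableAt (by simp))
    ((s3 x hx₁).differentiableAt (by simp))]
  refine jac_of_eventuallyEq_id ?_
  filter_upwards [mem_interior_iff_mem_nhds.1 (h1 hx)] with z hz using s4 z hz

theorem eventually_jac_mul_jac' (h : IsometryFamily D D' P Q L G) {K : Set E4} (hKD : K ⊆ D')
    (hK : IsCompact K) : ∀ᶠ s in 𝓝[>] 0, ∀ y ∈ K, jac (P s) (Q s y) * jac (Q s) y = 1 := by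
  obtain ⟨K₁, hK₁, h1, h2⟩ := exists_compact_between hK h.isOpen' hKD
  obtain ⟨K', hK'D, hK', -, hm⟩ := h.exists_mapsTo' h2 hK₁
  filter_upwards [hm, h.smoothP K' hK'D hK', h.smoothQ K₁ h2 hK₁, h.right K₁ h2 hK₁]
    with s s1 s2 s3 s4 x hx
  have hx₁ : x ∈ K₁ := interior_subset (h1 hx)
  rw [← jac_comp ((s2 _ (s1 hx₁)).differentiableAt (by simp))
    ((s3 x hx₁).differentiableAt (by simp))]
  refine jac_of_eventuallyEq_id ?_
  filter_upwards [mem_interior_iff_mem_nhds.1 (h1 hx)] with z hz using s4 z hz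

theorem eventually_det_jac_ne_zero (h : IsometryFamily D D' P Q L G) {K : Set E4} (hKD : K ⊆ D)
    (hK : IsCompact K) : ∀ᶠ s in 𝓝[>] 0, ∀ x ∈ K, (jac (P s) x).det ≠ 0 := by
  filter_upwards [h.eventually_jac_mul_jac hKD hK] with s hs x hx h0
  have := congrArg Matrix.det (hs x hx)
  rw [Matrix.det_mul, h0, mul_zero, Matrix.det_one] at this
  exact zero_ne_one this

theorem bdd_size (h : IsometryFamily D D' P Q L G) {K : Set E4} (hKD : K ⊆ D)
    (hK : IsCompact K) : LpAllBdd (volume.restrict K) (𝓝[>] 0) fun s x => (L s x).size := by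
  have : IsFiniteMeasure (volume.restrict K : Measure E4) := ⟨by simpa using hK.measure_lt_top⟩
  have hsum : ∀ A : ℝ → E4 → Matrix (Fin 4) (Fin 4) ℝ, ∀ A₀ : E4 → Matrix (Fin 4) (Fin 4) ℝ,
      (∀ i j, LpAllTendsto (volume.restrict K) (𝓝[>] 0) (fun s x => A s x i j) fun x => A₀ x i j) →
      LpAllBdd (volume.restrict K) (𝓝[>] 0) (fun s x => ∑ i, ∑ j, |A s x i j|) ∧
      ∀ᶠ s in 𝓝[>] 0, AEStronglyMeasurable (fun x => ∑ i, ∑ j, |A s x i j|)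
        (volume.restrict K) := by
    intro A A₀ hA
    have h1 : ∀ i j, LpAllBdd (volume.restrict K) (𝓝[>] 0) (fun s x => |A s x i j|) := fun i j =>
      (hA i j).bdd.of_norm_le (Eventually.of_forall fun s => Eventually.of_forall fun x => by simp)
    have h2 : ∀ i j, ∀ᶠ s in 𝓝[>] 0, AEStronglyMeasurable (fun x => |A s x i j|)
      (volume.restrict K) := fun i j => (hA i j).aesm.mono fun s hs => hs.norm
    have h3 := fun i => LpAllBdd.sum Finset.univ (fun j _ => h1 i j) (fun j _ => h2 i j)
    exact LpAllBdd.sum Finset.univ (fun i _ => (h3 i).1) (fun i _ => (h3 i).2)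
  obtain ⟨a1, a2⟩ := hsum L (L 0) (h.convL K hKD hK)
  obtain ⟨b1, b2⟩ := hsum _ _ (h.convLinv K hKD hK)
  have hc : LpAllBdd (volume.restrict K) (𝓝[>] (0 : ℝ)) fun _ _ => (1 : ℝ) := fun p _ _ =>
    ⟨(eLpNorm (fun _ => (1 : ℝ)) p (volume.restrict K)).toNNReal, Eventually.of_forall fun s => by
      rw [ENNReal.coe_toNNReal (memLp_const (1 : ℝ)).2.ne]⟩
  exact hc.add (a1.add b1 a2 b2) (Eventually.of_forall fun _ => aestronglyMeasurable_const)
    (by filter_upwards [a2, b2] with s x y using x.add y)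

/-- The pointwise bounds for the Jacobian matrix. -/
theorem eventually_abs_jac_le (h : IsometryFamily D D' P Q L G) {K : Set E4} (hKD : K ⊆ D)
    (hK : IsCompact K) : ∃ C : ℝ, 0 ≤ C ∧ ∀ᶠ s in 𝓝[>] 0, ∀ x ∈ K, ∀ α i,
      |jac (P s) x α i| ≤ C * (L s x).size := by
  obtain ⟨K', hK'D, hK', -, hm⟩ := h.exists_mapsTo hKD hK
  obtain ⟨c, b, hc, he⟩ := h.elliptic K' hK'D hK'
  refine ⟨1 + 1 / c, by positivity, ?_⟩
  filter_upwards [hm, he, h.isometry K hKD hK] with s s1 s2 s3 x hx α i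
  refine (s2 _ (s1 hx)).abs_apply_le hc (L s x).one_le_size (fun i j => ?_) α i
  rw [← s3 x hx]
  exact (L s x).abs_le_size i j

theorem bdd_fderiv (h : IsometryFamily D D' P Q L G) {K : Set E4} (hKD : K ⊆ D)
    (hK : IsCompact K) : LpAllBdd (volume.restrict K) (𝓝[>] 0) fun s => fderiv ℝ (P s) := by
  obtain ⟨C, hC, hev⟩ := h.eventually_abs_jac_le hKD hK
  refine ((h.bdd_size hKD hK).const_mul (16 * C)).of_norm_le ?_
  filter_upwards [hev] with s hs
  refine (ae_restrict_iff' hK.measurableSet).2 (Eventually.of_forall fun x hx => ?_)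
  refine (norm_clm_le_sum_abs _).trans (le_trans ?_ (le_abs_self _))
  calc _ ≤ ∑ _i : Fin 4, ∑ _α : Fin 4, C * (L s x).size :=
        Finset.sum_le_sum fun i _ => Finset.sum_le_sum fun α _ => hs x hx α i
    _ = _ := by simp; ring

/-- Integrating the pointwise bound leaves three terms: a power of the size of `L` and its inverse,
bounded by the `L^p` convergence; `|DL|²`, bounded by the Sobolev assumption; and `|DG ∘ P|² |det
DP|`, which becomes an integral of `|DG|²` over the image. -/
theorem bdd_fderiv_fderiv (h : IsometryFamily D D' P Q L G) {K : Set E4} (hKD : K ⊆ D)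
    (hK : IsCompact K) (i : Fin 4) : ∃ C : ℝ≥0, ∀ᶠ s in 𝓝[>] 0,
      ∫⁻ x in K, ‖fderiv ℝ (fderiv ℝ (P s)) x (EuclideanSpace.single i 1)
        (EuclideanSpace.single i 1)‖ₑ ≤ C := by
  -- The isometry identity is needed on a neighbourhood of `K`, since it will be differentiated.
  obtain ⟨K₁, hK₁, h1, h2⟩ := exists_compact_between hK h.isOpen hKD
  obtain ⟨K', hK'D, hK', -, hm⟩ := h.exists_mapsTo hKD hK
  obtain ⟨c, b, hc, he⟩ := h.elliptic K' hK'D hK'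
  obtain ⟨C, hC, hpt⟩ := exists_norm_fderiv_fderiv_le (b := b) hc
  obtain ⟨C₁, hC₁⟩ := ((h.bdd_size hKD hK).pow (n := 18) (by norm_num)).lintegral_enorm_le
  -- squares of sums of derivatives of components
  have hsq : ∀ (A : ℝ → E4 → Matrix (Fin 4) (Fin 4) ℝ) (B : Set E4),
      (∀ i j, ∃ C : ℝ≥0, ∀ᶠ s in 𝓝[>] 0,
        eLpNorm (fderiv ℝ fun x => A s x i j) 2 (volume.restrict B) ≤ C) →
      ∃ C : ℝ≥0, ∀ᶠ s in 𝓝[>] 0, ∫⁻ x in B,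
        ENNReal.ofReal ((∑ i, ∑ j, ‖fderiv ℝ (fun z => A s z i j) x‖) ^ 2) ≤ C := by
    intro A B hA
    choose C hC using hA
    refine ⟨(∑ i, ∑ j, C i j) ^ 2, ?_⟩
    filter_upwards [eventually_all.2 fun i => eventually_all.2 fun j => hC i j] with s hs
    have hm : ∀ i j, Measurable fun x => ‖fderiv ℝ (fun z => A s z i j) x‖ := fun i j =>
      (measurable_fderiv ℝ _).norm
    have hle : eLpNorm (fun x => ∑ i, ∑ j, ‖fderiv ℝ (fun z => A s z i j) x‖) 2
        (volume.restrict B) ≤ ∑ i, ∑ j, (C i j : ℝ≥0∞) := by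
      have e1 : (fun x => ∑ i, ∑ j, ‖fderiv ℝ (fun z => A s z i j) x‖) =
        ∑ i, ∑ j, fun x => ‖fderiv ℝ (fun z => A s z i j) x‖ := by ext x; simp
      rw [e1]
      refine (eLpNorm_sum_le (fun i _ => Finset.aestronglyMeasurable_sum _ fun j _ =>
        (hm i j).aestronglyMeasurable) (by norm_num)).trans (Finset.sum_le_sum fun i _ => ?_)
      refine (eLpNorm_sum_le (fun j _ => (hm i j).aestronglyMeasurable) (by norm_num)).trans
        (Finset.sum_le_sum fun j _ => ?_)
      rw [eLpNorm_norm]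
      exact hs i j
    rw [eLpNorm_eq_lintegral_rpow_enorm_toReal (by norm_num) (by norm_num)] at hle
    have := ENNReal.rpow_le_rpow hle (show (0 : ℝ) ≤ 2 by norm_num)
    rw [← ENNReal.rpow_mul] at this
    simp only [ENNReal.toReal_ofNat, one_div, ne_eq, OfNat.ofNat_ne_zero, not_false_eq_true,
      inv_mul_cancel₀, ENNReal.rpow_one, ENNReal.rpow_ofNat] at this
    push_cast
    refine le_trans (lintegral_mono fun x => ?_) this
    rw [← ofReal_norm, ← ENNReal.ofReal_pow (norm_nonneg _), Real.norm_eq_abs, sq_abs]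
  obtain ⟨C₂, hC₂⟩ := hsq L K (h.bddL K hKD hK)
  obtain ⟨C₃, hC₃⟩ := hsq G K' (h.bddG K' hK'D hK')
  refine ⟨C.toNNReal * (C₁ + C₂ + C₃), ?_⟩
  filter_upwards [hm, he, h.isometry K₁ h2 hK₁, h.smoothP K hKD hK, h.diffG K' hK'D hK',
    h.eventually_det_jac_ne_zero hKD hK, hC₁, hC₂, hC₃, h.left K hKD hK]
    with s s1 s2 s3 s4 s5 s6 s7 s8 s9 s10
  set dL : E4 → ℝ := fun x => ∑ i, ∑ j, ‖fderiv ℝ (fun z => L s z i j) x‖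
  set dG : E4 → ℝ := fun y => ∑ i, ∑ j, ‖fderiv ℝ (fun z => G s z i j) y‖
  have hdLm : Measurable fun x => ENNReal.ofReal (dL x ^ 2) :=
    ((Finset.measurable_fun_sum _ fun i _ => Finset.measurable_fun_sum _ fun j _ =>
      (measurable_fderiv ℝ _).norm).pow_const 2).ennreal_ofReal
  have hcont : ContinuousOn (P s) K := fun x hx => (s4 x hx).continuousAt.continuousWithinAt
  -- Change of variables, with `P s` injective on `K` because of its left inverse and with its image
  -- inside `K'`.
  have hcv : ∫⁻ x in K, ENNReal.ofReal |(fderiv ℝ (P s) x).det| * ENNReal.ofReal (dG (P s x) ^ 2)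
      ≤ C₃ := by
    rw [← lintegral_image_eq_lintegral_abs_det_fderiv_mul volume hK.measurableSet
      (fun x hx => ((s4 x hx).differentiableAt (by simp)).hasFDerivAt.hasFDerivWithinAt)
      (fun x hx y hy hxy => by rw [← s10 x hx, ← s10 y hy, hxy])
      (fun y => ENNReal.ofReal (dG y ^ 2))]
    exact (lintegral_mono_set s1.image_subset).trans s9
  calc ∫⁻ x in K, ‖fderiv ℝ (fderiv ℝ (P s)) x (EuclideanSpace.single i 1)
        (EuclideanSpace.single i 1)‖ₑ
      ≤ ∫⁻ x in K, ENNReal.ofReal C * ((‖(L s x).size ^ 18‖ₑ + ENNReal.ofReal (dL x ^ 2)) +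
          ENNReal.ofReal |(fderiv ℝ (P s) x).det| * ENNReal.ofReal (dG (P s x) ^ 2)) := by
        refine setLIntegral_mono' hK.measurableSet fun x hx => ?_
        have hx₁ : x ∈ K₁ := interior_subset (h1 hx)
        have := hpt (P s) (L s) (G s) x (L s x).size (L s x).one_le_size
          ((s4 x hx).of_le (WithTop.coe_le_coe.2 (le_top : (2 : ℕ∞) ≤ ⊤))) (s5 _ (s1 hx))
          (by filter_upwards [mem_interior_iff_mem_nhds.1 (h1 hx)] with z hz using s3 z hz)
          (s2 _ (s1 hx)) (s6 x hx) (L s x).abs_le_size (L s x).abs_inv_le_size i i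
        have h18 : 0 ≤ (L s x).size ^ 18 := by
          have := (L s x).one_le_size; positivity
        rw [← ofReal_norm]
        refine (ENNReal.ofReal_le_ofReal this).trans_eq ?_
        rw [ENNReal.ofReal_mul hC, ENNReal.ofReal_add (by positivity) (by positivity),
          ENNReal.ofReal_add (by positivity) (by positivity), ← ofReal_norm ((L s x).size ^ 18),
          Real.norm_of_nonneg h18, ← det_jac, mul_comm (_ ^ 2) |_|,
          ENNReal.ofReal_mul (abs_nonneg _)]
    _ = ENNReal.ofReal C * ∫⁻ x in K, ((‖(L s x).size ^ 18‖ₑ + ENNReal.ofReal (dL x ^ 2)) +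
          ENNReal.ofReal |(fderiv ℝ (P s) x).det| * ENNReal.ofReal (dG (P s x) ^ 2)) :=
        lintegral_const_mul' _ _ ENNReal.ofReal_ne_top
    _ ≤ ENNReal.ofReal C * (C₁ + C₂ + C₃) := by
        refine mul_le_mul_right ?_ _
        have hdet : AEMeasurable (fun x => ENNReal.ofReal |(fderiv ℝ (P s) x).det| *
            ENNReal.ofReal (dG (P s x) ^ 2)) (volume.restrict K) := by
          have m1 : Measurable fun x => (fderiv ℝ (P s) x).det :=
            ContinuousLinearMap.continuous_det.measurable.comp (measurable_fderiv ℝ (P s))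
          have m2 : Measurable dG := Finset.measurable_fun_sum _ fun i _ =>
            Finset.measurable_fun_sum _ fun j _ => (measurable_fderiv ℝ _).norm
          exact (m1.abs.ennreal_ofReal.aemeasurable).mul
            ((m2.pow_const 2).ennreal_ofReal.comp_aemeasurable
              (hcont.aemeasurable hK.measurableSet))
        rw [lintegral_add_right' _ hdet, lintegral_add_right _ hdLm]
        exact add_le_add (add_le_add s7 s8) hcv
    _ = _ := by push_cast; rfl

end IsometryFamily

/-! ### Convergence of the isometries, of their inverses and of the metrics. -/

namespace IsometryFamily

variable {D D' : Set E4} {P Q : ℝ → E4 → E4} {L G : ℝ → E4 → Matrix (Fin 4) (Fin 4) ℝ}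

theorem eventually_contDiffAt_two (h : IsometryFamily D D' P Q L G) {K : Set E4} (hKD : K ⊆ D)
    (hK : IsCompact K) : ∀ᶠ s in 𝓝[>] 0, ∀ x ∈ K, ContDiffAt ℝ 2 (P s) x :=
  (h.smoothP K hKD hK).mono fun _ hs x hx =>
    (hs x hx).of_le (WithTop.coe_le_coe.2 (le_top : (2 : ℕ∞) ≤ ⊤))

theorem eventually_contDiffAt_two' (h : IsometryFamily D D' P Q L G) {K : Set E4} (hKD : K ⊆ D')
    (hK : IsCompact K) : ∀ᶠ s in 𝓝[>] 0, ∀ x ∈ K, ContDiffAt ℝ 2 (Q s) x :=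
  (h.smoothQ K hKD hK).mono fun _ hs x hx =>
    (hs x hx).of_le (WithTop.coe_le_coe.2 (le_top : (2 : ℕ∞) ≤ ⊤))

theorem exists_tendsto_fderiv (h : IsometryFamily D D' P Q L G) : ∃ DP : E4 → E4 →L[ℝ] E4,
    ∀ K ⊆ D, IsCompact K →
      LpAllTendsto (volume.restrict K) (𝓝[>] 0) (fun s => fderiv ℝ (P s)) DP := by
  refine exists_lpAllTendsto_of_cauchy h.isOpen
    (fun K _ _ => Eventually.of_forall fun s => (measurable_fderiv ℝ (P s)).aestronglyMeasurable)
    (fun K hKD hK => h.bdd_fderiv hKD hK) fun K hKD hK ε hε => ?_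
  exact exists_eLpNorm_fderiv_sub_lt h.isOpen h.tendstoP
    (fun K hKD hK => h.eventually_contDiffAt_two hKD hK)
    (fun K hKD hK i => h.bdd_fderiv_fderiv hKD hK i) hKD hK hε

/-- The substitution `y = P s x` exhibits `|det DP|` as the density of the push-forward under `Q s`.
It is at most `4!` times a fourth power of the bound on the entries of `DP`, hence bounded in `L²`,
and Cauchy–Schwarz applies. -/
theorem exists_hasSquareIntegrableDensity (h : IsometryFamily D D' P Q L G) {K : Set E4}
    (hKD : K ⊆ D') (hK : IsCompact K) : ∃ B ⊆ D, IsCompact B ∧ ∃ C : ℝ≥0, ∀ᶠ s in 𝓝[>] 0,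
      ContinuousOn (Q s) K ∧
      HasSquareIntegrableDensity C (volume.restrict K) (volume.restrict B) (Q s) := by
  obtain ⟨B, hBD, hB, -, hm⟩ := h.exists_mapsTo' hKD hK
  obtain ⟨c, hc, hJ⟩ := h.eventually_abs_jac_le hBD hB
  obtain ⟨C, hC⟩ := (((h.bdd_size hBD hB).pow (n := 4) (by norm_num)).const_mul (24 * c ^ 4)) 2
    (by norm_num) (by norm_num)
  refine ⟨B, hBD, hB, C, ?_⟩
  filter_upwards [hm, hJ, hC, h.smoothQ K hKD hK, h.smoothP B hBD hB, h.right K hKD hK]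
    with s s1 s2 s3 s4 s5 s6
  have hcont : ContinuousOn (Q s) K := fun y hy => (s4 y hy).continuousAt.continuousWithinAt
  refine ⟨hcont, hcont.aemeasurable hK.measurableSet, fun f hf => ?_⟩
  have hX : IsCompact (Q s '' K) := hK.image_of_continuousOn hcont
  have himg : P s '' (Q s '' K) = K := by
    rw [← image_comp]
    exact (image_congr fun y hy => s6 y hy).trans (image_id K)
  have hdet : ∀ x ∈ B, ENNReal.ofReal |(fderiv ℝ (P s) x).det| ≤
      ‖24 * c ^ 4 * (L s x).size ^ 4‖ₑ := by
    intro x hx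
    rw [← ofReal_norm]
    refine ENNReal.ofReal_le_ofReal (le_trans ?_ (le_abs_self _))
    rw [← det_jac]
    refine (Matrix.det_le (abv := AbsoluteValue.abs) fun α i => s2 x hx α i).trans_eq ?_
    simp only [Fintype.card_fin, Nat.factorial, nsmul_eq_mul]
    push_cast; ring
  have m1 : Measurable fun x => ENNReal.ofReal |(fderiv ℝ (P s) x).det| :=
    (ContinuousLinearMap.continuous_det.measurable.comp
      (measurable_fderiv ℝ (P s))).abs.ennreal_ofReal
  calc ∫⁻ y in K, f (Q s y) = ∫⁻ y in P s '' (Q s '' K), f (Q s y) := by rw [himg]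
    _ = ∫⁻ x in Q s '' K, ENNReal.ofReal |(fderiv ℝ (P s) x).det| * f (Q s (P s x)) := by
        refine lintegral_image_eq_lintegral_abs_det_fderiv_mul volume hX.measurableSet
          (fun x hx => ?_) ?_ _
        · exact ((s5 x (s1.image_subset hx)).differentiableAt
            (by simp)).hasFDerivAt.hasFDerivWithinAt
        · rintro _ ⟨y, hy, rfl⟩ _ ⟨z, hz, rfl⟩ hyz
          rw [s6 y hy, s6 z hz] at hyz
          rw [hyz]
    _ = ∫⁻ x in Q s '' K, ENNReal.ofReal |(fderiv ℝ (P s) x).det| * f x := by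
        refine setLIntegral_congr_fun hX.measurableSet ?_
        rintro _ ⟨y, hy, rfl⟩
        simp only [s6 y hy]
    _ ≤ ∫⁻ x in B, ENNReal.ofReal |(fderiv ℝ (P s) x).det| * f x :=
        lintegral_mono_set s1.image_subset
    _ ≤ (∫⁻ x in B, ENNReal.ofReal |(fderiv ℝ (P s) x).det| ^ (2 : ℝ)) ^ (1 / 2 : ℝ) *
        (∫⁻ x in B, f x ^ (2 : ℝ)) ^ (1 / 2 : ℝ) :=
        ENNReal.lintegral_mul_le_Lp_mul_Lq _ (by constructor <;> norm_num) m1.aemeasurable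
          hf.aemeasurable
    _ ≤ C * (∫⁻ x in B, f x ^ (2 : ℝ)) ^ (1 / 2 : ℝ) := by
        refine mul_le_mul_left (le_trans ?_ s3) _
        rw [eLpNorm_eq_lintegral_rpow_enorm_toReal (by norm_num) (by norm_num)]
        simp only [ENNReal.toReal_ofNat]
        refine ENNReal.rpow_le_rpow (setLIntegral_mono' hB.measurableSet fun x hx => ?_)
          (by norm_num)
        exact ENNReal.rpow_le_rpow (hdet x hx) (by norm_num)
    _ = _ := by simp only [ENNReal.rpow_ofNat]

/-- Convergence in all `L^p_loc(D)` is preserved by composition with the maps `Q s`. -/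
theorem tendsto_comp (h : IsometryFamily D D' P Q L G) {E : Type*} [NormedAddCommGroup E]
    [NormedSpace ℝ E] {f : ℝ → E4 → E} {f₀ : E4 → E}
    (hf : ∀ K ⊆ D, IsCompact K → LpAllTendsto (volume.restrict K) (𝓝[>] 0) f f₀)
    {K : Set E4} (hKD : K ⊆ D') (hK : IsCompact K) :
    LpAllTendsto (volume.restrict K) (𝓝[>] 0) (fun s y => f s (Q s y)) (fun y => f₀ (Q 0 y)) := by
  obtain ⟨B, hBD, hB, C, hev⟩ := h.exists_hasSquareIntegrableDensity hKD hK
  exact (hf B hBD hB).comp hK hB (hev.mono fun s hs => hs.2) (hev.mono fun s hs => hs.1)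
    (h.tendstoQ K hKD hK)

/-- The derivative of `Q s` is the inverse of the Jacobian of `P s` at `Q s y`, that is `(L⁻¹ ∘ Q)
(Jᵀ ∘ Q) G`. Each factor converges in every `L^p_loc`, the first two by stability under composition.
-/
theorem exists_tendsto_fderiv' (h : IsometryFamily D D' P Q L G) : ∃ DQ : E4 → E4 →L[ℝ] E4,
    ∀ K ⊆ D', IsCompact K →
      LpAllTendsto (volume.restrict K) (𝓝[>] 0) (fun s => fderiv ℝ (Q s)) DQ := by
  obtain ⟨DP, hDP⟩ := h.exists_tendsto_fderiv
  refine ⟨fun y => matrixCLM ((L 0 (Q 0 y))⁻¹ * (Matrix.of fun i α => DP (Q 0 y)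
    (EuclideanSpace.single i 1) α) * G 0 y), fun K hKD hK => ?_⟩
  have h1 : ∀ i j, LpAllTendsto (volume.restrict K) (𝓝[>] 0)
      (fun s y => (L s (Q s y))⁻¹ i j) fun y => (L 0 (Q 0 y))⁻¹ i j := fun i j =>
    h.tendsto_comp (f := fun s x => (L s x)⁻¹ i j) (f₀ := fun x => (L 0 x)⁻¹ i j)
      (fun K hKD hK => h.convLinv K hKD hK i j) hKD hK
  have h2 : ∀ i α, LpAllTendsto (volume.restrict K) (𝓝[>] 0)
      (fun s y => (jac (P s) (Q s y)).transpose i α) fun y => (Matrix.of fun i α => DP (Q 0 y)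
        (EuclideanSpace.single i 1) α) i α := fun i α =>
    h.tendsto_comp (f := fun s x => jac (P s) x α i)
      (f₀ := fun x => DP x (EuclideanSpace.single i 1) α)
      (fun K hKD hK => (hDP K hKD hK).jac_apply α i) hKD hK
  have h3 := LpAllTendsto.matrixCLM (LpAllTendsto.matrix_mul
    (LpAllTendsto.matrix_mul h1 h2) (h.convG K hKD hK))
  refine h3.congr ?_ (ae_eq_refl _)
  obtain ⟨B, hBD, hB, -, hm⟩ := h.exists_mapsTo' hKD hK
  obtain ⟨c, b, hc, he⟩ := h.elliptic K hKD hK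
  filter_upwards [hm, he, h.isometry B hBD hB, h.eventually_det_jac_ne_zero hBD hB,
    h.eventually_jac_mul_jac' hKD hK, h.right K hKD hK] with s s1 s2 s3 s4 s5 s6
  refine (ae_restrict_iff' hK.measurableSet).2 (Eventually.of_forall fun y hy => ?_)
  have e1 := s3 _ (s1 hy)
  rw [s6 y hy] at e1
  have e2 := (s2 y hy).inv_eq hc (s4 _ (s1 hy))
  rw [fderiv_eq_matrixCLM, ← Matrix.inv_eq_right_inv (s5 y hy), e2, ← e1]

/-- Convergence of the components of the metrics in the identity `G s = (Q s)^* L s`. -/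
theorem tendsto_pullback (h : IsometryFamily D D' P Q L G) {DQ : E4 → E4 →L[ℝ] E4} {K : Set E4}
    (hKD : K ⊆ D') (hK : IsCompact K)
    (hDQ : LpAllTendsto (volume.restrict K) (𝓝[>] 0) (fun s => fderiv ℝ (Q s)) DQ)
    (α β : Fin 4) :
    LpAllTendsto (volume.restrict K) (𝓝[>] 0) (fun s y => G s y α β) fun y =>
      ∑ i, ∑ j, DQ y (EuclideanSpace.single α 1) i * DQ y (EuclideanSpace.single β 1) j *
        L 0 (Q 0 y) i j := by
  have h1 := fun i j => h.tendsto_comp (f := fun s x => L s x i j) (f₀ := fun x => L 0 x i j)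
    (fun K hKD hK => h.convL K hKD hK i j) hKD hK
  have h2 := LpAllTendsto.sum Finset.univ fun i _ => LpAllTendsto.sum Finset.univ fun j _ =>
    ((hDQ.jac_apply i α).mul (hDQ.jac_apply j β)).mul (h1 i j)
  refine h2.congr ?_ (ae_eq_refl _)
  obtain ⟨B, hBD, hB, -, hm⟩ := h.exists_mapsTo' hKD hK
  filter_upwards [hm, h.isometry B hBD hB, h.eventually_jac_mul_jac' hKD hK, h.right K hKD hK]
    with s s1 s2 s3 s4
  refine (ae_restrict_iff' hK.measurableSet).2 (Eventually.of_forall fun y hy => ?_)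
  have e1 := s2 _ (s1 hy)
  rw [s4 y hy] at e1
  -- Multiplying `L = Jᵀ G J` on both sides by the Jacobian of `Q s` and its transpose inverts the
  -- pullback relation.
  have e2 : (jac (Q s) y).transpose * L s (Q s y) * jac (Q s) y = G s y := by
    rw [e1]
    have e3 := s3 y hy
    have e4 := congrArg Matrix.transpose e3
    rw [Matrix.transpose_mul, Matrix.transpose_one] at e4
    calc _ = ((jac (Q s) y).transpose * (jac (P s) (Q s y)).transpose) * G s y *
          (jac (P s) (Q s y) * jac (Q s) y) := by simp only [Matrix.mul_assoc]
      _ = _ := by rw [e3, e4, Matrix.one_mul, Matrix.mul_one]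
  have e5 := congrFun (congrFun e2 α) β
  refine Eq.trans ?_ e5
  simp only [Matrix.mul_apply, Matrix.transpose_apply, Finset.sum_mul]
  rw [Finset.sum_comm]
  exact Finset.sum_congr rfl fun i _ => Finset.sum_congr rfl fun j _ => by ring

theorem tendstoW1p {A : Set E4} (h : IsometryFamily D D' P Q L G) {DP : E4 → E4 →L[ℝ] E4}
    (hDP : ∀ K ⊆ D, IsCompact K →
      LpAllTendsto (volume.restrict K) (𝓝[>] 0) (fun s => fderiv ℝ (P s)) DP)
    (hA : A ⊆ D) (hAc : IsCompact A) {p : ℝ≥0∞} (hp : 1 ≤ p) (hp' : p ≠ ⊤) :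
    TendstoW1p p A P (P 0) DP := by
  have h1 := hDP A hA hAc
  have h2 := LpAllTendsto.of_tendstoUniformlyOn (μ := volume) hAc (h.tendstoP A hA hAc)
    ((h.smoothP A hA hAc).mono fun s hs x hx => (hs x hx).continuousAt.continuousWithinAt)
  exact ⟨h2.memLp p hp hp', h1.memLp p hp hp', h2.tendsto p hp hp', h1.tendsto p hp hp'⟩

theorem tendstoW1p' {A : Set E4} (h : IsometryFamily D D' P Q L G) {DQ : E4 → E4 →L[ℝ] E4}
    (hDQ : ∀ K ⊆ D', IsCompact K →
      LpAllTendsto (volume.restrict K) (𝓝[>] 0) (fun s => fderiv ℝ (Q s)) DQ)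
    (hA : A ⊆ D') (hAc : IsCompact A) {p : ℝ≥0∞} (hp : 1 ≤ p) (hp' : p ≠ ⊤) :
    TendstoW1p p A Q (Q 0) DQ := by
  have h1 := hDQ A hA hAc
  have h2 := LpAllTendsto.of_tendstoUniformlyOn (μ := volume) hAc (h.tendstoQ A hA hAc)
    ((h.smoothQ A hA hAc).mono fun s hs x hx => (hs x hx).continuousAt.continuousWithinAt)
  exact ⟨h2.memLp p hp hp', h1.memLp p hp hp', h2.tendsto p hp hp', h1.tendsto p hp hp'⟩

theorem hasWeakDerivOn (h : IsometryFamily D D' P Q L G) {DP : E4 → E4 →L[ℝ] E4}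
    (hDP : ∀ K ⊆ D, IsCompact K →
      LpAllTendsto (volume.restrict K) (𝓝[>] 0) (fun s => fderiv ℝ (P s)) DP) :
    HasWeakDerivOn (P 0) DP D :=
  hasWeakDerivOn_of_tendsto h.isOpen h.contP h.tendstoP
    (fun _ hKD hK => h.eventually_contDiffAt_two hKD hK) hDP

theorem hasWeakDerivOn' (h : IsometryFamily D D' P Q L G) {DQ : E4 → E4 →L[ℝ] E4}
    (hDQ : ∀ K ⊆ D', IsCompact K →
      LpAllTendsto (volume.restrict K) (𝓝[>] 0) (fun s => fderiv ℝ (Q s)) DQ) :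
    HasWeakDerivOn (Q 0) DQ D' :=
  hasWeakDerivOn_of_tendsto h.isOpen' h.contQ h.tendstoQ
    (fun _ hKD hK => h.eventually_contDiffAt_two' hKD hK) hDQ

end IsometryFamily

/-! ### Components of forms and of maps in charts. -/

section Charts

variable {M : Type*} [TopologicalSpace M] [ChartedSpace E4 M] {e e' : OpenPartialHomeomorph M E4}

/-- Every tangent space is modelled on the same `E4`, so vectors can be carried unchanged between
two expressions for the same point, such as `F (e.symm y)` and its image under `e'.symm ∘ e'`. -/
theorem FormField.apply_congr (b : FormField M) {x x' : M} (h : x = x') (v w : E4) :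
    b x (v : TangentSpace (𝓡 4) x) (w : TangentSpace (𝓡 4) x) =
      b x' (v : TangentSpace (𝓡 4) x') (w : TangentSpace (𝓡 4) x') := by
  subst h; rfl

theorem coordVec_sum_smul (e : OpenPartialHomeomorph M E4) (y : E4) (v : E4) :
    (mfderiv (𝓡 4) (𝓡 4) e.symm y v : TangentSpace (𝓡 4) (e.symm y)) =
      ∑ i, v i • coordVec e y i := by
  have h : v = ∑ i, v i • (EuclideanSpace.single i (1 : ℝ) : E4) := by
    conv_lhs => rw [← (EuclideanSpace.basisFun (Fin 4) ℝ).sum_repr v]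
    simp
  have h2 : (mfderiv (𝓡 4) (𝓡 4) e.symm y v : TangentSpace (𝓡 4) (e.symm y)) =
      mfderiv (𝓡 4) (𝓡 4) e.symm y (∑ i, v i • (EuclideanSpace.single i (1 : ℝ) : E4)) :=
    congrArg _ h
  rw [h2]
  exact (map_sum (mfderiv (𝓡 4) (𝓡 4) e.symm y) _ _).trans
    (Finset.sum_congr rfl fun i _ => map_smul (mfderiv (𝓡 4) (𝓡 4) e.symm y) _ _)

/-- The components of a form determine its values. -/
theorem apply_mfderiv_symm (b : FormField M) (e : OpenPartialHomeomorph M E4) (y v w : E4) :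
    b (e.symm y) (mfderiv (𝓡 4) (𝓡 4) e.symm y v) (mfderiv (𝓡 4) (𝓡 4) e.symm y w) =
      ∑ i, ∑ j, v i * w j * metricComp e b y i j := by
  rw [coordVec_sum_smul, coordVec_sum_smul]
  simp only [map_sum, map_smul, LinearMap.sum_apply, LinearMap.smul_apply, smul_eq_mul,
    Finset.mul_sum]
  rw [Finset.sum_comm]
  exact Finset.sum_congr rfl fun i _ => Finset.sum_congr rfl fun j _ => by
    simp only [metricComp, Matrix.of_apply]; ring

theorem dotProduct_metricComp_mulVec (b : FormField M) (e : OpenPartialHomeomorph M E4) (y : E4)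
    (v : Fin 4 → ℝ) :
    v ⬝ᵥ ((metricComp e b y).mulVec v) = b (e.symm y)
      (mfderiv (𝓡 4) (𝓡 4) e.symm y (WithLp.toLp 2 v : E4))
      (mfderiv (𝓡 4) (𝓡 4) e.symm y (WithLp.toLp 2 v : E4)) := by
  rw [apply_mfderiv_symm]
  simp only [dotProduct, Matrix.mulVec, Finset.mul_sum]
  exact Finset.sum_congr rfl fun i _ => Finset.sum_congr rfl fun j _ => by ring

theorem IsSmoothChart.contMDiffOn (he : IsSmoothChart e) :
    ContMDiffOn (𝓡 4) (𝓡 4) ∞ e e.source := contMDiffOn_of_mem_maximalAtlas he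

theorem IsSmoothChart.contMDiffOn_symm (he : IsSmoothChart e) :
    ContMDiffOn (𝓡 4) (𝓡 4) ∞ e.symm e.target := contMDiffOn_symm_of_mem_maximalAtlas he

theorem IsSmoothChart.mdifferentiableAt_symm (he : IsSmoothChart e) {y : E4} (hy : y ∈ e.target) :
    MDifferentiableAt (𝓡 4) (𝓡 4) e.symm y :=
  (he.contMDiffOn_symm.contMDiffAt (e.open_target.mem_nhds hy)).mdifferentiableAt (by simp)

theorem IsSmoothChart.mdifferentiableAt (he : IsSmoothChart e) {x : M} (hx : x ∈ e.source) :
    MDifferentiableAt (𝓡 4) (𝓡 4) e x :=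
  (he.contMDiffOn.contMDiffAt (e.open_source.mem_nhds hx)).mdifferentiableAt (by simp)

theorem IsSmoothChart.mfderiv_symm_ne_zero (he : IsSmoothChart e) {y : E4} (hy : y ∈ e.target)
    {v : E4} (hv : v ≠ 0) :
    (mfderiv (𝓡 4) (𝓡 4) e.symm y v : TangentSpace (𝓡 4) (e.symm y)) ≠ 0 := by
  intro h0
  have h1 := mfderiv_comp (I := 𝓡 4) (I' := 𝓡 4) (I'' := 𝓡 4) y
    (he.mdifferentiableAt (e.map_target hy)) (he.mdifferentiableAt_symm hy)
  have h2 : (e ∘ e.symm) =ᶠ[𝓝 y] id := by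
    filter_upwards [e.open_target.mem_nhds hy] with z hz using e.right_inv hz
  have h3 : mfderiv (𝓡 4) (𝓡 4) (e ∘ e.symm) y v = v := by
    rw [h2.mfderiv_eq, mfderiv_id]; rfl
  rw [h1] at h3
  apply hv
  rw [← h3]
  exact (congrArg (mfderiv (𝓡 4) (𝓡 4) e (e.symm y)) h0).trans (map_zero _)

/-- The chain rule on both sides of `e'.symm ∘ coordMap e e' F = F ∘ e.symm`, which holds near `y`.
-/
theorem mfderiv_symm_coordMap (he : IsSmoothChart e) (he' : IsSmoothChart e') {F : M → M} {y : E4}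
    (hy : y ∈ e.target) (hF : MDifferentiableAt (𝓡 4) (𝓡 4) F (e.symm y))
    (hFy : F (e.symm y) ∈ e'.source) (v : E4) :
    (mfderiv (𝓡 4) (𝓡 4) F (e.symm y) (mfderiv (𝓡 4) (𝓡 4) e.symm y v) : E4) =
      (mfderiv (𝓡 4) (𝓡 4) e'.symm (coordMap e e' F y) (fderiv ℝ (coordMap e e' F) y v) : E4) := by
  have hes := he.mdifferentiableAt_symm hy
  have hFe : MDifferentiableAt (𝓡 4) (𝓡 4) (F ∘ e.symm) y := hF.comp y hes
  have hu : MDifferentiableAt (𝓡 4) (𝓡 4) (coordMap e e' F) y :=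
    (he'.mdifferentiableAt (x := (F ∘ e.symm) y) hFy).comp y hFe
  have huy : coordMap e e' F y ∈ e'.target := e'.map_source hFy
  have h1 := mfderiv_comp (I := 𝓡 4) (I' := 𝓡 4) (I'' := 𝓡 4) y hF hes
  have h2 := mfderiv_comp (I := 𝓡 4) (I' := 𝓡 4) (I'' := 𝓡 4) y
    (he'.mdifferentiableAt_symm huy) hu
  have h3 : (e'.symm ∘ coordMap e e' F) =ᶠ[𝓝 y] F ∘ e.symm := by
    filter_upwards [hFe.continuousAt.preimage_mem_nhds (e'.open_source.mem_nhds hFy)] with z hz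
    exact e'.left_inv hz
  have h4 : (mfderiv (𝓡 4) (𝓡 4) (e'.symm ∘ coordMap e e' F) y v : E4) =
      mfderiv (𝓡 4) (𝓡 4) (F ∘ e.symm) y v := by rw [h3.mfderiv_eq]; rfl
  rw [h1, h2] at h4
  have h5 : mfderiv (𝓡 4) (𝓡 4) (coordMap e e' F) y = fderiv ℝ (coordMap e e' F) y :=
    mfderiv_eq_fderiv
  refine Eq.trans h4.symm ?_
  exact congrArg (fun A : E4 →L[ℝ] E4 =>
    (mfderiv (𝓡 4) (𝓡 4) e'.symm (coordMap e e' F y) (A v) : E4)) h5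

/-- The transformation rule for the components of a pullback. -/
theorem metricComp_pullbackForm (he : IsSmoothChart e) (he' : IsSmoothChart e') {F : M → M} {y : E4}
    (hy : y ∈ e.target) (hF : MDifferentiableAt (𝓡 4) (𝓡 4) F (e.symm y))
    (hFy : F (e.symm y) ∈ e'.source) (b : FormField M) :
    metricComp e (pullbackForm F b) y =
      (jac (coordMap e e' F) y).transpose * metricComp e' b (coordMap e e' F y) *
        jac (coordMap e e' F) y := by
  ext i j
  have h1 : metricComp e (pullbackForm F b) y i j = b (e'.symm (coordMap e e' F y))
      (mfderiv (𝓡 4) (𝓡 4) e'.symm (coordMap e e' F y)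
        (fderiv ℝ (coordMap e e' F) y (EuclideanSpace.single i 1)))
      (mfderiv (𝓡 4) (𝓡 4) e'.symm (coordMap e e' F y)
        (fderiv ℝ (coordMap e e' F) y (EuclideanSpace.single j 1))) := by
    have hpt : F (e.symm y) = e'.symm (coordMap e e' F y) := (e'.left_inv hFy).symm
    refine Eq.trans ?_ (b.apply_congr hpt _ _)
    rw [← mfderiv_symm_coordMap he he' hy hF hFy, ← mfderiv_symm_coordMap he he' hy hF hFy]
    rfl
  rw [h1, apply_mfderiv_symm]
  simp only [Matrix.mul_apply, Matrix.transpose_apply, Finset.sum_mul]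
  rw [Finset.sum_comm]
  exact Finset.sum_congr rfl fun i _ => Finset.sum_congr rfl fun j _ => by
    simp only [jac, Matrix.of_apply]; ring

end Charts

/-! ### Smooth families of maps in charts. -/

section Families

variable {M : Type*} [TopologicalSpace M] [ChartedSpace E4 M]
  {e e' : OpenPartialHomeomorph M E4} {T : ℝ} {F : ℝ → M → M}

theorem IsSmoothMapFamily.contMDiff (hF : IsSmoothMapFamily T F) {s : ℝ} (hs : s ∈ Ioo 0 T) :
    ContMDiff (𝓡 4) (𝓡 4) ∞ (F s) := by
  rw [← contMDiffOn_univ]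
  have h : ContMDiffOn (𝓡 4) ((𝓘(ℝ, ℝ)).prod (𝓡 4)) ∞ (fun x : M => (s, x)) univ :=
    contMDiffOn_const.prodMk contMDiffOn_id
  exact ContMDiffOn.comp (g := fun q : ℝ × M => F q.1 q.2) (t := Ioo 0 T ×ˢ univ) hF h
    fun x _ => ⟨hs, mem_univ _⟩

theorem contMDiffOn_uncurry_symm (he : IsSmoothChart e) (hF : IsSmoothMapFamily T F) :
    ContMDiffOn 𝓘(ℝ, ℝ × E4) (𝓡 4) ∞ (fun q : ℝ × E4 => F q.1 (e.symm q.2))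
      (Ioo 0 T ×ˢ e.target) := by
  have h1 : ContMDiffOn 𝓘(ℝ, ℝ × E4) 𝓘(ℝ, ℝ) ∞ (fun q : ℝ × E4 => q.1) (Ioo 0 T ×ˢ e.target) :=
    contDiff_fst.contMDiff.contMDiffOn
  have h2 : ContMDiffOn 𝓘(ℝ, ℝ × E4) (𝓡 4) ∞ (fun q : ℝ × E4 => e.symm q.2)
      (Ioo 0 T ×ˢ e.target) :=
    he.contMDiffOn_symm.comp (contDiff_snd.contMDiff.contMDiffOn) fun q hq => hq.2
  exact ContMDiffOn.comp hF (h1.prodMk h2) fun q hq => ⟨hq.1, mem_univ _⟩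

theorem isOpen_setOf_coordMap (he : IsSmoothChart e) (hF : IsSmoothMapFamily T F) :
    IsOpen ((Ioo 0 T ×ˢ e.target) ∩ (fun q : ℝ × E4 => F q.1 (e.symm q.2)) ⁻¹' e'.source) :=
  (contMDiffOn_uncurry_symm he hF).continuousOn.isOpen_inter_preimage
    (isOpen_Ioo.prod e.open_target) e'.open_source

theorem contDiffOn_coordMap_uncurry (he : IsSmoothChart e) (he' : IsSmoothChart e')
    (hF : IsSmoothMapFamily T F) :
    ContDiffOn ℝ ∞ (fun q : ℝ × E4 => coordMap e e' (F q.1) q.2)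
      ((Ioo 0 T ×ˢ e.target) ∩ (fun q : ℝ × E4 => F q.1 (e.symm q.2)) ⁻¹' e'.source) := by
  rw [← contMDiffOn_iff_contDiffOn]
  exact he'.contMDiffOn.comp ((contMDiffOn_uncurry_symm he hF).mono inter_subset_left)
    fun q hq => hq.2

theorem contDiffAt_coordMap (he : IsSmoothChart e) (he' : IsSmoothChart e')
    (hF : IsSmoothMapFamily T F) {s : ℝ} (hs : s ∈ Ioo 0 T) {y : E4} (hy : y ∈ e.target)
    (hFy : F s (e.symm y) ∈ e'.source) : ContDiffAt ℝ ∞ (coordMap e e' (F s)) y := by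
  have h1 := (contDiffOn_coordMap_uncurry he he' hF).contDiffAt (x := (s, y))
    ((isOpen_setOf_coordMap he hF).mem_nhds ⟨⟨hs, hy⟩, hFy⟩)
  exact ContDiffAt.comp (f := fun z : E4 => (s, z)) y h1
    (contDiffAt_const.prodMk contDiffAt_id)

/-- Derivatives in coordinates are bounded for `s` in a compact subset of `(0,T)`. -/
theorem exists_norm_fderiv_coordMap_le (he : IsSmoothChart e) (he' : IsSmoothChart e')
    (hF : IsSmoothMapFamily T F) {ε S : ℝ} (hε : 0 < ε) (hS : S < T) {K : Set E4}
    (hK : IsCompact K) (hKe : K ⊆ e.target)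
    (hKF : ∀ s ∈ Icc ε S, ∀ y ∈ K, F s (e.symm y) ∈ e'.source) :
    ∃ C : ℝ, ∀ s ∈ Icc ε S, ∀ y ∈ K, ‖fderiv ℝ (coordMap e e' (F s)) y‖ ≤ C := by
  set O := (Ioo 0 T ×ˢ e.target) ∩ (fun q : ℝ × E4 => F q.1 (e.symm q.2)) ⁻¹' e'.source
  have hO : IsOpen O := isOpen_setOf_coordMap he hF
  have hf := contDiffOn_coordMap_uncurry he he' hF
  have hsub : Icc ε S ×ˢ K ⊆ O := fun q hq =>
    ⟨⟨⟨hε.trans_le hq.1.1, hq.1.2.trans_lt hS⟩, hKe hq.2⟩, hKF _ hq.1 _ hq.2⟩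
  -- The derivative in `y` alone is the joint derivative in `(s, y)` restricted to the second
  -- factor, and is therefore jointly continuous.
  have hc : ContinuousOn (fun q : ℝ × E4 => (fderiv ℝ (fun q : ℝ × E4 =>
      coordMap e e' (F q.1) q.2) q).comp (ContinuousLinearMap.inr ℝ ℝ E4)) O :=
    (hf.continuousOn_fderiv_of_isOpen hO (by simp)).clm_comp continuousOn_const
  obtain ⟨C, hC⟩ := (isCompact_Icc.prod hK).exists_bound_of_continuousOn (hc.mono hsub)
  refine ⟨C, fun s hs y hy => ?_⟩
  have h1 : HasFDerivAt (fun q : ℝ × E4 => coordMap e e' (F q.1) q.2) _ (s, y) :=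
    ((hf.contDiffAt (hO.mem_nhds (hsub ⟨hs, hy⟩))).differentiableAt (by simp)).hasFDerivAt
  have h2 := (HasFDerivAt.comp (f := fun z : E4 => (s, z)) y h1 (hasFDerivAt_prodMk_right s y)).fderiv
  exact (congrArg norm h2).trans_le (hC (s, y) ⟨hs, hy⟩)

end Families

/-! ### Uniform ellipticity, measurability and integrability of the metric components. -/

section Metrics

variable {M : Type*} [TopologicalSpace M] [ChartedSpace E4 M]
  {e e' : OpenPartialHomeomorph M E4} {T : ℝ} {b : ℝ → FormField M}

theorem IsSmoothMetricFamily.contDiffOn_metricComp (hb : IsSmoothMetricFamily T b)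
    (he : IsSmoothChart e) {s : ℝ} (hs : s ∈ Ioo 0 T) (i j : Fin 4) :
    ContDiffOn ℝ ∞ (fun y => metricComp e (b s) y i j) e.target :=
  (hb.smooth e he i j).comp (f := fun y : E4 => (s, y))
    (contDiffOn_const.prodMk contDiffOn_id) fun _ hy => ⟨hs, hy⟩

/-- Through the reference `r`, all members of the family are comparable with one another up to `a²`.
It is then enough to bound the single smooth metric at time `T / 2` on the compact set `K`, and no
regularity of `r` is needed. -/
theorem IsSmoothMetricFamily.exists_isEllipticWith (hb : IsSmoothMetricFamily T b)
    (he : IsSmoothChart e) {a : ℝ} (ha : 0 < a) (hT : 0 < T)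
    {r : ∀ x : M, TangentSpace (𝓡 4) x → ℝ}
    (hr : ∀ s ∈ Ioo 0 T, ∀ (x : M) (v : TangentSpace (𝓡 4) x),
      1 / a * r x v ≤ b s x v v ∧ b s x v v ≤ a * r x v)
    {K : Set E4} (hK : IsCompact K) (hKe : K ⊆ e.target) :
    ∃ c B : ℝ, 0 < c ∧ ∀ s ∈ Ioo 0 T, ∀ y ∈ K, (metricComp e (b s) y).IsEllipticWith c B := by
  set σ : ℝ := T / 2
  have hσ : σ ∈ Ioo 0 T := ⟨by positivity, by simp only [σ]; linarith⟩
  have hcmp : ∀ s ∈ Ioo 0 T, ∀ t ∈ Ioo 0 T, ∀ (x : M) (v : TangentSpace (𝓡 4) x),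
      b t x v v ≤ a ^ 2 * b s x v v := by
    intro s hs t ht x v
    have h1 := (hr s hs x v).1
    have h2 := (hr t ht x v).2
    have h3 : r x v ≤ a * b s x v v := by
      rw [one_div, inv_mul_le_iff₀ ha] at h1; exact h1
    nlinarith
  have hcont : ∀ i j, ContinuousOn (fun y => metricComp e (b σ) y i j) K := fun i j =>
    ((hb.contDiffOn_metricComp he hσ i j).continuousOn).mono hKe
  have hpos : ∀ s ∈ Ioo 0 T, ∀ y ∈ K, ∀ v : Fin 4 → ℝ, v ≠ 0 →
      0 < v ⬝ᵥ ((metricComp e (b s) y).mulVec v) := by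
    intro s hs y hy v hv
    rw [dotProduct_metricComp_mulVec]
    refine hb.pos s hs _ _ (he.mfderiv_symm_ne_zero (hKe hy) fun h => hv ?_)
    ext i
    exact congrFun (congrArg WithLp.ofLp h) i
  obtain ⟨c, hc, hcle⟩ : ∃ c : ℝ, 0 < c ∧ ∀ y ∈ K, ∀ v : Fin 4 → ℝ,
      c * ∑ i, v i ^ 2 ≤ v ⬝ᵥ ((metricComp e (b σ) y).mulVec v) := by
    rcases K.eq_empty_or_nonempty with rfl | hne
    · exact ⟨1, one_pos, by simp⟩
    -- The ellipticity constant at time `T / 2` is the minimum of the quadratic form over `K` times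
    -- the unit sphere, extended to all vectors by homogeneity.
    set q : E4 × E4 → ℝ := fun z => (z.2 : Fin 4 → ℝ) ⬝ᵥ ((metricComp e (b σ) z.1).mulVec z.2)
    have hq : ContinuousOn q (K ×ˢ Metric.sphere (0 : E4) 1) := by
      simp only [q, dotProduct, Matrix.mulVec]
      refine continuousOn_finsetSum _ fun i _ => ContinuousOn.mul (by fun_prop) ?_
      refine continuousOn_finsetSum _ fun j _ => ContinuousOn.mul ?_ (by fun_prop)
      exact (hcont i j).comp continuousOn_fst fun z hz => hz.1
    have hsne : (K ×ˢ Metric.sphere (0 : E4) 1).Nonempty :=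
      hne.prod (NormedSpace.sphere_nonempty.2 zero_le_one)
    obtain ⟨z, hz, hmin⟩ := (hK.prod (isCompact_sphere (0 : E4) 1)).exists_isMinOn hsne hq
    refine ⟨q z, hpos σ hσ z.1 hz.1 _ fun h => ?_, fun y hy v => ?_⟩
    · have h0 : z.2 = 0 := by ext i; exact congrFun h i
      have := hz.2
      simp [h0] at this
    · set w : E4 := WithLp.toLp 2 v
      have hsq : ∑ i, v i ^ 2 = ‖w‖ ^ 2 := by
        rw [EuclideanSpace.norm_sq_eq]; simp [w]
      rcases eq_or_ne w 0 with h0 | h0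
      · have : v = 0 := by ext i; exact congrFun (congrArg WithLp.ofLp h0) i
        simp [this]
      · have hn : 0 < ‖w‖ := norm_pos_iff.2 h0
        have hm : q z ≤ q (y, ‖w‖⁻¹ • w) := isMinOn_iff.1 hmin _ ⟨hy, by
          simp [norm_smul, hn.ne']⟩
        have e1 : q (y, ‖w‖⁻¹ • w) = ‖w‖⁻¹ ^ 2 * (v ⬝ᵥ ((metricComp e (b σ) y).mulVec v)) := by
          have : ((‖w‖⁻¹ • w : E4) : Fin 4 → ℝ) = ‖w‖⁻¹ • v := rfl
          simp only [q, this, Matrix.mulVec_smul, dotProduct_smul, smul_dotProduct, smul_eq_mul]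
          ring
        rw [hsq]
        calc q z * ‖w‖ ^ 2 ≤ ‖w‖⁻¹ ^ 2 * (v ⬝ᵥ ((metricComp e (b σ) y).mulVec v)) * ‖w‖ ^ 2 := by
              rw [← e1]; gcongr
          _ = _ := by field_simp
  choose B hB using fun i => hK.exists_bound_of_continuousOn (hcont i i)
  refine ⟨c / a ^ 2, a ^ 2 * ∑ i, |B i|, by positivity, fun s hs y hy => ⟨?_, fun v => ?_, ?_⟩⟩
  · ext i j
    exact hb.symm s hs _ _ _
  · have h1 := hcle y hy v
    have h2 : v ⬝ᵥ ((metricComp e (b σ) y).mulVec v) ≤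
        a ^ 2 * (v ⬝ᵥ ((metricComp e (b s) y).mulVec v)) := by
      rw [dotProduct_metricComp_mulVec, dotProduct_metricComp_mulVec]
      exact hcmp s hs σ hσ _ _
    rw [div_mul_eq_mul_div, div_le_iff₀ (by positivity)]
    linarith
  · set A := metricComp e (b s) y
    have hdiag : ∀ i, A i i ≤ a ^ 2 * ∑ i, |B i| := by
      intro i
      have h1 : A i i ≤ a ^ 2 * metricComp e (b σ) y i i := hcmp σ hσ s hs _ _
      refine h1.trans (mul_le_mul_of_nonneg_left ?_ (by positivity))
      exact ((le_abs_self _).trans ((hB i y hy).trans (le_abs_self _))).trans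
        (Finset.single_le_sum (f := fun i => |B i|) (fun _ _ => abs_nonneg _) (Finset.mem_univ i))
    have hsymm : ∀ i j, A j i = A i j := fun i j => hb.symm s hs _ _ _
    have hnn : ∀ v : Fin 4 → ℝ, 0 ≤ v ⬝ᵥ (A.mulVec v) := by
      intro v
      rcases eq_or_ne v 0 with h0 | h0
      · simp [h0]
      · exact (hpos s hs y hy v h0).le
    intro i j
    -- Positivity on `e_i ± e_j` bounds the off-diagonal entries by the diagonal ones: `2 |A_ij| ≤
    -- A_ii + A_jj`.
    have h1 := hnn (Pi.single i 1 + Pi.single j 1)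
    have h2 := hnn (Pi.single i 1 - Pi.single j 1)
    simp only [Matrix.mulVec_add, Matrix.mulVec_sub, add_dotProduct, sub_dotProduct,
      dotProduct_add, dotProduct_sub, Matrix.mulVec_single_one, single_one_dotProduct,
      Matrix.col_apply, hsymm i j] at h1 h2
    rw [abs_le]
    constructor <;> linarith [hdiag i, hdiag j]

/-- Cramer's rule: the entries are quotients of determinants, with inverse zero where the
determinant vanishes. -/
theorem aestronglyMeasurable_inv_apply {X : Type*} [MeasurableSpace X] {μ : Measure X}
    {A : X → Matrix (Fin 4) (Fin 4) ℝ} (hA : ∀ i j, AEStronglyMeasurable (fun x => A x i j) μ)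
    (i j : Fin 4) : AEStronglyMeasurable (fun x => (A x)⁻¹ i j) μ := by
  have hdet : ∀ B : X → Matrix (Fin 4) (Fin 4) ℝ,
      (∀ i j, AEStronglyMeasurable (fun x => B x i j) μ) →
      AEStronglyMeasurable (fun x => (B x).det) μ := by
    intro B hB
    simp only [Matrix.det_apply]
    exact Finset.aestronglyMeasurable_fun_sum _ fun τ _ =>
      (Finset.aestronglyMeasurable_fun_prod _ fun k _ => hB _ _).const_smul _
  simp only [Matrix.inv_def, Matrix.smul_apply, Ring.inverse_eq_inv', smul_eq_mul,
    Matrix.adjugate_apply]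
  refine (hdet A hA).inv₀.mul (hdet _ fun k l => ?_)
  rcases eq_or_ne k j with rfl | h
  · simp only [Matrix.updateRow_self]; exact aestronglyMeasurable_const
  · simp only [Matrix.updateRow_ne h]; exact hA k l

theorem eventually_mem_Ioo (hT : 0 < T) : ∀ᶠ s in 𝓝[>] (0 : ℝ), s ∈ Ioo 0 T :=
  Ioo_mem_nhdsGT hT

theorem eventually_aestronglyMeasurable_metricComp (hb : IsSmoothMetricFamily T b) (hT : 0 < T)
    (he : IsSmoothChart e) {K : Set E4} (hK : IsCompact K) (hKe : K ⊆ e.target) :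
    ∀ᶠ s in 𝓝[>] 0, ∀ i j,
      AEStronglyMeasurable (fun y => metricComp e (b s) y i j) (volume.restrict K) := by
  filter_upwards [eventually_mem_Ioo hT] with s hs i j
  exact ((hb.contDiffOn_metricComp he hs i j).continuousOn.mono hKe).aestronglyMeasurable_of_isCompact
    hK hK.measurableSet

theorem lpAllTendsto_metricComp (hb : IsSmoothMetricFamily T b) (hT : 0 < T)
    (h₀ : IsWeakMetric (b 0)) (hlim : TendstoLpLoc b (b 0)) (he : IsSmoothChart e) {K : Set E4}
    (hK : IsCompact K) (hKe : K ⊆ e.target) (i j : Fin 4) :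
    LpAllTendsto (volume.restrict K) (𝓝[>] 0) (fun s y => metricComp e (b s) y i j)
      (fun y => metricComp e (b 0) y i j) where
  aesm := (eventually_aestronglyMeasurable_metricComp hb hT he hK hKe).mono fun _ h => h i j
  memLp p hp hp' := h₀.memLp e he K hKe hK p hp hp' i j
  tendsto p hp hp' := hlim.tendsto e he K hKe hK p hp hp' i j

theorem lpAllTendsto_metricComp_inv (hb : IsSmoothMetricFamily T b) (hT : 0 < T)
    (h₀ : IsWeakMetric (b 0)) (hlim : TendstoLpLoc b (b 0)) (he : IsSmoothChart e) {K : Set E4}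
    (hK : IsCompact K) (hKe : K ⊆ e.target) (i j : Fin 4) :
    LpAllTendsto (volume.restrict K) (𝓝[>] 0) (fun s y => (metricComp e (b s) y)⁻¹ i j)
      (fun y => (metricComp e (b 0) y)⁻¹ i j) where
  aesm := (eventually_aestronglyMeasurable_metricComp hb hT he hK hKe).mono fun _ h =>
    aestronglyMeasurable_inv_apply h i j
  memLp p hp hp' := h₀.memLp_inv e he K hKe hK p hp hp' i j
  tendsto p hp hp' := hlim.tendsto_inv e he K hKe hK p hp hp' i j

/-- Hölder on a set of finite measure lowers the exponent to `2`, the only one that the estimate of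
second derivatives uses. -/
theorem exists_eLpNorm_fderiv_metricComp_le {q : ℝ≥0∞} (hq : 2 ≤ q)
    (hbdd : BoundedW1Loc q T b) (hT : 0 < T) (he : IsSmoothChart e) {K : Set E4}
    (hK : IsCompact K) (hKe : K ⊆ e.target) (i j : Fin 4) : ∃ C : ℝ≥0, ∀ᶠ s in 𝓝[>] 0,
      eLpNorm (fderiv ℝ fun y => metricComp e (b s) y i j) 2 (volume.restrict K) ≤ C := by
  obtain ⟨C, hC⟩ := hbdd e he K hKe hK
  set m : ℝ≥0∞ := (volume.restrict K : Measure E4) univ ^ (1 / (2 : ℝ≥0∞).toReal - 1 / q.toReal)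
  have hm : m ≠ ⊤ := by
    refine ENNReal.rpow_ne_top_of_nonneg ?_ (by simpa using hK.measure_lt_top.ne)
    rcases eq_or_ne q ⊤ with rfl | hq'
    · simp
    · have := ENNReal.toReal_mono hq' hq
      rw [sub_nonneg]
      exact one_div_le_one_div_of_le (by simp) this
  refine ⟨C * m.toNNReal, ?_⟩
  filter_upwards [eventually_mem_Ioo hT] with s hs
  rw [ENNReal.coe_mul, ENNReal.coe_toNNReal hm]
  refine (eLpNorm_le_eLpNorm_mul_rpow_measure_univ hq
    (measurable_fderiv ℝ _).aestronglyMeasurable).trans (mul_le_mul_left (hC s hs i j).2 _)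

end Metrics

/-! ### The family of isometries given by two charts. -/

section Isometries

variable {M : Type*} [MetricSpace M] [ChartedSpace E4 M]
  {e e' : OpenPartialHomeomorph M E4} {T : ℝ}

/-- Locally uniform convergence in coordinates. -/
theorem tendstoUniformlyOn_coordMap {F : ℝ → M → M} (hF0 : Continuous (F 0))
    (hFlim : ∀ K : Set M, IsCompact K → TendstoUniformlyOn F (F 0) (𝓝[>] 0) K) {K : Set E4}
    (hK : IsCompact K) (hKe : K ⊆ e.target ∩ e.symm ⁻¹' (F 0 ⁻¹' e'.source)) :
    TendstoUniformlyOn (fun s => coordMap e e' (F s)) (coordMap e e' (F 0)) (𝓝[>] 0) K ∧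
      ∀ᶠ s in 𝓝[>] 0, ∀ y ∈ K, F s (e.symm y) ∈ e'.source := by
  have : LocallyCompactSpace M := ChartedSpace.locallyCompactSpace E4 M
  have hKM : IsCompact (e.symm '' K) :=
    hK.image_of_continuousOn (e.continuousOn_symm.mono fun y hy => (hKe hy).1)
  obtain ⟨N, hN, hNc, hN0, hNs⟩ := exists_compact_eventually_mapsTo hKM e'.open_source
    (hFlim _ hKM) hF0.continuousOn (by rintro _ ⟨y, hy, rfl⟩; exact (hKe hy).2)
  have huc : UniformContinuousOn e' N :=
    hNc.uniformContinuousOn_of_continuous (e'.continuousOn.mono hN)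
  have h1 := huc.comp_tendstoUniformlyOn_eventually hNs hN0 (hFlim _ hKM)
  refine ⟨(h1.comp e.symm).mono fun y hy => ⟨y, hy, rfl⟩, ?_⟩
  filter_upwards [hNs] with s hs y hy using hN (hs ⟨y, hy, rfl⟩)

/-- The bridge from the manifold to `ℝ⁴`. The two domains are where the limit maps are expressed in
the charts. For `s > 0` on a compact subset this holds only once `s` is small, by locally uniform
convergence. -/
theorem isometryFamily_coordMap (hT : 0 < T) {Φ W : ℝ → M → M} {ℓ g : ℝ → FormField M}
    (hΦ0 : Continuous (Φ 0)) (hW0 : Continuous (W 0))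
    (hWΦ0 : Function.LeftInverse (W 0) (Φ 0)) (hΦW0 : Function.RightInverse (W 0) (Φ 0))
    (hΦlim : ∀ K : Set M, IsCompact K → TendstoUniformlyOn Φ (Φ 0) (𝓝[>] 0) K)
    (hWlim : ∀ K : Set M, IsCompact K → TendstoUniformlyOn W (W 0) (𝓝[>] 0) K)
    (hΦ : IsSmoothMapFamily T Φ) (hW : IsSmoothMapFamily T W)
    (hWΦ : ∀ s ∈ Ioo 0 T, Function.LeftInverse (W s) (Φ s))
    (hΦW : ∀ s ∈ Ioo 0 T, Function.RightInverse (W s) (Φ s))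
    (hℓ : IsSmoothMetricFamily T ℓ) (hg : IsSmoothMetricFamily T g)
    (hℓg : ∀ s ∈ Ioo 0 T, ℓ s = pullbackForm (Φ s) (g s))
    (hℓ0 : IsWeakMetric (ℓ 0)) (hg0 : IsWeakMetric (g 0))
    (hℓlim : TendstoLpLoc ℓ (ℓ 0)) (hglim : TendstoLpLoc g (g 0))
    (hℓbdd : BoundedW1Loc 2 T ℓ) (hgbdd : BoundedW1Loc 4 T g)
    {a : ℝ} (ha : 0 < a) {r : ∀ x : M, TangentSpace (𝓡 4) x → ℝ}
    (hgr : ∀ s ∈ Ioo 0 T, ∀ (x : M) (v : TangentSpace (𝓡 4) x),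
      1 / a * r x v ≤ g s x v v ∧ g s x v v ≤ a * r x v)
    (he : IsSmoothChart e) (he' : IsSmoothChart e') :
    IsometryFamily (e.target ∩ e.symm ⁻¹' (Φ 0 ⁻¹' e'.source))
      (e'.target ∩ e'.symm ⁻¹' (W 0 ⁻¹' e.source)) (fun s => coordMap e e' (Φ s))
      (fun s => coordMap e' e (W s)) (fun s => metricComp e (ℓ s))
      (fun s => metricComp e' (g s)) where
  isOpen := e.isOpen_inter_preimage_symm (e'.open_source.preimage hΦ0)
  isOpen' := e'.isOpen_inter_preimage_symm (e.open_source.preimage hW0)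
  contP := e'.continuousOn.comp
    (hΦ0.comp_continuousOn (e.continuousOn_symm.mono inter_subset_left)) fun _ hy => hy.2
  contQ := e.continuousOn.comp
    (hW0.comp_continuousOn (e'.continuousOn_symm.mono inter_subset_left)) fun _ hy => hy.2
  mapsP y hy := by
    refine ⟨e'.map_source hy.2, ?_⟩
    simp only [coordMap, mem_preimage]
    rw [e'.left_inv hy.2, hWΦ0]
    exact e.map_target hy.1
  mapsQ y hy := by
    refine ⟨e.map_source hy.2, ?_⟩
    simp only [coordMap, mem_preimage]
    rw [e.left_inv hy.2, hΦW0]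
    exact e'.map_target hy.1
  tendstoP K hKD hK := (tendstoUniformlyOn_coordMap hΦ0 hΦlim hK hKD).1
  tendstoQ K hKD hK := (tendstoUniformlyOn_coordMap hW0 hWlim hK hKD).1
  smoothP K hKD hK := by
    filter_upwards [eventually_mem_Ioo hT, (tendstoUniformlyOn_coordMap hΦ0 hΦlim hK hKD).2]
      with s hs h y hy using contDiffAt_coordMap he he' hΦ hs (hKD hy).1 (h y hy)
  smoothQ K hKD hK := by
    filter_upwards [eventually_mem_Ioo hT, (tendstoUniformlyOn_coordMap hW0 hWlim hK hKD).2]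
      with s hs h y hy using contDiffAt_coordMap he' he hW hs (hKD hy).1 (h y hy)
  left K hKD hK := by
    filter_upwards [eventually_mem_Ioo hT, (tendstoUniformlyOn_coordMap hΦ0 hΦlim hK hKD).2]
      with s hs h y hy
    simp only [coordMap]
    rw [e'.left_inv (h y hy), hWΦ s hs, e.right_inv (hKD hy).1]
  right K hKD hK := by
    filter_upwards [eventually_mem_Ioo hT, (tendstoUniformlyOn_coordMap hW0 hWlim hK hKD).2]
      with s hs h y hy
    simp only [coordMap]
    rw [e.left_inv (h y hy), hΦW s hs, e'.right_inv (hKD hy).1]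
  isometry K hKD hK := by
    filter_upwards [eventually_mem_Ioo hT, (tendstoUniformlyOn_coordMap hΦ0 hΦlim hK hKD).2]
      with s hs h y hy
    rw [hℓg s hs]
    exact metricComp_pullbackForm he he' (hKD hy).1
      ((hΦ.contMDiff hs).mdifferentiable (by simp) _) (h y hy) _
  elliptic K hKD hK := by
    obtain ⟨c, B, hc, h⟩ := hg.exists_isEllipticWith he' ha hT hgr hK fun y hy => (hKD hy).1
    exact ⟨c, B, hc, (eventually_mem_Ioo hT).mono fun s hs => h s hs⟩
  diffG K hKD hK := by
    filter_upwards [eventually_mem_Ioo hT] with s hs y hy α β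
    exact ((hg.contDiffOn_metricComp he' hs α β).contDiffAt
      (e'.open_target.mem_nhds (hKD hy).1)).differentiableAt (by simp)
  convL K hKD hK := lpAllTendsto_metricComp hℓ hT hℓ0 hℓlim he hK fun y hy => (hKD hy).1
  convLinv K hKD hK := lpAllTendsto_metricComp_inv hℓ hT hℓ0 hℓlim he hK fun y hy => (hKD hy).1
  convG K hKD hK := lpAllTendsto_metricComp hg hT hg0 hglim he' hK fun y hy => (hKD hy).1
  bddL K hKD hK := exists_eLpNorm_fderiv_metricComp_le le_rfl hℓbdd hT he hK
    fun y hy => (hKD hy).1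
  bddG K hKD hK := exists_eLpNorm_fderiv_metricComp_le (by norm_num) hgbdd hT he' hK
    fun y hy => (hKD hy).1

/-- Uniform bounds in `L^p` for the derivatives in coordinates, up to `s = 0`. -/
theorem exists_eLpNorm_fderiv_coordMap_le {F : ℝ → M → M} (hF : IsSmoothMapFamily T F)
    (he : IsSmoothChart e) (he' : IsSmoothChart e') {S : ℝ} (hS : S < T) {K : Set E4}
    (hK : IsCompact K) (hKe : K ⊆ e.target)
    (hKF : ∀ s ∈ Ioc 0 S, ∀ y ∈ K, F s (e.symm y) ∈ e'.source)
    (hb : LpAllBdd (volume.restrict K) (𝓝[>] 0) fun s => fderiv ℝ (coordMap e e' (F s)))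
    {p : ℝ≥0∞} (hp : 1 ≤ p) (hp' : p ≠ ⊤) : ∃ C : ℝ≥0, ∀ s ∈ Ioc 0 S,
      eLpNorm (fderiv ℝ (coordMap e e' (F s))) p (volume.restrict K) ≤ C := by
  obtain ⟨C₁, hC₁⟩ := hb p hp hp'
  -- The bound along the limit covers `(0, ε)`; on `[ε, S]` joint smoothness and compactness bound
  -- the derivative pointwise.
  obtain ⟨ε, hε, hεC⟩ := mem_nhdsGT_iff_exists_Ioo_subset.1 hC₁
  obtain ⟨C₂, hC₂⟩ := exists_norm_fderiv_coordMap_le he he' hF (ε := ε) hε hS hK hKe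
    fun s hs => hKF s ⟨lt_of_lt_of_le hε hs.1, hs.2⟩
  set m : ℝ≥0∞ := (volume.restrict K : Measure E4) univ ^ p.toReal⁻¹ * ENNReal.ofReal C₂
  have hm : m ≠ ⊤ := ENNReal.mul_ne_top
    (ENNReal.rpow_ne_top_of_nonneg (by positivity) (by simpa using hK.measure_lt_top.ne))
    ENNReal.ofReal_ne_top
  refine ⟨C₁ + m.toNNReal, fun s hs => ?_⟩
  rw [ENNReal.coe_add, ENNReal.coe_toNNReal hm]
  rcases lt_or_ge s ε with h | h
  · exact (hεC ⟨hs.1, h⟩ : _ ≤ _).trans le_self_add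
  · refine (eLpNorm_le_of_ae_bound (C := C₂) ?_).trans le_add_self
    exact (ae_restrict_iff' hK.measurableSet).2 (Eventually.of_forall fun y hy =>
      hC₂ s ⟨h, hs.2⟩ y hy)

end Isometries

/-! ### Restriction to subsets, and the main theorem. -/

theorem HasWeakDerivOn.mono {u : E4 → E4} {G : E4 → E4 →L[ℝ] E4} {Ω Ω' : Set E4}
    (h : HasWeakDerivOn u G Ω) (hΩ : Ω' ⊆ Ω) : HasWeakDerivOn u G Ω' where
  locInt := h.locInt.mono_set hΩ
  locInt_deriv := h.locInt_deriv.mono_set hΩ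
  integral_eq η h1 h2 h3 := h.integral_eq η h1 h2 (h3.trans hΩ)

theorem TendstoW1p.mono {p : ℝ≥0∞} {A B : Set E4} {u : ℝ → E4 → E4} {u₀ : E4 → E4}
    {G₀ : E4 → E4 →L[ℝ] E4} (h : TendstoW1p p B u u₀ G₀) (hAB : A ⊆ B) :
    TendstoW1p p A u u₀ G₀ where
  memLp := h.memLp.mono_measure (Measure.restrict_mono hAB le_rfl)
  memLp_deriv := h.memLp_deriv.mono_measure (Measure.restrict_mono hAB le_rfl)
  tendsto := tendsto_of_tendsto_of_tendsto_of_le_of_le tendsto_const_nhds h.tendsto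
    (fun _ => zero_le) fun _ => eLpNorm_mono_measure _ (Measure.restrict_mono hAB le_rfl)
  tendsto_deriv := tendsto_of_tendsto_of_tendsto_of_le_of_le tendsto_const_nhds h.tendsto_deriv
    (fun _ => zero_le) fun _ => eLpNorm_mono_measure _ (Measure.restrict_mono hAB le_rfl)

/-- If `F` maps `A` into a set compactly contained in the domain of `e'`, then the closure of `A`, in
the coordinates `e`, is a compact set on which `F` is expressed in the coordinates `e`, `e'`. -/
theorem CompactlyIn.map_mem_source {M : Type*} [TopologicalSpace M]
    {e e' : OpenPartialHomeomorph M E4} {A : Set M} (hA : CompactlyIn A e.source) {F : M → M}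
    (hF : Continuous F) (hFA : CompactlyIn (F '' A) e'.source) {y : E4} (hy : y ∈ e '' closure A) :
    y ∈ e.target ∧ F (e.symm y) ∈ e'.source := by
  obtain ⟨x, hx, rfl⟩ := hy
  have hxe := hA.2 hx
  refine ⟨e.map_source hxe, ?_⟩
  rw [e.left_inv hxe]
  exact hFA.2 (image_closure_subset_closure_image hF ⟨x, hx, rfl⟩)

theorem mainTheorem9
    {M : Type*} [MetricSpace M] [ChartedSpace E4 M] [IsManifold (𝓡 4) ∞ M]
    [RiemannianBundle (fun x : M => TangentSpace (𝓡 4) x)]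
    [IsContMDiffRiemannianBundle (𝓡 4) ∞ E4 (fun x : M => TangentSpace (𝓡 4) x)]
    [IsRiemannianManifold (𝓡 4) M] [CompleteSpace M] [ConnectedSpace M]
    (T : ℝ) (hT : 0 < T) (Φ W : ℝ → M → M) (ℓ g : ℝ → FormField M)
    -- the limit homeomorphisms
    (hΦ0 : Continuous (Φ 0)) (hW0 : Continuous (W 0))
    (hWΦ0 : Function.LeftInverse (W 0) (Φ 0)) (hΦW0 : Function.RightInverse (W 0) (Φ 0))
    (hΦlim : ∀ K : Set M, IsCompact K → TendstoUniformlyOn Φ (Φ 0) (𝓝[>] 0) K)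
    (hWlim : ∀ K : Set M, IsCompact K → TendstoUniformlyOn W (W 0) (𝓝[>] 0) K)
    -- the diffeomorphisms
    (hΦ : IsSmoothMapFamily T Φ) (hW : IsSmoothMapFamily T W)
    (hWΦ : ∀ s ∈ Ioo 0 T, Function.LeftInverse (W s) (Φ s))
    (hΦW : ∀ s ∈ Ioo 0 T, Function.RightInverse (W s) (Φ s))
    -- the metrics
    (hℓ : IsSmoothMetricFamily T ℓ) (hg : IsSmoothMetricFamily T g)
    (hℓg : ∀ s ∈ Ioo 0 T, ℓ s = pullbackForm (Φ s) (g s))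
    (hgℓ : ∀ s ∈ Ioo 0 T, g s = pullbackForm (W s) (ℓ s))
    (hℓ0 : IsWeakMetric (ℓ 0)) (hg0 : IsWeakMetric (g 0))
    (hℓlim : TendstoLpLoc ℓ (ℓ 0)) (hglim : TendstoLpLoc g (g 0))
    (hℓbdd : BoundedW1Loc 2 T ℓ) (hgbdd : BoundedW1Loc 4 T g)
    (a : ℝ) (ha : 1 ≤ a)
    (hgh : ∀ s ∈ Ioo 0 T, ∀ (x : M) (v : TangentSpace (𝓡 4) x),
      1 / a * inner ℝ v v ≤ g s x v v ∧ g s x v v ≤ a * inner ℝ v v) :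
    TendstoW1Loc Φ (Φ 0) ∧ TendstoW1Loc W (W 0) ∧
    ∀ (φ ψ : OpenPartialHomeomorph M E4), IsSmoothChart φ → IsSmoothChart ψ →
    ∀ (U' V' : Set M), IsOpen U' → IsOpen V' → CompactlyIn U' φ.source → CompactlyIn V' ψ.source →
    ∀ S : ℝ, 0 < S → S < T →
      (∀ s ∈ Icc 0 S, CompactlyIn (W s '' V') φ.source) →
      (∀ s ∈ Icc 0 S, CompactlyIn (Φ s '' U') ψ.source) →
      (∀ s ∈ Icc 0 S, CompactlyIn (W s '' ψ.source) φ.source) →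
      -- uniform `L^p` bounds for the derivatives
      (∀ p : ℝ≥0∞, 1 ≤ p → p ≠ ⊤ → ∃ C : ℝ≥0, ∀ s ∈ Ioc 0 S,
        eLpNorm (fderiv ℝ (coordMap φ ψ (Φ s))) p (volume.restrict (φ '' U')) ≤ C ∧
        eLpNorm (fderiv ℝ (coordMap ψ φ (W s))) p (volume.restrict (ψ '' V')) ≤ C) ∧
      -- convergence of `Φ s` in `W^{1,p}`
      (∃ DΦ0 : E4 → E4 →L[ℝ] E4, HasWeakDerivOn (coordMap φ ψ (Φ 0)) DΦ0 (φ '' U') ∧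
        ∀ p : ℝ≥0∞, 1 ≤ p → p ≠ ⊤ →
          TendstoW1p p (φ '' U') (fun s => coordMap φ ψ (Φ s)) (coordMap φ ψ (Φ 0)) DΦ0) ∧
      -- `ℓ 0 ∘ W 0` is in `L^p_loc`
      (∀ K ⊆ ψ.target, IsCompact K → ∀ p : ℝ≥0∞, 1 ≤ p → p ≠ ⊤ → ∀ i j,
        MemLp (fun y => metricComp φ (ℓ 0) (coordMap ψ φ (W 0) y) i j) p (volume.restrict K)) ∧
      -- convergence of `W s` in `W^{1,p}`, and the isometry of the limit metrics
      (∃ DW0 : E4 → E4 →L[ℝ] E4, HasWeakDerivOn (coordMap ψ φ (W 0)) DW0 (ψ '' V') ∧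
        (∀ p : ℝ≥0∞, 1 ≤ p → p ≠ ⊤ →
          TendstoW1p p (ψ '' V') (fun s => coordMap ψ φ (W s)) (coordMap ψ φ (W 0)) DW0) ∧
        ∀ α β : Fin 4,
          (∀ᵐ y ∂(volume.restrict (ψ '' V')), metricComp ψ (g 0) y α β =
            ∑ i, ∑ j, DW0 y (EuclideanSpace.single α 1) i * DW0 y (EuclideanSpace.single β 1) j *
              metricComp φ (ℓ 0) (coordMap ψ φ (W 0) y) i j) ∧
          ∀ p : ℝ≥0∞, 1 ≤ p → p ≠ ⊤ →
            MemLp (fun y => metricComp ψ (g 0) y α β) p (volume.restrict (ψ '' V')) ∧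
            MemLp (fun y => ∑ i, ∑ j, DW0 y (EuclideanSpace.single α 1) i *
              DW0 y (EuclideanSpace.single β 1) j *
              metricComp φ (ℓ 0) (coordMap ψ φ (W 0) y) i j) p (volume.restrict (ψ '' V'))) := by
  have ha0 : 0 < a := zero_lt_one.trans_le ha
  have fam : ∀ e e' : OpenPartialHomeomorph M E4, IsSmoothChart e → IsSmoothChart e' → _ :=
    fun e e' he he' => isometryFamily_coordMap (e := e) (e' := e') hT hΦ0 hW0 hWΦ0 hΦW0 hΦlim
      hWlim hΦ hW hWΦ hΦW hℓ hg hℓg hℓ0 hg0 hℓlim hglim hℓbdd hgbdd ha0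
      (r := fun _ v => inner ℝ v v) hgh he he'
  refine ⟨fun e e' he he' => ?_, fun e e' he he' => ?_, ?_⟩
  · have h := fam e e' he he'
    obtain ⟨DP, hDP⟩ := h.exists_tendsto_fderiv
    exact ⟨DP, h.hasWeakDerivOn hDP, fun K hKD hK p hp hp' => h.tendstoW1p hDP hKD hK hp hp'⟩
  -- The charts are interchanged: `W` read from `e` to `e'` is the inverse of `Φ` read from `e'` to
  -- `e`.
  · have h := fam e' e he' he
    obtain ⟨DQ, hDQ⟩ := h.exists_tendsto_fderiv'
    exact ⟨DQ, h.hasWeakDerivOn' hDQ, fun K hKD hK p hp hp' => h.tendstoW1p' hDQ hKD hK hp hp'⟩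
  intro φ ψ hφ hψ U' V' _ _ hU' hV' S hS hST hWV hΦU hWψ
  have h := fam φ ψ hφ hψ
  obtain ⟨DP, hDP⟩ := h.exists_tendsto_fderiv
  obtain ⟨DQ, hDQ⟩ := h.exists_tendsto_fderiv'
  have hΦc : ∀ s ∈ Icc 0 S, Continuous (Φ s) := fun s hs => by
    rcases hs.1.eq_or_lt with rfl | h0
    · exact hΦ0
    · exact (hΦ.contMDiff ⟨h0, hs.2.trans_lt hST⟩).continuous
  have hWc : ∀ s ∈ Icc 0 S, Continuous (W s) := fun s hs => by
    rcases hs.1.eq_or_lt with rfl | h0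
    · exact hW0
    · exact (hW.contMDiff ⟨h0, hs.2.trans_lt hST⟩).continuous
  have hKU : IsCompact (φ '' closure U') := hU'.1.image_of_continuousOn (φ.continuousOn.mono hU'.2)
  have hKV : IsCompact (ψ '' closure V') := hV'.1.image_of_continuousOn (ψ.continuousOn.mono hV'.2)
  have hUs : φ '' U' ⊆ φ '' closure U' := image_mono subset_closure
  have hVs : ψ '' V' ⊆ ψ '' closure V' := image_mono subset_closure
  have hΦs : ∀ s ∈ Icc 0 S, ∀ y ∈ φ '' closure U', y ∈ φ.target ∧ Φ s (φ.symm y) ∈ ψ.source :=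
    fun s hs y hy => hU'.map_mem_source (hΦc s hs) (hΦU s hs) hy
  have hWs : ∀ s ∈ Icc 0 S, ∀ y ∈ ψ '' closure V', y ∈ ψ.target ∧ W s (ψ.symm y) ∈ φ.source :=
    fun s hs y hy => hV'.map_mem_source (hWc s hs) (hWV s hs) hy
  have h00 : (0 : ℝ) ∈ Icc 0 S := left_mem_Icc.2 hS.le
  have hUD : φ '' closure U' ⊆ φ.target ∩ φ.symm ⁻¹' (Φ 0 ⁻¹' ψ.source) := hΦs 0 h00
  have hVD : ψ '' closure V' ⊆ ψ.target ∩ ψ.symm ⁻¹' (W 0 ⁻¹' φ.source) := hWs 0 h00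
  have hpull := h.tendsto_pullback hVD hKV (hDQ _ hVD hKV)
  have hGV := h.convG _ hVD hKV
  have hrV : (volume.restrict (ψ '' V') : Measure E4) ≤ volume.restrict (ψ '' closure V') :=
    Measure.restrict_mono hVs le_rfl
  refine ⟨fun p hp hp' => ?_, ⟨DP, (h.hasWeakDerivOn hDP).mono (hUs.trans hUD),
    fun p hp hp' => (h.tendstoW1p hDP hUD hKU hp hp').mono hUs⟩,
    fun K hK hKc p hp hp' i j => ?_, ⟨DQ, (h.hasWeakDerivOn' hDQ).mono (hVs.trans hVD),
    fun p hp hp' => (h.tendstoW1p' hDQ hVD hKV hp hp').mono hVs, fun α β => ⟨?_,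
    fun p hp hp' => ⟨?_, ?_⟩⟩⟩⟩
  · obtain ⟨C₁, hC₁⟩ := exists_eLpNorm_fderiv_coordMap_le hΦ hφ hψ hST hKU
      (fun y hy => (hUD hy).1) (fun s hs y hy => (hΦs s ⟨hs.1.le, hs.2⟩ y hy).2)
      (hDP _ hUD hKU).bdd hp hp'
    obtain ⟨C₂, hC₂⟩ := exists_eLpNorm_fderiv_coordMap_le hW hψ hφ hST hKV
      (fun y hy => (hVD hy).1) (fun s hs y hy => (hWs s ⟨hs.1.le, hs.2⟩ y hy).2)
      (hDQ _ hVD hKV).bdd hp hp'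
    refine ⟨max C₁ C₂, fun s hs => ⟨?_, ?_⟩⟩
    · exact (eLpNorm_mono_measure _ (Measure.restrict_mono hUs le_rfl)).trans
        ((hC₁ s hs).trans (by exact_mod_cast le_max_left _ _))
    · exact (eLpNorm_mono_measure _ hrV).trans
        ((hC₂ s hs).trans (by exact_mod_cast le_max_right _ _))
  -- Since `W 0` maps the whole domain of `ψ` into that of `φ`, every compact subset of `ψ.target`
  -- is admissible for the composition result.
  · have hKD : K ⊆ ψ.target ∩ ψ.symm ⁻¹' (W 0 ⁻¹' φ.source) := fun y hy =>
      ⟨hK hy, (hWψ 0 h00).2 (subset_closure ⟨_, ψ.map_target (hK hy), rfl⟩)⟩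
    exact (h.tendsto_comp (f := fun s x => metricComp φ (ℓ s) x i j)
      (f₀ := fun x => metricComp φ (ℓ 0) x i j)
      (fun K hKD hK => h.convL K hKD hK i j) hKD hKc).memLp p hp hp'
  -- The components of `g s` converge both to those of `g 0` and to the pulled-back components of `ℓ
  -- 0`; limits in `L^p` are unique.
  · exact ae_mono hrV ((hGV α β).unique (hpull α β))
  · exact ((hGV α β).memLp p hp hp').mono_measure hrV
  · exact ((hpull α β).memLp p hp hp').mono_measure hrV
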